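/- Let $\Bbbk$ be a field, $k\ge 1$ an integer and $d\in\mathbb Z$. All operads are symmetric operads with unit in $\mathbb Z$-graded $\Bbbk$-vector spaces (with the Koszul sign rule); write $\mathcal P(I)$ for the operations with inputs marked by a finite set $I$, and $\mathcal P(n)=\mathcal P(\{1,\dots,n\})$. Let $\mathsf{Pois}^k_d$ be the operad generated by a binary operation $\mu$ of degree $0$ and a $(k+1)$-ary operation $\nu$ of degree $1-kd$, subject to the following relations: (1) $\mu$ is commutative and associative; (2) $\sigma\cdot\nu=\operatorname{sgn}(\sigma)^d\,\nu$ for all $\sigma\in\mathbb S_{k+1}$; (3) (generalized Jacobi identity) $\sum_\sigma \nu(\nu(x_{\sigma(1)},\dots,x_{\sigma(k+1)}),x_{\sigma(k+2)},\dots,x_{\sigma(2k+1)})=0$, where $\sigma$ runs over even representatives of the cosets $\mathbb S_{2k+1}/(\mathbb S_{k+1}\times\mathbb S_k)$; (4) (Leibniz identity) $\nu(x_1,\dots,x_k,\mu(a,b))=\mu(\nu(x_1,\dots,x_k,a),b)+\mu(\nu(x_1,\dots,x_k,b),a)$, as an identity of operations (Koszul signs appear when it is evaluated on graded elements). In particular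 $\mathsf{Pois}^k_d(\varnothing)=0$. The tensor product of operads is $(\mathcal P\otimes\mathcal Q)(I)=\mathcal P(I)\otimes\mathcal Q(I)$ with partial compositions $(a\otimes a')\circ_i(b\otimes b')=(-1)^{|a'||b|}(a\circ_i b)\otimes(a'\circ_i b')$. Let $\mu^{\circ n}\in\mathsf{Pois}^k_d(n+1)$ be the $n$-fold iterated product $\mu(x_1,\mu(x_2,\dots,\mu(x_n,x_{n+1})))$. Let $\mathsf{Com}$ be the operad of commutative associative algebras, with $\mathsf{Com}(I)=\Bbbk$ in degree $0$ for $I\ne\varnothing$ and $\mathsf{Com}(\varnothing)=0$. Then there is a unique morphism of operads $\Delta:\mathsf{Pois}^k_d\to\mathsf{Pois}^k_d\otimes\mathsf{Pois}^k_d$ such that $$\Delta(\mu)=\mu\otimes\mu,\qquad \Delta(\nu)=\mu^{\circ k}\otimes\nu+\nu\otimes\mu^{\circ k}.$$ Moreover: (a) $\Delta$ is a Hopf structure: it makes every $\mathsf{Pois}^k_d(I)$ a coassociative and graded cocommutative coalgebra. (b) This Hopf operad is unital and augmented: there are morphisms of operads $\varepsilon:\mathsf{Pois}^k_d\to\mathsf{Com}$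 and $\eta:\mathsf{Com}\to\mathsf{Pois}^k_d$ such that $\varepsilon$ is surjective and is a counit for $\Delta$, $\varepsilon\circ\eta=\mathrm{id}$, $\eta$ is compatible with the comultiplications (that is, $\Delta(\eta(1))=\eta(1)\otimes\eta(1)$ for $1\in\mathsf{Com}(I)$, $I\neq\varnothing$), and $\eta$ sends the commutative product $1\in\mathsf{Com}(2)$ to $\mu$. (c) $\nu$ is a primitive generator: $\nu$ is primitive, i.e. $\Delta(\nu)=\mu^{\circ k}\otimes\nu+\nu\otimes\mu^{\circ k}$, and the only suboperad of $\mathsf{Pois}^k_d$ that contains $\mu$ and $\nu$ is $\mathsf{Pois}^k_d$ itself. -/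

import Mathlib

open scoped TensorProduct DirectSum

universe u v w

noncomputable section

/-! ### Graded vector spaces and the Koszul sign rule -/

section Graded

/-- The scalar `(-1) ^ n`. -/
def zsign (𝕜 : Type u) [Field 𝕜] (n : ℤ) : 𝕜 := ((n.negOnePow : ℤ) : 𝕜)

theorem zsign_add (𝕜 : Type u) [Field 𝕜] (m n : ℤ) :
    zsign 𝕜 (m + n) = zsign 𝕜 m * zsign 𝕜 n := by
  simp [zsign, Int.negOnePow_add]

theorem zsign_zero (𝕜 : Type u) [Field 𝕜] : zsign 𝕜 0 = 1 := by simp [zsign]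

theorem zsign_eq (𝕜 : Type u) [Field 𝕜] {m n : ℤ} (h : Even (m - n)) :
    zsign 𝕜 m = zsign 𝕜 n := by
  rw [zsign, zsign, (Int.negOnePow_eq_iff m n).2 h]

/-- The isomorphism of a graded vector space with the direct sum of its homogeneous parts. -/
def gradedEquiv {𝕜 : Type u} [Field 𝕜] {M : Type v} [AddCommGroup M] [Module 𝕜 M]
    {A : ℤ → Submodule 𝕜 M} (hA : DirectSum.IsInternal A) : (⨁ i, A i) ≃ₗ[𝕜] M :=
  LinearEquiv.ofBijective (DirectSum.coeLinearMap A) (show Function.Bijective _ from hA)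

theorem gradedEquiv_lof {𝕜 : Type u} [Field 𝕜] {M : Type v} [AddCommGroup M] [Module 𝕜 M]
    {A : ℤ → Submodule 𝕜 M} (hA : DirectSum.IsInternal A) {p : ℤ} (a : A p) :
    gradedEquiv hA (DirectSum.lof 𝕜 ℤ (fun i => A i) p a) = a :=
  DirectSum.coeLinearMap_lof A p a

theorem gradedEquiv_symm {𝕜 : Type u} [Field 𝕜] {M : Type v} [AddCommGroup M] [Module 𝕜 M]
    {A : ℤ → Submodule 𝕜 M} (hA : DirectSum.IsInternal A) {p : ℤ} {a : M} (ha : a ∈ A p) :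
    (gradedEquiv hA).symm a = DirectSum.lof 𝕜 ℤ (fun i => A i) p ⟨a, ha⟩ := by
  rw [LinearEquiv.symm_apply_eq, gradedEquiv_lof]

/-- The symmetry `M ⊗ N → N ⊗ M` of `ℤ`-graded vector spaces, with the Koszul sign:
`a ⊗ b ↦ (-1) ^ (|a| |b|) b ⊗ a` (see `koszulSwap_tmul`). -/
def koszulSwap {𝕜 : Type u} [Field 𝕜] {M : Type v} {N : Type w}
    [AddCommGroup M] [Module 𝕜 M] [AddCommGroup N] [Module 𝕜 N]
    {A : ℤ → Submodule 𝕜 M} {B : ℤ → Submodule 𝕜 N}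
    (hA : DirectSum.IsInternal A) (hB : DirectSum.IsInternal B) :
    M ⊗[𝕜] N →ₗ[𝕜] N ⊗[𝕜] M :=
  (TensorProduct.congr (gradedEquiv hB) (gradedEquiv hA)).toLinearMap ∘ₗ
    (TensorProduct.gradedComm 𝕜 (fun i => A i) (fun i => B i)).toLinearMap ∘ₗ
      (TensorProduct.congr (gradedEquiv hA).symm (gradedEquiv hB).symm).toLinearMap

theorem koszulSwap_tmul {𝕜 : Type u} [Field 𝕜] {M : Type v} {N : Type w}
    [AddCommGroup M] [Module 𝕜 M] [AddCommGroup N] [Module 𝕜 N]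
    {A : ℤ → Submodule 𝕜 M} {B : ℤ → Submodule 𝕜 N}
    (hA : DirectSum.IsInternal A) (hB : DirectSum.IsInternal B)
    {p q : ℤ} {a : M} {b : N} (ha : a ∈ A p) (hb : b ∈ B q) :
    koszulSwap hA hB (a ⊗ₜ b) = zsign 𝕜 (p * q) • (b ⊗ₜ[𝕜] a) := by
  have h3 : ((-1 : ℤˣ) ^ (q * p)) = (p * q).negOnePow := by
    rw [mul_comm]; rfl
  simp only [koszulSwap, LinearMap.comp_apply, LinearEquiv.coe_coe, TensorProduct.congr_tmul,
    gradedEquiv_symm hA ha, gradedEquiv_symm hB hb, TensorProduct.gradedComm_of_tmul_of, h3]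
  rw [zsign, Units.smul_def, ← Int.cast_smul_eq_zsmul 𝕜, map_smul, TensorProduct.congr_tmul,
    gradedEquiv_lof, gradedEquiv_lof]

/-- The degree `r` part of `M ⊗ N`, spanned by the `a ⊗ b` with `|a| + |b| = r`. -/
def tensorDeg {𝕜 : Type u} [Field 𝕜] {M : Type v} {N : Type w}
    [AddCommGroup M] [Module 𝕜 M] [AddCommGroup N] [Module 𝕜 N]
    (A : ℤ → Submodule 𝕜 M) (B : ℤ → Submodule 𝕜 N) (r : ℤ) : Submodule 𝕜 (M ⊗[𝕜] N) :=
  Submodule.span 𝕜 {x | ∃ p q a b, p + q = r ∧ a ∈ A p ∧ b ∈ B q ∧ a ⊗ₜ[𝕜] b = x}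

theorem isInternal_of_linearMap {𝕜 : Type u} [Field 𝕜] {M : Type v}
    [AddCommGroup M] [Module 𝕜 M] (A : ℤ → Submodule 𝕜 M) (f : M →ₗ[𝕜] ⨁ i, A i)
    (h1 : ∀ x, DirectSum.coeLinearMap A (f x) = x)
    (h2 : ∀ i (x : A i), f x = DirectSum.lof 𝕜 ℤ (fun i => A i) i x) :
    DirectSum.IsInternal A := by
  have h3 : f ∘ₗ DirectSum.coeLinearMap A = LinearMap.id := by
    apply DirectSum.linearMap_ext
    intro i
    ext1 x
    simp [h2]
  refine ⟨fun x y h => ?_, fun x => ⟨f x, h1 x⟩⟩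
  have hx := LinearMap.congr_fun h3 x
  have hy := LinearMap.congr_fun h3 y
  simp only [LinearMap.comp_apply, LinearMap.id_apply] at hx hy
  rw [← hx, ← hy]
  exact congrArg f h

theorem homogeneous_induction {𝕜 : Type u} [Field 𝕜] {M : Type v}
    [AddCommGroup M] [Module 𝕜 M] {A : ℤ → Submodule 𝕜 M} (hA : DirectSum.IsInternal A)
    {C : M → Prop} (h0 : C 0) (hadd : ∀ x y, C x → C y → C (x + y))
    (hC : ∀ p, ∀ x ∈ A p, C x) (x : M) : C x := by
  have hx : x ∈ iSup A := by rw [hA.submodule_iSup_eq_top]; trivial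
  exact Submodule.iSup_induction A (motive := C) hx hC h0 hadd

theorem tensor_homogeneous_induction {𝕜 : Type u} [Field 𝕜] {M : Type v} {N : Type w}
    [AddCommGroup M] [Module 𝕜 M] [AddCommGroup N] [Module 𝕜 N]
    {A : ℤ → Submodule 𝕜 M} {B : ℤ → Submodule 𝕜 N}
    (hA : DirectSum.IsInternal A) (hB : DirectSum.IsInternal B)
    {C : M ⊗[𝕜] N → Prop} (h0 : C 0) (hadd : ∀ x y, C x → C y → C (x + y))
    (hC : ∀ p q, ∀ a ∈ A p, ∀ b ∈ B q, C (a ⊗ₜ b)) (x : M ⊗[𝕜] N) : C x := by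
  induction x using TensorProduct.induction_on with
  | zero => exact h0
  | add x y hx hy => exact hadd x y hx hy
  | tmul a b =>
    refine homogeneous_induction hA (C := fun a => C (a ⊗ₜ b)) (by simpa using h0)
      (fun x y hx hy => by rw [TensorProduct.add_tmul]; exact hadd _ _ hx hy) (fun p a ha => ?_) a
    exact homogeneous_induction hB (C := fun b => C (a ⊗ₜ b)) (by simpa using h0)
      (fun x y hx hy => by rw [TensorProduct.tmul_add]; exact hadd _ _ hx hy)
      (fun q b hb => hC p q a ha b hb) b

theorem tmul_mem_tensorDeg {𝕜 : Type u} [Field 𝕜] {M : Type v} {N : Type w}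
    [AddCommGroup M] [Module 𝕜 M] [AddCommGroup N] [Module 𝕜 N]
    {A : ℤ → Submodule 𝕜 M} {B : ℤ → Submodule 𝕜 N} {p q r : ℤ} {a : M} {b : N}
    (ha : a ∈ A p) (hb : b ∈ B q) (h : p + q = r) : a ⊗ₜ[𝕜] b ∈ tensorDeg A B r :=
  Submodule.subset_span ⟨p, q, a, b, h, ha, hb, rfl⟩

theorem tensorDeg_isInternal {𝕜 : Type u} [Field 𝕜] {M : Type v} {N : Type w}
    [AddCommGroup M] [Module 𝕜 M] [AddCommGroup N] [Module 𝕜 N]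
    {A : ℤ → Submodule 𝕜 M} {B : ℤ → Submodule 𝕜 N}
    (hA : DirectSum.IsInternal A) (hB : DirectSum.IsInternal B) :
    DirectSum.IsInternal (tensorDeg A B) := by
  have hmem : ∀ (i : ℤ × ℤ) (x : A i.1 ⊗[𝕜] B i.2),
      TensorProduct.map (A i.1).subtype (B i.2).subtype x ∈ tensorDeg A B (i.1 + i.2) := by
    intro i x
    induction x using TensorProduct.induction_on with
    | zero => simp
    | add x y hx hy => rw [map_add]; exact add_mem hx hy
    | tmul a b => exact tmul_mem_tensorDeg a.2 b.2 rfl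
  let g : (⨁ i : ℤ × ℤ, A i.1 ⊗[𝕜] B i.2) →ₗ[𝕜] ⨁ r, tensorDeg A B r :=
    DirectSum.toModule 𝕜 (ℤ × ℤ) _ fun i =>
      DirectSum.lof 𝕜 ℤ (fun r => tensorDeg A B r) (i.1 + i.2) ∘ₗ
        LinearMap.codRestrict _ (TensorProduct.map (A i.1).subtype (B i.2).subtype) (hmem i)
  let f : M ⊗[𝕜] N →ₗ[𝕜] ⨁ r, tensorDeg A B r :=
    g ∘ₗ (TensorProduct.directSum 𝕜 𝕜 (fun i => A i) (fun i => B i)).toLinearMap ∘ₗ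
      (TensorProduct.congr (gradedEquiv hA).symm (gradedEquiv hB).symm).toLinearMap
  have hf : ∀ p q a b (ha : a ∈ A p) (hb : b ∈ B q), f (a ⊗ₜ b) =
      DirectSum.lof 𝕜 ℤ (fun r => tensorDeg A B r) (p + q)
        ⟨a ⊗ₜ b, tmul_mem_tensorDeg ha hb rfl⟩ := by
    intro p q a b ha hb
    simp only [f, LinearMap.comp_apply, LinearEquiv.coe_coe, TensorProduct.congr_tmul,
      gradedEquiv_symm hA ha, gradedEquiv_symm hB hb,
      TensorProduct.directSum_lof_tmul_lof, g]
    rw [DirectSum.toModule_lof]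
    rfl
  refine isInternal_of_linearMap _ f (fun x => ?_) (fun r x => ?_)
  · induction x using tensor_homogeneous_induction hA hB with
    | h0 => simp
    | hadd x y hx hy => rw [map_add, map_add, hx, hy]
    | hC p q a ha b hb => rw [hf p q a b ha hb]; simp
  · obtain ⟨x, hx⟩ := x
    induction hx using Submodule.span_induction with
    | mem x h =>
      obtain ⟨p, q, a, b, rfl, ha, hb, rfl⟩ := h
      exact hf p q a b ha hb
    | zero => simp only [map_zero]; exact (map_zero _).symm
    | add x y hx hy ihx ihy =>
      rw [map_add, ihx, ihy, ← map_add]; rfl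
    | smul c x hx ih => rw [map_smul, ih, ← map_smul]; rfl

end Graded

/-! ### Symmetric operads in graded vector spaces -/

section Operads

/-- `I ⊔ (J ⊔ {*}) ≃ (I ⊔ J) ⊔ {*}`. -/
def seqEquiv (I J : Type) : I ⊕ Option J ≃ Option (I ⊕ J) where
  toFun x := match x with
    | .inl i => some (.inl i)
    | .inr none => none
    | .inr (some j) => some (.inr j)
  invFun x := match x with
    | none => .inr none
    | some (.inl i) => .inl i
    | some (.inr j) => .inr (some j)
  left_inv x := by rcases x with i | _ | j <;> rfl
  right_inv x := by rcases x with _ | i | j <;> rfl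

/-- `(I ⊔ {*}) ⊔ J ≃ (I ⊔ J) ⊔ {*}`. -/
def parEquiv (I J : Type) : Option I ⊕ J ≃ Option (I ⊕ J) where
  toFun x := match x with
    | .inl none => none
    | .inl (some i) => some (.inl i)
    | .inr j => some (.inr j)
  invFun x := match x with
    | none => .inl none
    | some (.inl i) => .inl (some i)
    | some (.inr j) => .inr j
  left_inv x := by rcases x with (_ | i) | j <;> rfl
  right_inv x := by rcases x with _ | i | j <;> rfl

/-- The exchange of the two added points of `(I ⊔ {*}) ⊔ {*}`. -/
def swapEquiv (I : Type) : Option (Option I) ≃ Option (Option I) where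
  toFun x := match x with
    | none => some none
    | some none => none
    | some (some i) => some (some i)
  invFun x := match x with
    | none => some none
    | some none => none
    | some (some i) => some (some i)
  left_inv x := by rcases x with _ | _ | i <;> rfl
  right_inv x := by rcases x with _ | _ | i <;> rfl

/-- `(I ⊔ J) ⊔ K ≃ (I ⊔ K) ⊔ J`. -/
def sumRightSwap (I J K : Type) : (I ⊕ J) ⊕ K ≃ (I ⊕ K) ⊕ J where
  toFun x := match x with
    | .inl (.inl i) => .inl (.inl i)
    | .inl (.inr j) => .inr j
    | .inr k => .inl (.inr k)
  invFun x := match x with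
    | .inl (.inl i) => .inl (.inl i)
    | .inl (.inr k) => .inr k
    | .inr j => .inl (.inr j)
  left_inv x := by rcases x with (i | j) | k <;> rfl
  right_inv x := by rcases x with (i | k) | j <;> rfl

/-- `{*} ≃ ∅ ⊔ {*}`. -/
def unitEquiv : Unit ≃ Option Empty where
  toFun _ := none
  invFun _ := ()
  left_inv _ := rfl
  right_inv x := by rcases x with _ | x; exacts [rfl, x.elim]

/-- A symmetric unital operad in `ℤ`-graded vector spaces over `𝕜`, in the form with inputs marked
by finite sets and partial compositions: `obj I` is the space of operations with inputs marked by
the finite set `I` (the values of `obj` on infinite types play no role), bijections act by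
renaming the inputs, and `comp a b` inserts `b` into the input `none` of `a`. -/
structure GrOperad (𝕜 : Type u) [Field 𝕜] where
  obj : Type → Type v
  [addCommGroup : ∀ I, AddCommGroup (obj I)]
  [module : ∀ I, Module 𝕜 (obj I)]
  /-- the homogeneous parts of the space of operations -/
  deg : ∀ I, ℤ → Submodule 𝕜 (obj I)
  isInternal : ∀ (I : Type) [Finite I], DirectSum.IsInternal (deg I)
  /-- renaming of inputs -/
  map : ∀ {I J : Type} [Finite I] [Finite J], (I ≃ J) → (obj I →ₗ[𝕜] obj J)
  /-- the identity operation -/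
  one : obj Unit
  /-- partial composition -/
  comp : ∀ {I J : Type} [Finite I] [Finite J],
    obj (Option I) →ₗ[𝕜] obj J →ₗ[𝕜] obj (I ⊕ J)
  map_refl : ∀ {I : Type} [Finite I] (a : obj I), map (Equiv.refl I) a = a
  map_trans : ∀ {I J K : Type} [Finite I] [Finite J] [Finite K] (e : I ≃ J) (f : J ≃ K)
    (a : obj I), map (e.trans f) a = map f (map e a)
  map_mem : ∀ {I J : Type} [Finite I] [Finite J] (e : I ≃ J) {p : ℤ} {a : obj I},
    a ∈ deg I p → map e a ∈ deg J p
  one_mem : one ∈ deg Unit 0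
  comp_mem : ∀ {I J : Type} [Finite I] [Finite J] {p q : ℤ} {a : obj (Option I)} {b : obj J},
    a ∈ deg (Option I) p → b ∈ deg J q → comp a b ∈ deg (I ⊕ J) (p + q)
  comp_map : ∀ {I J I' J' : Type} [Finite I] [Finite J] [Finite I'] [Finite J']
    (e : I ≃ I') (f : J ≃ J') (a : obj (Option I)) (b : obj J),
    comp (map e.optionCongr a) (map f b) = map (e.sumCongr f) (comp a b)
  one_comp : ∀ {J : Type} [Finite J] (b : obj J),
    map (Equiv.emptySum Empty J) (comp (map unitEquiv one) b) = b
  comp_one : ∀ {I : Type} [Finite I] (a : obj (Option I)),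
    comp a one = map (Equiv.optionEquivSumPUnit I) a
  /-- sequential associativity -/
  comp_seq : ∀ {I J K : Type} [Finite I] [Finite J] [Finite K]
    (a : obj (Option I)) (b : obj (Option J)) (c : obj K),
    map (Equiv.sumAssoc I J K) (comp (map (seqEquiv I J) (comp a b)) c) = comp a (comp b c)
  /-- parallel associativity, with the Koszul sign -/
  comp_par : ∀ {I J K : Type} [Finite I] [Finite J] [Finite K]
    (a : obj (Option (Option I))) {p q : ℤ} {b : obj J} {c : obj K},
    b ∈ deg J p → c ∈ deg K q →
    map (sumRightSwap I J K) (comp (map (parEquiv I J) (comp a b)) c) =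
      zsign 𝕜 (p * q) • comp (map (parEquiv I K) (comp (map (swapEquiv I) a) c)) b

attribute [instance] GrOperad.addCommGroup GrOperad.module

/-- Morphisms of operads. -/
structure GrOperad.Hom {𝕜 : Type u} [Field 𝕜] (P : GrOperad.{u, v} 𝕜) (Q : GrOperad.{u, w} 𝕜) where
  app : ∀ (I : Type) [Finite I], P.obj I →ₗ[𝕜] Q.obj I
  app_mem : ∀ {I : Type} [Finite I] {p : ℤ} {a : P.obj I}, a ∈ P.deg I p → app I a ∈ Q.deg I p
  app_map : ∀ {I J : Type} [Finite I] [Finite J] (e : I ≃ J) (a : P.obj I),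
    app J (P.map e a) = Q.map e (app I a)
  app_one : app Unit P.one = Q.one
  app_comp : ∀ {I J : Type} [Finite I] [Finite J] (a : P.obj (Option I)) (b : P.obj J),
    app (I ⊕ J) (P.comp a b) = Q.comp (app (Option I) a) (app J b)

/-- `(a ⊗ a') ⊗ (b ⊗ b') ↦ (-1) ^ (|a'| |b|) (a ⊗ b) ⊗ (a' ⊗ b')`. -/
def middleSwap {𝕜 : Type u} [Field 𝕜] {M M' N N' : Type*}
    [AddCommGroup M] [Module 𝕜 M] [AddCommGroup M'] [Module 𝕜 M']
    [AddCommGroup N] [Module 𝕜 N] [AddCommGroup N'] [Module 𝕜 N']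
    {A : ℤ → Submodule 𝕜 M'} {B : ℤ → Submodule 𝕜 N}
    (hA : DirectSum.IsInternal A) (hB : DirectSum.IsInternal B) :
    (M ⊗[𝕜] M') ⊗[𝕜] (N ⊗[𝕜] N') →ₗ[𝕜] (M ⊗[𝕜] N) ⊗[𝕜] (M' ⊗[𝕜] N') :=
  (TensorProduct.assoc 𝕜 M N (M' ⊗[𝕜] N')).symm.toLinearMap ∘ₗ
    LinearMap.lTensor M ((TensorProduct.assoc 𝕜 N M' N').toLinearMap ∘ₗ
      LinearMap.rTensor N' (koszulSwap hA hB) ∘ₗ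
        (TensorProduct.assoc 𝕜 M' N N').symm.toLinearMap) ∘ₗ
      (TensorProduct.assoc 𝕜 M M' (N ⊗[𝕜] N')).toLinearMap

theorem middleSwap_tmul {𝕜 : Type u} [Field 𝕜] {M M' N N' : Type*}
    [AddCommGroup M] [Module 𝕜 M] [AddCommGroup M'] [Module 𝕜 M']
    [AddCommGroup N] [Module 𝕜 N] [AddCommGroup N'] [Module 𝕜 N']
    {A : ℤ → Submodule 𝕜 M'} {B : ℤ → Submodule 𝕜 N}
    (hA : DirectSum.IsInternal A) (hB : DirectSum.IsInternal B)
    {p q : ℤ} {a' : M'} {b : N} (ha : a' ∈ A p) (hb : b ∈ B q) (a : M) (b' : N') :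
    middleSwap hA hB ((a ⊗ₜ a') ⊗ₜ (b ⊗ₜ b')) =
      zsign 𝕜 (p * q) • ((a ⊗ₜ[𝕜] b) ⊗ₜ[𝕜] (a' ⊗ₜ[𝕜] b')) := by
  simp only [middleSwap, LinearMap.comp_apply, LinearEquiv.coe_coe, TensorProduct.assoc_tmul,
    TensorProduct.assoc_symm_tmul, LinearMap.lTensor_tmul, LinearMap.rTensor_tmul,
    koszulSwap_tmul hA hB ha hb]
  rw [← TensorProduct.smul_tmul', map_smul, TensorProduct.assoc_tmul, TensorProduct.tmul_smul,
    map_smul, TensorProduct.assoc_symm_tmul]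

/-- The partial composition of the tensor product of operads:
`(a ⊗ a') ∘ (b ⊗ b') = (-1) ^ (|a'| |b|) (a ∘ b) ⊗ (a' ∘ b')` (see `tensorComp_tmul`). -/
def tensorComp {𝕜 : Type u} [Field 𝕜] (P : GrOperad.{u, v} 𝕜) (Q : GrOperad.{u, w} 𝕜)
    {I J : Type} [Finite I] [Finite J] :
    (P.obj (Option I) ⊗[𝕜] Q.obj (Option I)) →ₗ[𝕜] (P.obj J ⊗[𝕜] Q.obj J) →ₗ[𝕜]
      (P.obj (I ⊕ J) ⊗[𝕜] Q.obj (I ⊕ J)) :=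
  TensorProduct.curry
    (TensorProduct.map (TensorProduct.lift P.comp) (TensorProduct.lift Q.comp) ∘ₗ
      middleSwap (Q.isInternal (Option I)) (P.isInternal J))

theorem tensorComp_tmul {𝕜 : Type u} [Field 𝕜] (P : GrOperad.{u, v} 𝕜) (Q : GrOperad.{u, w} 𝕜)
    {I J : Type} [Finite I] [Finite J] {p q : ℤ} {a' : Q.obj (Option I)} {b : P.obj J}
    (ha : a' ∈ Q.deg (Option I) p) (hb : b ∈ P.deg J q) (a : P.obj (Option I)) (b' : Q.obj J) :
    tensorComp P Q (a ⊗ₜ a') (b ⊗ₜ b') =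
      zsign 𝕜 (p * q) • (P.comp a b ⊗ₜ[𝕜] Q.comp a' b') := by
  simp only [tensorComp, TensorProduct.curry_apply, LinearMap.comp_apply,
    middleSwap_tmul _ _ ha hb]
  rw [map_smul, TensorProduct.map_tmul, TensorProduct.lift.tmul, TensorProduct.lift.tmul]

theorem GrOperad.tensor_induction {𝕜 : Type u} [Field 𝕜] (P : GrOperad.{u, v} 𝕜)
    (Q : GrOperad.{u, w} 𝕜) (I : Type) [Finite I]
    {C : P.obj I ⊗[𝕜] Q.obj I → Prop} (h0 : C 0) (hadd : ∀ x y, C x → C y → C (x + y))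
    (hC : ∀ p q, ∀ a ∈ P.deg I p, ∀ b ∈ Q.deg I q, C (a ⊗ₜ b)) (x : P.obj I ⊗[𝕜] Q.obj I) :
    C x :=
  tensor_homogeneous_induction (P.isInternal I) (Q.isInternal I) h0 hadd hC x

/-- The (Hadamard) tensor product of operads, `(P ⊗ Q)(I) = P(I) ⊗ Q(I)`. -/
def GrOperad.tensor {𝕜 : Type u} [Field 𝕜] (P : GrOperad.{u, v} 𝕜) (Q : GrOperad.{u, w} 𝕜) :
    GrOperad.{u, max v w} 𝕜 where
  obj I := P.obj I ⊗[𝕜] Q.obj I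
  deg I := tensorDeg (P.deg I) (Q.deg I)
  isInternal I := tensorDeg_isInternal (P.isInternal I) (Q.isInternal I)
  map e := TensorProduct.map (P.map e) (Q.map e)
  one := P.one ⊗ₜ Q.one
  comp := tensorComp P Q
  map_refl {I} _ x := by
    induction x using TensorProduct.induction_on with
    | zero => simp
    | add x y hx hy => rw [map_add, hx, hy]
    | tmul a b => simp [P.map_refl, Q.map_refl]
  map_trans e f x := by
    induction x using TensorProduct.induction_on with
    | zero => simp
    | add x y hx hy => simp only [map_add, hx, hy]
    | tmul a b => simp [P.map_trans, Q.map_trans]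
  map_mem e p x hx := by
    induction hx using Submodule.span_induction with
    | mem x h =>
      obtain ⟨p, q, a, b, rfl, ha, hb, rfl⟩ := h
      exact tmul_mem_tensorDeg (P.map_mem e ha) (Q.map_mem e hb) rfl
    | zero => simp
    | add x y _ _ hx hy => rw [map_add]; exact add_mem hx hy
    | smul c x _ hx => rw [map_smul]; exact Submodule.smul_mem _ _ hx
  one_mem := tmul_mem_tensorDeg P.one_mem Q.one_mem (add_zero 0)
  comp_mem {I J} _ _ {r s x y} hx hy := by
    induction hx using Submodule.span_induction with
    | mem x h =>
      obtain ⟨p, q, a, a', rfl, ha, ha', rfl⟩ := h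
      induction hy using Submodule.span_induction with
      | mem y h =>
        obtain ⟨p', q', b, b', rfl, hb, hb', rfl⟩ := h
        rw [tensorComp_tmul P Q ha' hb]
        exact Submodule.smul_mem _ _ (tmul_mem_tensorDeg (P.comp_mem ha hb) (Q.comp_mem ha' hb') (by ring))
      | zero => simp
      | add x y _ _ hx hy => rw [map_add]; exact add_mem hx hy
      | smul c x _ hx => rw [map_smul]; exact Submodule.smul_mem _ _ hx
    | zero => simp
    | add x y _ _ hx hy => rw [map_add, LinearMap.add_apply]; exact add_mem hx hy
    | smul c x _ hx => rw [map_smul, LinearMap.smul_apply]; exact Submodule.smul_mem _ _ hx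
  comp_map {I J I' J'} _ _ _ _ e f x y := by
    induction x using GrOperad.tensor_induction P Q (Option I) with
    | h0 => simp
    | hadd x y hx hy => simp only [map_add, LinearMap.add_apply, hx, hy]
    | hC p q a ha a' ha' =>
      induction y using GrOperad.tensor_induction P Q J with
      | h0 => simp
      | hadd x y hx hy => simp only [map_add, hx, hy]
      | hC p' q' b hb b' hb' =>
        rw [TensorProduct.map_tmul, TensorProduct.map_tmul,
          tensorComp_tmul P Q (Q.map_mem _ ha') (P.map_mem _ hb), tensorComp_tmul P Q ha' hb,
          P.comp_map, Q.comp_map, map_smul, TensorProduct.map_tmul]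
  one_comp {J} _ y := by
    induction y using GrOperad.tensor_induction P Q J with
    | h0 => simp
    | hadd x y hx hy => simp only [map_add, hx, hy]
    | hC p' q' b hb b' hb' =>
      rw [TensorProduct.map_tmul, tensorComp_tmul P Q (Q.map_mem _ Q.one_mem) hb, zero_mul,
        zsign_zero, one_smul, TensorProduct.map_tmul, P.one_comp, Q.one_comp]
  comp_one {I} _ x := by
    induction x using GrOperad.tensor_induction P Q (Option I) with
    | h0 => simp
    | hadd x y hx hy => simp only [map_add, LinearMap.add_apply, hx, hy]
    | hC p q a ha a' ha' =>
      rw [tensorComp_tmul P Q ha' P.one_mem, mul_zero, zsign_zero, one_smul,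
        TensorProduct.map_tmul, P.comp_one, Q.comp_one]
  comp_seq {I J K} _ _ _ x y z := by
    induction x using GrOperad.tensor_induction P Q (Option I) with
    | h0 => simp
    | hadd x y hx hy => simp only [map_add, LinearMap.add_apply, hx, hy]
    | hC p q a ha a' ha' =>
      induction y using GrOperad.tensor_induction P Q (Option J) with
      | h0 => simp
      | hadd x y hx hy => simp only [map_add, LinearMap.add_apply, hx, hy]
      | hC p' q' b hb b' hb' =>
        induction z using GrOperad.tensor_induction P Q K with
        | h0 => simp
        | hadd x y hx hy => simp only [map_add, hx, hy]
        | hC p'' q'' c hc c' hc' =>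
          rw [tensorComp_tmul P Q ha' hb, tensorComp_tmul P Q hb' hc]
          simp only [map_smul, LinearMap.smul_apply]
          rw [tensorComp_tmul P Q ha' (P.comp_mem hb hc), TensorProduct.map_tmul,
            tensorComp_tmul P Q (Q.map_mem _ (Q.comp_mem ha' hb')) hc]
          simp only [map_smul]
          rw [TensorProduct.map_tmul, P.comp_seq, Q.comp_seq, smul_smul, smul_smul,
            ← zsign_add, ← zsign_add]
          congr 2
          ring
  comp_par {I J K} _ _ _ x r s y z hy hz := by
    induction x using GrOperad.tensor_induction P Q (Option (Option I)) with
    | h0 => simp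
    | hadd x y hx hy => simp only [map_add, LinearMap.add_apply, hx, hy, smul_add]
    | hC p q a ha a' ha' =>
      induction hy using Submodule.span_induction with
      | zero => simp
      | add x y _ _ hx hy => simp only [map_add, LinearMap.add_apply, hx, hy, smul_add]
      | smul c x _ hx => simp only [map_smul, LinearMap.smul_apply, hx]; rw [smul_comm]
      | mem y h =>
        obtain ⟨p', q', b, b', rfl, hb, hb', rfl⟩ := h
        induction hz using Submodule.span_induction with
        | zero => simp
        | add x y _ _ hx hy => simp only [map_add, LinearMap.add_apply, hx, hy, smul_add]
        | smul c x _ hx => simp only [map_smul, LinearMap.smul_apply, hx]; rw [smul_comm]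
        | mem y h =>
          obtain ⟨p'', q'', c, c', rfl, hc, hc', rfl⟩ := h
          rw [tensorComp_tmul P Q ha' hb, TensorProduct.map_tmul,
            tensorComp_tmul P Q (Q.map_mem _ ha') hc]
          simp only [map_smul, LinearMap.smul_apply]
          rw [TensorProduct.map_tmul, TensorProduct.map_tmul,
            tensorComp_tmul P Q (Q.map_mem _ (Q.comp_mem ha' hb')) hc,
            tensorComp_tmul P Q (Q.map_mem _ (Q.comp_mem (Q.map_mem _ ha') hc')) hb]
          simp only [map_smul]
          rw [TensorProduct.map_tmul, P.comp_par _ hb hc, Q.comp_par _ hb' hc']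
          rw [← TensorProduct.smul_tmul', TensorProduct.tmul_smul]
          simp only [smul_smul, ← zsign_add]
          congr 1
          apply zsign_eq
          refine ⟨- (p' * q''), ?_⟩
          ring

end Operads

/-! ### The operad of commutative algebras -/

section Commutative

/-- `Com(I)` as a subspace of the ground field: all of it for nonempty `I`, zero for empty `I`. -/
def comSpace (𝕜 : Type u) [Field 𝕜] (I : Type) : Submodule 𝕜 𝕜 where
  carrier := {c | IsEmpty I → c = 0}
  zero_mem' _ := rfl
  add_mem' ha hb h := by rw [ha h, hb h, add_zero]
  smul_mem' c x hx h := by rw [hx h, smul_zero]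

theorem mem_comSpace {𝕜 : Type u} [Field 𝕜] {I : Type} [Nonempty I] (c : 𝕜) :
    c ∈ comSpace 𝕜 I := fun h => (not_isEmpty_of_nonempty I h).elim

/-- The operad `Com` of (non-unital) commutative associative algebras: `Com(I)` is the ground field
with trivial action, in degree `0`, for nonempty `I`, and compositions are given by
multiplication. -/
def Com (𝕜 : Type u) [Field 𝕜] : GrOperad.{u, u} 𝕜 where
  obj I := comSpace 𝕜 I
  deg _ p := if p = 0 then ⊤ else ⊥
  isInternal I := by
    refine isInternal_of_linearMap _
      (DirectSum.lof 𝕜 ℤ (fun p => ((if p = 0 then ⊤ else ⊥ : Submodule 𝕜 (comSpace 𝕜 I)))) 0 ∘ₗ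
        LinearMap.codRestrict _ LinearMap.id (fun x => by simp)) (fun x => ?_) (fun p x => ?_)
    · rw [LinearMap.comp_apply, DirectSum.coeLinearMap_lof]; rfl
    · by_cases hp : p = 0
      · subst hp; rfl
      · have hx : x = 0 := by
          obtain ⟨x, hx⟩ := x
          simp only [hp, if_false, Submodule.mem_bot] at hx
          subst hx; rfl
        subst hx; simp
  map {I J} _ _ e := LinearMap.codRestrict _ (comSpace 𝕜 I).subtype
    (fun x h => x.2 (e.isEmpty_congr.2 h))
  one := ⟨1, mem_comSpace 1⟩
  comp {I J} _ _ := LinearMap.mk₂ 𝕜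
    (fun a b => ⟨(a : 𝕜) * b, fun h => by
      rw [b.2 (isEmpty_sum.1 h).2, mul_zero]⟩)
    (fun a a' b => Subtype.ext (add_mul _ _ _)) (fun c a b => Subtype.ext (mul_assoc _ _ _))
    (fun a b b' => Subtype.ext (mul_add _ _ _))
    (fun c a b => Subtype.ext (mul_left_comm _ _ _))
  map_refl _ := rfl
  map_trans _ _ _ := rfl
  map_mem e p a ha := by
    by_cases hp : p = 0
    · simp [hp]
    · simp only [hp, if_false, Submodule.mem_bot] at ha ⊢
      rw [ha, map_zero]
  one_mem := by simp
  comp_mem {I J} _ _ p q a b ha hb := by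
    by_cases hp : p = 0
    · by_cases hq : q = 0
      · simp [hp, hq]
      · simp only [hq, if_false, Submodule.mem_bot] at hb
        rw [hb, map_zero]; exact zero_mem _
    · simp only [hp, if_false, Submodule.mem_bot] at ha
      rw [ha, map_zero]; exact zero_mem _
  comp_map _ _ _ _ := rfl
  one_comp b := Subtype.ext (one_mul _)
  comp_one a := Subtype.ext (mul_one _)
  comp_seq a b c := Subtype.ext (mul_assoc _ _ _)
  comp_par {I J K} _ _ _ a p q b c hb hc := by
    have key : ∀ u : 𝕜, (b : 𝕜) = 0 ∨ (c : 𝕜) = 0 ∨ u = 1 →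
        (a : 𝕜) * b * c = u * ((a : 𝕜) * c * b) := by
      rintro u (h | h | h) <;> simp only [h] <;> ring
    refine Subtype.ext (key _ ?_)
    by_cases hp : p = 0
    · right; right; rw [hp, zero_mul, zsign_zero]
    · left
      simp only [hp, if_false, Submodule.mem_bot] at hb
      rw [hb]; rfl

end Commutative

/-! ### The operad `Pois^k_d` -/

section Poisson

/-- Operadic monomials in a binary generator `mu` and a `(k+1)`-ary generator `nu`: everything
obtained from them and the identity by renaming inputs and partial compositions. -/
inductive PoisMono (k : ℕ) : Type → Type 1
  | one : PoisMono k Unit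
  | mu : PoisMono k (Fin 2)
  | nu : PoisMono k (Fin (k + 1))
  | map {I J : Type} [Finite I] [Finite J] (e : I ≃ J) (a : PoisMono k I) : PoisMono k J
  | comp {I J : Type} [Finite I] [Finite J] (a : PoisMono k (Option I)) (b : PoisMono k J) :
      PoisMono k (I ⊕ J)

/-- The degree of a monomial, with `|mu| = 0` and `|nu| = 1 - k d`. -/
def PoisMono.degree {k : ℕ} (d : ℤ) {I : Type} : PoisMono k I → ℤ
  | .one => 0
  | .mu => 0
  | .nu => 1 - k * d
  | @PoisMono.map _ _ _ _ _ _ a => a.degree d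
  | @PoisMono.comp _ _ _ _ _ a b => a.degree d + b.degree d

/-- Linear combinations of monomials with inputs marked by `I`. -/
abbrev PoisFree (𝕜 : Type u) [Field 𝕜] (k : ℕ) (I : Type) : Type (max 1 u) := PoisMono k I →₀ 𝕜

namespace PoisFree

/-- A monomial, as a linear combination. -/
def of (𝕜 : Type u) [Field 𝕜] {k : ℕ} {I : Type} (m : PoisMono k I) : PoisFree 𝕜 k I :=
  Finsupp.single m 1

/-- The linear extension of the renaming of inputs. -/
def map {𝕜 : Type u} [Field 𝕜] {k : ℕ} {I J : Type} [Finite I] [Finite J] (e : I ≃ J) :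
    PoisFree 𝕜 k I →ₗ[𝕜] PoisFree 𝕜 k J :=
  Finsupp.lmapDomain 𝕜 𝕜 (PoisMono.map e)

/-- The bilinear extension of the partial composition. -/
def comp {𝕜 : Type u} [Field 𝕜] {k : ℕ} {I J : Type} [Finite I] [Finite J] :
    PoisFree 𝕜 k (Option I) →ₗ[𝕜] PoisFree 𝕜 k J →ₗ[𝕜] PoisFree 𝕜 k (I ⊕ J) :=
  Finsupp.linearCombination 𝕜 fun a => Finsupp.lmapDomain 𝕜 𝕜 (PoisMono.comp a)

theorem map_of {𝕜 : Type u} [Field 𝕜] {k : ℕ} {I J : Type} [Finite I] [Finite J] (e : I ≃ J)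
    (m : PoisMono k I) : map e (of 𝕜 m) = of 𝕜 (m.map e) := by
  simp [map, of]

theorem comp_of {𝕜 : Type u} [Field 𝕜] {k : ℕ} {I J : Type} [Finite I] [Finite J]
    (a : PoisMono k (Option I)) (b : PoisMono k J) :
    comp (of 𝕜 a) (of 𝕜 b) = of 𝕜 (a.comp b) := by
  simp [comp, of]

/-- The linear combinations of monomials of degree `p`. -/
def deg (𝕜 : Type u) [Field 𝕜] {k : ℕ} (d : ℤ) (I : Type) (p : ℤ) :
    Submodule 𝕜 (PoisFree 𝕜 k I) :=
  Finsupp.supported 𝕜 𝕜 {m | m.degree d = p}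

end PoisFree

/-- The renaming of `{z} ⊔ {y_0, …, y_k}` to `{x_0, …, x_(k-1)} ⊔ {a_0, a_1}` with `y_i ↦ x_i` for
`i < k`, `y_k ↦ a_0` and `z ↦ a_1`. -/
def leibnizEquiv (k : ℕ) : Fin 1 ⊕ Fin (k + 1) ≃ Fin k ⊕ Fin 2 :=
  (Equiv.sumCongr (Equiv.refl (Fin 1)) finSumFinEquiv.symm).trans <|
    (Equiv.sumComm (Fin 1) (Fin k ⊕ Fin 1)).trans <|
      (Equiv.sumAssoc (Fin k) (Fin 1) (Fin 1)).trans <|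
        Equiv.sumCongr (Equiv.refl (Fin k)) finSumFinEquiv

open PoisFree in
/-- The relations of `Pois^k_d`: the axioms of an operad, the defining relations between the
generators, and what follows from these by renaming inputs and composing with monomials. -/
inductive PoisRel (𝕜 : Type u) [Field 𝕜] (k : ℕ) (d : ℤ) : (I : Type) → PoisFree 𝕜 k I → Prop
  | map_refl {I : Type} [Finite I] (a : PoisMono k I) :
      PoisRel 𝕜 k d I (of 𝕜 (a.map (Equiv.refl I)) - of 𝕜 a)
  | map_trans {I J K : Type} [Finite I] [Finite J] [Finite K] (e : I ≃ J) (f : J ≃ K)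
      (a : PoisMono k I) :
      PoisRel 𝕜 k d K (of 𝕜 (a.map (e.trans f)) - of 𝕜 ((a.map e).map f))
  | comp_map {I J I' J' : Type} [Finite I] [Finite J] [Finite I'] [Finite J']
      (e : I ≃ I') (f : J ≃ J') (a : PoisMono k (Option I)) (b : PoisMono k J) :
      PoisRel 𝕜 k d (I' ⊕ J')
        (of 𝕜 ((a.map e.optionCongr).comp (b.map f)) - of 𝕜 ((a.comp b).map (e.sumCongr f)))
  | one_comp {J : Type} [Finite J] (b : PoisMono k J) :
      PoisRel 𝕜 k d J
        (of 𝕜 (((PoisMono.one.map unitEquiv).comp b).map (Equiv.emptySum Empty J)) - of 𝕜 b)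
  | comp_one {I : Type} [Finite I] (a : PoisMono k (Option I)) :
      PoisRel 𝕜 k d (I ⊕ Unit)
        (of 𝕜 (a.comp PoisMono.one) - of 𝕜 (a.map (Equiv.optionEquivSumPUnit I)))
  | comp_seq {I J K : Type} [Finite I] [Finite J] [Finite K]
      (a : PoisMono k (Option I)) (b : PoisMono k (Option J)) (c : PoisMono k K) :
      PoisRel 𝕜 k d (I ⊕ (J ⊕ K))
        (of 𝕜 ((((a.comp b).map (seqEquiv I J)).comp c).map (Equiv.sumAssoc I J K)) -
          of 𝕜 (a.comp (b.comp c)))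
  | comp_par {I J K : Type} [Finite I] [Finite J] [Finite K]
      (a : PoisMono k (Option (Option I))) (b : PoisMono k J) (c : PoisMono k K) :
      PoisRel 𝕜 k d ((I ⊕ K) ⊕ J)
        (of 𝕜 ((((a.comp b).map (parEquiv I J)).comp c).map (sumRightSwap I J K)) -
          zsign 𝕜 (b.degree d * c.degree d) •
            of 𝕜 ((((a.map (swapEquiv I)).comp c).map (parEquiv I K)).comp b))
  /-- `μ(x₀, x₁) = μ(x₁, x₀)` -/
  | mu_comm : PoisRel 𝕜 k d (Fin 2)
      (of 𝕜 (PoisMono.mu.map (Equiv.swap 0 1)) - of 𝕜 PoisMono.mu)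
  /-- `μ(μ(x₀, x₁), x₂) = μ(x₀, μ(x₁, x₂))` -/
  | mu_assoc : PoisRel 𝕜 k d (Fin 3)
      (map ((Equiv.sumComm (Fin 1) (Fin 2)).trans finSumFinEquiv)
          (comp (map (finSuccEquiv 1) (of 𝕜 PoisMono.mu)) (of 𝕜 PoisMono.mu)) -
        map finSumFinEquiv
          (comp (map finSuccEquivLast (of 𝕜 PoisMono.mu)) (of 𝕜 PoisMono.mu)))
  /-- `ν` is symmetric for even `d` and skew-symmetric for odd `d` -/
  | nu_symm (σ : Equiv.Perm (Fin (k + 1))) : PoisRel 𝕜 k d (Fin (k + 1))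
      (map σ (of 𝕜 PoisMono.nu) -
        (((Equiv.Perm.sign σ ^ d : ℤˣ) : ℤ) : 𝕜) • of 𝕜 PoisMono.nu)
  /-- the Leibniz identity
  `ν(x₀, …, x_(k-1), μ(a₀, a₁)) = μ(ν(x₀, …, x_(k-1), a₀), a₁) + μ(ν(x₀, …, x_(k-1), a₁), a₀)` -/
  | leibniz : PoisRel 𝕜 k d (Fin k ⊕ Fin 2)
      (comp (map finSuccEquivLast (of 𝕜 PoisMono.nu)) (of 𝕜 PoisMono.mu) -
        (map (leibnizEquiv k)
            (comp (map (finSuccEquiv 1) (of 𝕜 PoisMono.mu)) (of 𝕜 PoisMono.nu)) +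
          map ((leibnizEquiv k).trans (Equiv.sumCongr (Equiv.refl (Fin k)) (Equiv.swap 0 1)))
            (comp (map (finSuccEquiv 1) (of 𝕜 PoisMono.mu)) (of 𝕜 PoisMono.nu))))
  /-- the generalized Jacobi identity: the sum of `ν(ν(y₀, …, y_k), x₀, …, x_(k-1))` over even
  representatives of the cosets `S_(2k+1) / (S_k × S_(k+1))` vanishes -/
  | jacobi (s : Equiv.Perm.ModSumCongr (Fin k) (Fin (k + 1)) → Equiv.Perm (Fin k ⊕ Fin (k + 1)))
      (hs : ∀ q, QuotientGroup.mk (s q) = q) (hs' : ∀ q, Equiv.Perm.sign (s q) = 1) :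
      PoisRel 𝕜 k d (Fin k ⊕ Fin (k + 1))
        (∑ q, map (s q)
          (comp (map (finSuccEquiv k) (of 𝕜 PoisMono.nu)) (of 𝕜 PoisMono.nu)))
  | map_rel {I J : Type} [Finite I] [Finite J] (e : I ≃ J) (x : PoisFree 𝕜 k I) :
      PoisRel 𝕜 k d I x → PoisRel 𝕜 k d J (map e x)
  | rel_comp {I J : Type} [Finite I] [Finite J] (x : PoisFree 𝕜 k (Option I)) (b : PoisMono k J) :
      PoisRel 𝕜 k d (Option I) x → PoisRel 𝕜 k d (I ⊕ J) (comp x (of 𝕜 b))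
  | comp_rel {I J : Type} [Finite I] [Finite J] (a : PoisMono k (Option I)) (y : PoisFree 𝕜 k J) :
      PoisRel 𝕜 k d J y → PoisRel 𝕜 k d (I ⊕ J) (comp (of 𝕜 a) y)

/-- The span of the relations. -/
def poisIdeal (𝕜 : Type u) [Field 𝕜] (k : ℕ) (d : ℤ) (I : Type) : Submodule 𝕜 (PoisFree 𝕜 k I) :=
  Submodule.span 𝕜 {x | PoisRel 𝕜 k d I x}

namespace PoisFree

theorem of_mem_deg (𝕜 : Type u) [Field 𝕜] {k : ℕ} (d : ℤ) {I : Type} (m : PoisMono k I) {p : ℤ}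
    (h : m.degree d = p) : of 𝕜 m ∈ deg 𝕜 d I p :=
  Finsupp.single_mem_supported 𝕜 _ h

theorem deg_eq_span (𝕜 : Type u) [Field 𝕜] {k : ℕ} (d : ℤ) (I : Type) (p : ℤ) :
    deg 𝕜 (k := k) d I p = Submodule.span 𝕜 (of 𝕜 '' {m | m.degree d = p}) :=
  Finsupp.supported_eq_span_single 𝕜 _

theorem map_mem {𝕜 : Type u} [Field 𝕜] {k : ℕ} {d : ℤ} {I J : Type} [Finite I] [Finite J]
    (e : I ≃ J) {p : ℤ} {x : PoisFree 𝕜 k I} (hx : x ∈ deg 𝕜 d I p) :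
    map e x ∈ deg 𝕜 d J p := by
  rw [deg_eq_span] at hx
  induction hx using Submodule.span_induction with
  | mem x h =>
    obtain ⟨m, hm, rfl⟩ := h
    rw [map_of]; exact of_mem_deg 𝕜 d _ hm
  | zero => rw [LinearMap.map_zero]; exact zero_mem _
  | add x y _ _ hx hy => rw [LinearMap.map_add]; exact add_mem hx hy
  | smul c x _ hx => rw [LinearMap.map_smul]; exact Submodule.smul_mem _ _ hx

theorem comp_mem {𝕜 : Type u} [Field 𝕜] {k : ℕ} {d : ℤ} {I J : Type} [Finite I] [Finite J]
    {p q : ℤ} {x : PoisFree 𝕜 k (Option I)} {y : PoisFree 𝕜 k J} (hx : x ∈ deg 𝕜 d (Option I) p)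
    (hy : y ∈ deg 𝕜 d J q) : comp x y ∈ deg 𝕜 d (I ⊕ J) (p + q) := by
  rw [deg_eq_span] at hx hy
  induction hx using Submodule.span_induction with
  | mem x h =>
    obtain ⟨a, ha, rfl⟩ := h
    induction hy using Submodule.span_induction with
    | mem y h =>
      obtain ⟨b, hb, rfl⟩ := h
      rw [comp_of]
      refine of_mem_deg 𝕜 d _ ?_
      have ha : a.degree d = p := ha
      have hb : b.degree d = q := hb
      change (a.comp b).degree d = p + q
      rw [PoisMono.degree, ha, hb]
    | zero => rw [LinearMap.map_zero]; exact zero_mem _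
    | add x y _ _ hx hy => rw [LinearMap.map_add]; exact add_mem hx hy
    | smul c x _ hx => rw [LinearMap.map_smul]; exact Submodule.smul_mem _ _ hx
  | zero => rw [LinearMap.map_zero]; exact zero_mem _
  | add x y _ _ hx hy => rw [LinearMap.map_add]; exact add_mem hx hy
  | smul c x _ hx => rw [LinearMap.map_smul]; exact Submodule.smul_mem _ _ hx

theorem rel_homogeneous {𝕜 : Type u} [Field 𝕜] {k : ℕ} {d : ℤ} {I : Type} {x : PoisFree 𝕜 k I}
    (hx : PoisRel 𝕜 k d I x) : ∃ p, x ∈ deg 𝕜 d I p := by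
  have hmu : of 𝕜 (PoisMono.mu (k := k)) ∈ deg 𝕜 d _ 0 := of_mem_deg 𝕜 d _ rfl
  have hnu : of 𝕜 (PoisMono.nu (k := k)) ∈ deg 𝕜 d _ (1 - k * d) := of_mem_deg 𝕜 d _ rfl
  induction hx with
  | map_refl a => exact ⟨_, sub_mem (of_mem_deg 𝕜 d _ rfl) (of_mem_deg 𝕜 d _ rfl)⟩
  | map_trans e f a => exact ⟨_, sub_mem (of_mem_deg 𝕜 d _ rfl) (of_mem_deg 𝕜 d _ rfl)⟩
  | comp_map e f a b => exact ⟨_, sub_mem (of_mem_deg 𝕜 d _ rfl) (of_mem_deg 𝕜 d _ rfl)⟩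
  | one_comp b =>
    exact ⟨b.degree d, sub_mem (of_mem_deg 𝕜 d _ (by simp [PoisMono.degree]))
      (of_mem_deg 𝕜 d _ rfl)⟩
  | comp_one a =>
    exact ⟨a.degree d, sub_mem (of_mem_deg 𝕜 d _ (by simp [PoisMono.degree]))
      (of_mem_deg 𝕜 d _ rfl)⟩
  | comp_seq a b c =>
    exact ⟨a.degree d + (b.degree d + c.degree d),
      sub_mem (of_mem_deg 𝕜 d _ (by simp [PoisMono.degree, add_assoc])) (of_mem_deg 𝕜 d _ rfl)⟩
  | comp_par a b c =>
    exact ⟨a.degree d + b.degree d + c.degree d, sub_mem (of_mem_deg 𝕜 d _ rfl)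
      (Submodule.smul_mem _ _ (of_mem_deg 𝕜 d _ (by simp only [PoisMono.degree]; ring)))⟩
  | mu_comm => exact ⟨_, sub_mem (of_mem_deg 𝕜 d _ rfl) hmu⟩
  | mu_assoc =>
    exact ⟨_, sub_mem (map_mem _ (comp_mem (map_mem _ hmu) hmu))
      (map_mem _ (comp_mem (map_mem _ hmu) hmu))⟩
  | nu_symm σ => exact ⟨_, sub_mem (map_mem _ hnu) (Submodule.smul_mem _ _ hnu)⟩
  | leibniz =>
    refine ⟨0 + (1 - k * d), sub_mem ?_ (add_mem (map_mem _ (comp_mem (map_mem _ hmu) hnu))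
      (map_mem _ (comp_mem (map_mem _ hmu) hnu)))⟩
    rw [add_comm]
    exact comp_mem (map_mem _ hnu) hmu
  | jacobi s hs hs' =>
    exact ⟨_, sum_mem fun q _ => map_mem _ (comp_mem (map_mem _ hnu) hnu)⟩
  | map_rel e x _ ih => obtain ⟨p, hp⟩ := ih; exact ⟨p, map_mem e hp⟩
  | rel_comp x b _ ih => obtain ⟨p, hp⟩ := ih; exact ⟨_, comp_mem hp (of_mem_deg 𝕜 d b rfl)⟩
  | comp_rel a y _ ih => obtain ⟨p, hp⟩ := ih; exact ⟨_, comp_mem (of_mem_deg 𝕜 d a rfl) hp⟩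

theorem map_mem_ideal {𝕜 : Type u} [Field 𝕜] {k : ℕ} {d : ℤ} {I J : Type} [Finite I] [Finite J]
    (e : I ≃ J) : poisIdeal 𝕜 k d I ≤ (poisIdeal 𝕜 k d J).comap (map e) :=
  Submodule.span_le.2 fun x hx => Submodule.subset_span (PoisRel.map_rel e x hx)

theorem comp_mem_ideal_left {𝕜 : Type u} [Field 𝕜] {k : ℕ} {d : ℤ} {I J : Type}
    [Finite I] [Finite J] {x : PoisFree 𝕜 k (Option I)} (hx : x ∈ poisIdeal 𝕜 k d (Option I))
    (y : PoisFree 𝕜 k J) : comp x y ∈ poisIdeal 𝕜 k d (I ⊕ J) := by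
  induction y using Finsupp.induction_linear with
  | zero => rw [LinearMap.map_zero]; exact zero_mem _
  | add y z hy hz => rw [LinearMap.map_add]; exact add_mem hy hz
  | single b c =>
    have hc : Finsupp.single b c = c • of 𝕜 b := by simp [of]
    rw [hc, LinearMap.map_smul]
    refine Submodule.smul_mem _ _ ?_
    induction hx using Submodule.span_induction with
    | mem x h => exact Submodule.subset_span (PoisRel.rel_comp x b h)
    | zero => rw [LinearMap.map_zero]; exact zero_mem _
    | add x y _ _ hx hy => rw [LinearMap.map_add]; exact add_mem hx hy
    | smul c x _ hx => rw [LinearMap.map_smul]; exact Submodule.smul_mem _ _ hx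

theorem comp_mem_ideal_right {𝕜 : Type u} [Field 𝕜] {k : ℕ} {d : ℤ} {I J : Type}
    [Finite I] [Finite J] (x : PoisFree 𝕜 k (Option I)) {y : PoisFree 𝕜 k J}
    (hy : y ∈ poisIdeal 𝕜 k d J) : comp x y ∈ poisIdeal 𝕜 k d (I ⊕ J) := by
  induction x using Finsupp.induction_linear with
  | zero => rw [LinearMap.map_zero]; exact zero_mem _
  | add y z hy hz => rw [LinearMap.map_add]; exact add_mem hy hz
  | single b c =>
    have hc : Finsupp.single b c = c • of 𝕜 b := by simp [of]
    rw [hc, LinearMap.map_smul]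
    refine Submodule.smul_mem _ _ ?_
    induction hy using Submodule.span_induction with
    | mem x h => exact Submodule.subset_span (PoisRel.comp_rel b x h)
    | zero => rw [LinearMap.map_zero]; exact zero_mem _
    | add x y _ _ hx hy => rw [LinearMap.map_add]; exact add_mem hx hy
    | smul c x _ hx => rw [LinearMap.map_smul]; exact Submodule.smul_mem _ _ hx

end PoisFree

/-- The space of operations of `Pois^k_d` with inputs marked by `I`. -/
def PoisQuot (𝕜 : Type u) [Field 𝕜] (k : ℕ) (d : ℤ) (I : Type) : Type (max 1 u) :=
  PoisFree 𝕜 k I ⧸ poisIdeal 𝕜 k d I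

namespace PoisQuot

open PoisFree

instance (𝕜 : Type u) [Field 𝕜] (k : ℕ) (d : ℤ) (I : Type) : AddCommGroup (PoisQuot 𝕜 k d I) :=
  inferInstanceAs (AddCommGroup (PoisFree 𝕜 k I ⧸ poisIdeal 𝕜 k d I))

instance (𝕜 : Type u) [Field 𝕜] (k : ℕ) (d : ℤ) (I : Type) : Module 𝕜 (PoisQuot 𝕜 k d I) :=
  inferInstanceAs (Module 𝕜 (PoisFree 𝕜 k I ⧸ poisIdeal 𝕜 k d I))

/-- The class of a linear combination of monomials. -/
def mk (𝕜 : Type u) [Field 𝕜] (k : ℕ) (d : ℤ) (I : Type) :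
    PoisFree 𝕜 k I →ₗ[𝕜] PoisQuot 𝕜 k d I :=
  (poisIdeal 𝕜 k d I).mkQ

theorem mk_eq_zero {𝕜 : Type u} [Field 𝕜] {k : ℕ} {d : ℤ} {I : Type} {x : PoisFree 𝕜 k I}
    (hx : x ∈ poisIdeal 𝕜 k d I) : mk 𝕜 k d I x = 0 :=
  (Submodule.Quotient.mk_eq_zero _).2 hx

theorem mk_surjective {𝕜 : Type u} [Field 𝕜] {k : ℕ} {d : ℤ} {I : Type} (x : PoisQuot 𝕜 k d I) :
    ∃ y, mk 𝕜 k d I y = x :=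
  Submodule.mkQ_surjective _ x

/-- The linear map on classes induced by a linear map that vanishes on the relations. -/
def lift {𝕜 : Type u} [Field 𝕜] {k : ℕ} {d : ℤ} {I : Type} {M : Type*}
    [AddCommGroup M] [Module 𝕜 M] (f : PoisFree 𝕜 k I →ₗ[𝕜] M)
    (h : ∀ x ∈ poisIdeal 𝕜 k d I, f x = 0) : PoisQuot 𝕜 k d I →ₗ[𝕜] M :=
  (poisIdeal 𝕜 k d I).liftQ f (fun x hx => LinearMap.mem_ker.2 (h x hx))

theorem lift_mk {𝕜 : Type u} [Field 𝕜] {k : ℕ} {d : ℤ} {I : Type} {M : Type*}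
    [AddCommGroup M] [Module 𝕜 M] (f : PoisFree 𝕜 k I →ₗ[𝕜] M)
    (h : ∀ x ∈ poisIdeal 𝕜 k d I, f x = 0) (x : PoisFree 𝕜 k I) :
    lift f h (mk 𝕜 k d I x) = f x := rfl

/-- The class of a monomial. -/
def cls (𝕜 : Type u) [Field 𝕜] {k : ℕ} (d : ℤ) {I : Type} (m : PoisMono k I) :
    PoisQuot 𝕜 k d I :=
  mk 𝕜 k d I (of 𝕜 m)

/-- The homogeneous parts. -/
def deg (𝕜 : Type u) [Field 𝕜] (k : ℕ) (d : ℤ) (I : Type) (p : ℤ) :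
    Submodule 𝕜 (PoisQuot 𝕜 k d I) :=
  (PoisFree.deg 𝕜 d I p).map (mk 𝕜 k d I)

/-- The renaming of inputs modulo the relations. -/
def map (𝕜 : Type u) [Field 𝕜] (k : ℕ) (d : ℤ) {I J : Type} [Finite I] [Finite J] (e : I ≃ J) :
    PoisQuot 𝕜 k d I →ₗ[𝕜] PoisQuot 𝕜 k d J :=
  lift (mk 𝕜 k d J ∘ₗ PoisFree.map e) (fun _ hx => mk_eq_zero (map_mem_ideal e hx))

/-- The partial composition modulo the relations. -/
def comp (𝕜 : Type u) [Field 𝕜] (k : ℕ) (d : ℤ) {I J : Type} [Finite I] [Finite J] :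
    PoisQuot 𝕜 k d (Option I) →ₗ[𝕜] PoisQuot 𝕜 k d J →ₗ[𝕜] PoisQuot 𝕜 k d (I ⊕ J) :=
  lift
    (lift (PoisFree.comp.compr₂ (mk 𝕜 k d (I ⊕ J))).flip
      (fun _ hy => LinearMap.ext fun x => mk_eq_zero (comp_mem_ideal_right x hy))).flip
    (fun x hx => LinearMap.ext fun y => by
      obtain ⟨y, rfl⟩ := mk_surjective y
      exact mk_eq_zero (comp_mem_ideal_left hx y))

theorem map_mk {𝕜 : Type u} [Field 𝕜] {k : ℕ} {d : ℤ} {I J : Type} [Finite I] [Finite J]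
    (e : I ≃ J) (x : PoisFree 𝕜 k I) :
    map 𝕜 k d e (mk 𝕜 k d I x) = mk 𝕜 k d J (PoisFree.map e x) := rfl

theorem comp_mk {𝕜 : Type u} [Field 𝕜] {k : ℕ} {d : ℤ} {I J : Type} [Finite I] [Finite J]
    (x : PoisFree 𝕜 k (Option I)) (y : PoisFree 𝕜 k J) :
    comp 𝕜 k d (mk 𝕜 k d (Option I) x) (mk 𝕜 k d J y) = mk 𝕜 k d (I ⊕ J) (PoisFree.comp x y) :=
  rfl

theorem map_cls {𝕜 : Type u} [Field 𝕜] {k : ℕ} {d : ℤ} {I J : Type} [Finite I] [Finite J]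
    (e : I ≃ J) (m : PoisMono k I) : map 𝕜 k d e (cls 𝕜 d m) = cls 𝕜 d (m.map e) := by
  rw [cls, map_mk, map_of, cls]

theorem comp_cls {𝕜 : Type u} [Field 𝕜] {k : ℕ} {d : ℤ} {I J : Type} [Finite I] [Finite J]
    (a : PoisMono k (Option I)) (b : PoisMono k J) :
    comp 𝕜 k d (cls 𝕜 d a) (cls 𝕜 d b) = cls 𝕜 d (a.comp b) := by
  rw [cls, cls, comp_mk, comp_of, cls]

theorem quot_induction {𝕜 : Type u} [Field 𝕜] {k : ℕ} {d : ℤ} {I : Type}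
    {C : PoisQuot 𝕜 k d I → Prop} (h0 : C 0)
    (hadd : ∀ x y, C x → C y → C (x + y)) (hsmul : ∀ (c : 𝕜) x, C x → C (c • x))
    (hC : ∀ m, C (cls 𝕜 d m)) (x : PoisQuot 𝕜 k d I) : C x := by
  obtain ⟨x, rfl⟩ := mk_surjective x
  induction x using Finsupp.induction_linear with
  | zero => rw [LinearMap.map_zero]; exact h0
  | add y z hy hz => rw [LinearMap.map_add]; exact hadd _ _ hy hz
  | single b c =>
    have hc : Finsupp.single b c = c • of 𝕜 b := by simp [of]
    rw [hc, LinearMap.map_smul]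
    exact hsmul _ _ (hC b)

theorem linearMap_ext {𝕜 : Type u} [Field 𝕜] {k : ℕ} {d : ℤ} {I : Type} {M : Type*}
    [AddCommGroup M] [Module 𝕜 M] {f g : PoisQuot 𝕜 k d I →ₗ[𝕜] M}
    (h : ∀ m, f (cls 𝕜 d m) = g (cls 𝕜 d m)) (x : PoisQuot 𝕜 k d I) : f x = g x := by
  induction x using quot_induction with
  | h0 => rw [LinearMap.map_zero, LinearMap.map_zero]
  | hadd x y hx hy => rw [LinearMap.map_add, LinearMap.map_add, hx, hy]
  | hsmul c x hx => rw [LinearMap.map_smul, LinearMap.map_smul, hx]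
  | hC m => exact h m

theorem deg_induction {𝕜 : Type u} [Field 𝕜] {k : ℕ} {d : ℤ} {I : Type} {p : ℤ}
    {C : PoisQuot 𝕜 k d I → Prop} (h0 : C 0)
    (hadd : ∀ x y, C x → C y → C (x + y)) (hsmul : ∀ (c : 𝕜) x, C x → C (c • x))
    (hC : ∀ m, m.degree d = p → C (cls 𝕜 d m)) (x : PoisQuot 𝕜 k d I)
    (hx : x ∈ deg 𝕜 k d I p) : C x := by
  obtain ⟨x, hx, rfl⟩ := hx
  rw [SetLike.mem_coe, deg_eq_span] at hx
  induction hx using Submodule.span_induction with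
  | mem x h => obtain ⟨m, hm, rfl⟩ := h; exact hC m hm
  | zero => rw [LinearMap.map_zero]; exact h0
  | add y z _ _ hy hz => rw [LinearMap.map_add]; exact hadd _ _ hy hz
  | smul c x _ hx => rw [LinearMap.map_smul]; exact hsmul _ _ hx

theorem mk_eq {𝕜 : Type u} [Field 𝕜] {k : ℕ} {d : ℤ} {I : Type} {x y : PoisFree 𝕜 k I}
    (h : PoisRel 𝕜 k d I (x - y)) :
    mk 𝕜 k d I x = mk 𝕜 k d I y :=
  (Submodule.Quotient.eq _).2 (Submodule.subset_span h)

theorem mk_mem {𝕜 : Type u} [Field 𝕜] {k : ℕ} {d : ℤ} {I : Type} {p : ℤ} {x : PoisFree 𝕜 k I}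
    (hx : x ∈ PoisFree.deg 𝕜 d I p) : mk 𝕜 k d I x ∈ deg 𝕜 k d I p :=
  Submodule.mem_map_of_mem hx

/-- The homogeneous components of a linear combination of monomials. -/
def components (𝕜 : Type u) [Field 𝕜] (k : ℕ) (d : ℤ) (I : Type) :
    PoisFree 𝕜 k I →ₗ[𝕜] ⨁ p, deg 𝕜 k d I p :=
  Finsupp.linearCombination 𝕜 fun m =>
    DirectSum.lof 𝕜 ℤ (fun p => deg 𝕜 k d I p) (m.degree d)
      ⟨cls 𝕜 d m, mk_mem (of_mem_deg 𝕜 d m rfl)⟩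

theorem components_of_mem {𝕜 : Type u} [Field 𝕜] {k : ℕ} {d : ℤ} {I : Type} (p : ℤ)
    (x : PoisFree 𝕜 k I) (hx : x ∈ PoisFree.deg 𝕜 d I p) :
    components 𝕜 k d I x = DirectSum.lof 𝕜 ℤ (fun p => deg 𝕜 k d I p) p ⟨_, mk_mem hx⟩ := by
  have hx' := hx
  rw [deg_eq_span] at hx'
  induction hx' using Submodule.span_induction with
  | mem x h =>
    obtain ⟨m, rfl, rfl⟩ := h
    simp only [components, of, Finsupp.linearCombination_single, one_smul]
    rfl
  | zero => simp only [LinearMap.map_zero]; exact (LinearMap.map_zero _).symm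
  | add x y h1 h2 ihx ihy =>
    rw [← deg_eq_span] at h1 h2
    rw [LinearMap.map_add, ihx h1, ihy h2, ← LinearMap.map_add]; rfl
  | smul c x h1 ih =>
    rw [← deg_eq_span] at h1
    rw [LinearMap.map_smul, ih h1, ← LinearMap.map_smul]; rfl

theorem isInternal (𝕜 : Type u) [Field 𝕜] (k : ℕ) (d : ℤ) (I : Type) :
    DirectSum.IsInternal (deg 𝕜 k d I) := by
  have hker : ∀ x ∈ poisIdeal 𝕜 k d I, components 𝕜 k d I x = 0 := by
    intro x hx
    rw [← LinearMap.mem_ker]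
    revert x
    refine Submodule.span_le.2 fun x hx => ?_
    obtain ⟨p, hp⟩ := rel_homogeneous hx
    have h0 : (⟨_, mk_mem hp⟩ : deg 𝕜 k d I p) = 0 :=
      Subtype.ext (mk_eq_zero (Submodule.subset_span hx))
    rw [SetLike.mem_coe, LinearMap.mem_ker, components_of_mem p x hp, h0, LinearMap.map_zero]
  refine isInternal_of_linearMap _ (lift (components 𝕜 k d I) hker)
    (fun x => ?_) (fun p x => ?_)
  · refine linearMap_ext (f := DirectSum.coeLinearMap (deg 𝕜 k d I) ∘ₗ
      lift (components 𝕜 k d I) hker) (g := LinearMap.id) (fun m => ?_) x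
    rw [LinearMap.comp_apply, cls, lift_mk,
      components_of_mem _ _ (of_mem_deg 𝕜 d m rfl), DirectSum.coeLinearMap_lof]
    rfl
  · obtain ⟨_, x, hx, rfl⟩ := x
    exact components_of_mem p x hx

theorem comp_seq {𝕜 : Type u} [Field 𝕜] {k : ℕ} {d : ℤ} {I J K : Type} [Finite I] [Finite J]
    [Finite K] (a : PoisQuot 𝕜 k d (Option I)) (b : PoisQuot 𝕜 k d (Option J))
    (c : PoisQuot 𝕜 k d K) :
    map 𝕜 k d (Equiv.sumAssoc I J K)
        (comp 𝕜 k d (map 𝕜 k d (seqEquiv I J) (comp 𝕜 k d a b)) c) =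
      comp 𝕜 k d a (comp 𝕜 k d b c) := by
  induction a using quot_induction with
  | h0 => simp only [LinearMap.map_zero, LinearMap.zero_apply]
  | hadd x y hx hy => simp only [LinearMap.map_add, LinearMap.add_apply, hx, hy]
  | hsmul c x hx => simp only [LinearMap.map_smul, LinearMap.smul_apply, hx]
  | hC m =>
    induction b using quot_induction with
    | h0 => simp only [LinearMap.map_zero, LinearMap.zero_apply]
    | hadd x y hx hy => simp only [LinearMap.map_add, LinearMap.add_apply, hx, hy]
    | hsmul c x hx => simp only [LinearMap.map_smul, LinearMap.smul_apply, hx]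
    | hC n =>
      induction c using quot_induction with
      | h0 => simp only [LinearMap.map_zero]
      | hadd x y hx hy => simp only [LinearMap.map_add, hx, hy]
      | hsmul c x hx => simp only [LinearMap.map_smul, hx]
      | hC r =>
        simp only [comp_cls, map_cls]
        exact mk_eq (PoisRel.comp_seq m n r)

theorem comp_par {𝕜 : Type u} [Field 𝕜] {k : ℕ} {d : ℤ} {I J K : Type} [Finite I] [Finite J]
    [Finite K] (a : PoisQuot 𝕜 k d (Option (Option I))) {p q : ℤ} (b : PoisQuot 𝕜 k d J)
    (c : PoisQuot 𝕜 k d K) (hb : b ∈ deg 𝕜 k d J p) (hc : c ∈ deg 𝕜 k d K q) :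
    map 𝕜 k d (sumRightSwap I J K)
        (comp 𝕜 k d (map 𝕜 k d (parEquiv I J) (comp 𝕜 k d a b)) c) =
      zsign 𝕜 (p * q) • comp 𝕜 k d
        (map 𝕜 k d (parEquiv I K) (comp 𝕜 k d (map 𝕜 k d (swapEquiv I) a) c)) b := by
  induction a using quot_induction with
  | h0 => simp only [LinearMap.map_zero, LinearMap.zero_apply, smul_zero]
  | hadd x y hx hy => simp only [LinearMap.map_add, LinearMap.add_apply, hx, hy, smul_add]
  | hsmul c x hx =>
    simp only [LinearMap.map_smul, LinearMap.smul_apply, hx]; rw [smul_comm]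
  | hC m =>
    revert b
    refine deg_induction ?_ ?_ ?_ ?_
    · simp only [LinearMap.map_zero, LinearMap.zero_apply, smul_zero]
    · intro x y hx hy
      simp only [LinearMap.map_add, LinearMap.add_apply, hx, hy, smul_add]
    · intro c x hx
      simp only [LinearMap.map_smul, LinearMap.smul_apply, hx]; rw [smul_comm]
    · rintro n rfl
      revert c
      refine deg_induction ?_ ?_ ?_ ?_
      · simp only [LinearMap.map_zero, LinearMap.zero_apply, smul_zero]
      · intro x y hx hy
        simp only [LinearMap.map_add, LinearMap.add_apply, hx, hy, smul_add]
      · intro c x hx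
        simp only [LinearMap.map_smul, LinearMap.smul_apply, hx]; rw [smul_comm]
      · rintro r rfl
        simp only [comp_cls, map_cls]
        exact mk_eq (PoisRel.comp_par m n r)

theorem comp_map {𝕜 : Type u} [Field 𝕜] {k : ℕ} {d : ℤ} {I J I' J' : Type} [Finite I] [Finite J]
    [Finite I'] [Finite J'] (e : I ≃ I') (f : J ≃ J') (a : PoisQuot 𝕜 k d (Option I))
    (b : PoisQuot 𝕜 k d J) :
    comp 𝕜 k d (map 𝕜 k d e.optionCongr a) (map 𝕜 k d f b) =
      map 𝕜 k d (e.sumCongr f) (comp 𝕜 k d a b) := by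
  induction a using quot_induction with
  | h0 => simp only [LinearMap.map_zero, LinearMap.zero_apply]
  | hadd x y hx hy => simp only [LinearMap.map_add, LinearMap.add_apply, hx, hy]
  | hsmul c x hx => simp only [LinearMap.map_smul, LinearMap.smul_apply, hx]
  | hC m =>
    induction b using quot_induction with
    | h0 => simp only [LinearMap.map_zero]
    | hadd x y hx hy => simp only [LinearMap.map_add, hx, hy]
    | hsmul c x hx => simp only [LinearMap.map_smul, hx]
    | hC n =>
      simp only [comp_cls, map_cls]
      exact mk_eq (PoisRel.comp_map e f m n)

theorem one_comp {𝕜 : Type u} [Field 𝕜] {k : ℕ} {d : ℤ} {J : Type} [Finite J]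
    (b : PoisQuot 𝕜 k d J) :
    map 𝕜 k d (Equiv.emptySum Empty J)
      (comp 𝕜 k d (map 𝕜 k d unitEquiv (cls 𝕜 d PoisMono.one)) b) = b := by
  induction b using quot_induction with
  | h0 => simp only [LinearMap.map_zero]
  | hadd x y hx hy => simp only [LinearMap.map_add, hx, hy]
  | hsmul c x hx => simp only [LinearMap.map_smul, hx]
  | hC n =>
    simp only [comp_cls, map_cls]
    exact mk_eq (PoisRel.one_comp n)

theorem comp_one {𝕜 : Type u} [Field 𝕜] {k : ℕ} {d : ℤ} {I : Type} [Finite I]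
    (a : PoisQuot 𝕜 k d (Option I)) :
    comp 𝕜 k d a (cls 𝕜 d PoisMono.one) = map 𝕜 k d (Equiv.optionEquivSumPUnit I) a := by
  induction a using quot_induction with
  | h0 => simp only [LinearMap.map_zero, LinearMap.zero_apply]
  | hadd x y hx hy => simp only [LinearMap.map_add, LinearMap.add_apply, hx, hy]
  | hsmul c x hx => simp only [LinearMap.map_smul, LinearMap.smul_apply, hx]
  | hC m =>
    simp only [comp_cls, map_cls]
    exact mk_eq (PoisRel.comp_one m)

end PoisQuot

/-- The operad `Pois^k_d`, generated by a commutative associative product `μ` of degree `0` and a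
`(k+1)`-ary operation `ν` of degree `1 - k d`, symmetric for even `d` and skew-symmetric for odd
`d`, subject to the generalized Jacobi identity for `ν` and the Leibniz identity. -/
def Pois (𝕜 : Type u) [Field 𝕜] (k : ℕ) (d : ℤ) : GrOperad.{u, max 1 u} 𝕜 where
  obj I := PoisQuot 𝕜 k d I
  deg I := PoisQuot.deg 𝕜 k d I
  isInternal I := PoisQuot.isInternal 𝕜 k d I
  map e := PoisQuot.map 𝕜 k d e
  one := PoisQuot.cls 𝕜 d PoisMono.one
  comp := PoisQuot.comp 𝕜 k d
  map_refl a := PoisQuot.linearMap_ext (f := PoisQuot.map 𝕜 k d (Equiv.refl _))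
    (g := LinearMap.id)
    (fun m => (PoisQuot.map_cls _ m).trans (PoisQuot.mk_eq (PoisRel.map_refl m))) a
  map_trans e f a := PoisQuot.linearMap_ext (f := PoisQuot.map 𝕜 k d (e.trans f))
    (g := PoisQuot.map 𝕜 k d f ∘ₗ PoisQuot.map 𝕜 k d e)
    (fun m => by
      rw [LinearMap.comp_apply, PoisQuot.map_cls, PoisQuot.map_cls, PoisQuot.map_cls]
      exact PoisQuot.mk_eq (PoisRel.map_trans e f m)) a
  map_mem e p a ha := by
    obtain ⟨x, hx, rfl⟩ := ha
    exact PoisQuot.mk_mem (PoisFree.map_mem e hx)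
  one_mem := PoisQuot.mk_mem (PoisFree.of_mem_deg 𝕜 d _ rfl)
  comp_mem {I J} _ _ p q a b ha hb := by
    obtain ⟨x, hx, rfl⟩ := ha
    obtain ⟨y, hy, rfl⟩ := hb
    exact PoisQuot.mk_mem (PoisFree.comp_mem hx hy)
  comp_map e f a b := PoisQuot.comp_map e f a b
  one_comp b := PoisQuot.one_comp b
  comp_one a := PoisQuot.comp_one a
  comp_seq a b c := PoisQuot.comp_seq a b c
  comp_par a _ _ _ _ hb hc := PoisQuot.comp_par a _ _ hb hc

/-- The generating product `μ ∈ Pois^k_d(2)`. -/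
def Pois.mu (𝕜 : Type u) [Field 𝕜] (k : ℕ) (d : ℤ) : (Pois 𝕜 k d).obj (Fin 2) :=
  PoisQuot.cls 𝕜 d PoisMono.mu

/-- The generating bracket `ν ∈ Pois^k_d(k+1)`. -/
def Pois.nu (𝕜 : Type u) [Field 𝕜] (k : ℕ) (d : ℤ) : (Pois 𝕜 k d).obj (Fin (k + 1)) :=
  PoisQuot.cls 𝕜 d PoisMono.nu

end Poisson

/-! ### Hopf operads -/

section Hopf

/-- The `n`-fold iterated product `m(x₀, m(x₁, … m(x_(n-1), x_n)))` of `n + 1` inputs. -/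
def GrOperad.iterMul {𝕜 : Type u} [Field 𝕜] (P : GrOperad.{u, v} 𝕜) (m : P.obj (Fin 2)) :
    (n : ℕ) → P.obj (Fin (n + 1))
  | 0 => P.map (Equiv.ofUnique Unit (Fin 1)) P.one
  | n + 1 => P.map (finSumFinEquiv (m := n) (n := 2)) (P.comp (P.map finSuccEquivLast (P.iterMul m n)) m : P.obj (Fin n ⊕ Fin 2))

/-- The components `P(I) → P(I) ⊗ P(I)` of a morphism of operads `P → P ⊗ P`. -/
def GrOperad.Hom.comul {𝕜 : Type u} [Field 𝕜] {P : GrOperad.{u, v} 𝕜}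
    (Δ : GrOperad.Hom P (P.tensor P)) (I : Type) [Finite I] :
    P.obj I →ₗ[𝕜] P.obj I ⊗[𝕜] P.obj I :=
  Δ.app I

/-- The components `P(I) → 𝕜` of a morphism of operads `P → Com`. -/
def GrOperad.Hom.counit {𝕜 : Type u} [Field 𝕜] {P : GrOperad.{u, v} 𝕜}
    (ε : GrOperad.Hom P (Com 𝕜)) (I : Type) [Finite I] : P.obj I →ₗ[𝕜] 𝕜 :=
  (comSpace 𝕜 I).subtype ∘ₗ ε.app I

/-- The comultiplication `Δ : P → P ⊗ P`, a morphism of operads, makes every `P(I)` a coassociative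
and (graded) cocommutative coalgebra. -/
structure GrOperad.IsHopf {𝕜 : Type u} [Field 𝕜] {P : GrOperad.{u, v} 𝕜}
    (Δ : GrOperad.Hom P (P.tensor P)) : Prop where
  coassoc : ∀ (I : Type) [Finite I] (x : P.obj I),
    TensorProduct.assoc 𝕜 (P.obj I) (P.obj I) (P.obj I)
      ((Δ.comul I).rTensor (P.obj I) (Δ.comul I x)) = (Δ.comul I).lTensor (P.obj I) (Δ.comul I x)
  cocomm : ∀ (I : Type) [Finite I] (x : P.obj I),
    koszulSwap (P.isInternal I) (P.isInternal I) (Δ.comul I x) = Δ.comul I x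

/-- The Hopf operad `(P, Δ)` is unital, with counits `ε`. -/
structure GrOperad.IsUnital {𝕜 : Type u} [Field 𝕜] {P : GrOperad.{u, v} 𝕜}
    (Δ : GrOperad.Hom P (P.tensor P)) (ε : GrOperad.Hom P (Com 𝕜)) : Prop where
  counit_comul : ∀ (I : Type) [Finite I] (x : P.obj I),
    TensorProduct.lid 𝕜 (P.obj I) ((ε.counit I).rTensor (P.obj I) (Δ.comul I x)) = x
  comul_counit : ∀ (I : Type) [Finite I] (x : P.obj I),
    TensorProduct.rid 𝕜 (P.obj I) ((ε.counit I).lTensor (P.obj I) (Δ.comul I x)) = x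
  surjective : ∀ (I : Type) [Finite I], Function.Surjective (ε.app I)

/-- The Hopf operad `(P, Δ)` with counits `ε` is augmented by `η : Com → P`, and `m ∈ P(2)` is the
image of the commutative product. -/
structure GrOperad.IsAugmented {𝕜 : Type u} [Field 𝕜] {P : GrOperad.{u, v} 𝕜}
    (Δ : GrOperad.Hom P (P.tensor P)) (ε : GrOperad.Hom P (Com 𝕜)) (η : GrOperad.Hom (Com 𝕜) P)
    (m : P.obj (Fin 2)) : Prop where
  comul_app : ∀ (I : Type) [Nonempty I] [Finite I],
    Δ.comul I (η.app I ⟨1, mem_comSpace 1⟩) =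
      η.app I ⟨1, mem_comSpace 1⟩ ⊗ₜ η.app I ⟨1, mem_comSpace 1⟩
  counit_app : ∀ (I : Type) [Finite I] (c : (Com 𝕜).obj I), ε.app I (η.app I c) = c
  app_one : η.app (Fin 2) ⟨1, mem_comSpace 1⟩ = m

/-- The element `γ ∈ P(n+1)` is primitive. -/
def GrOperad.IsPrimitive {𝕜 : Type u} [Field 𝕜] {P : GrOperad.{u, v} 𝕜}
    (Δ : GrOperad.Hom P (P.tensor P)) (m : P.obj (Fin 2)) {n : ℕ} (γ : P.obj (Fin (n + 1))) :
    Prop :=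
  Δ.comul _ γ = P.iterMul m n ⊗ₜ[𝕜] γ + γ ⊗ₜ[𝕜] P.iterMul m n

/-- Suboperads. -/
structure GrOperad.Suboperad {𝕜 : Type u} [Field 𝕜] (P : GrOperad.{u, v} 𝕜) where
  carrier : ∀ (I : Type) [Finite I], Submodule 𝕜 (P.obj I)
  one_mem : P.one ∈ carrier Unit
  map_mem : ∀ {I J : Type} [Finite I] [Finite J] (e : I ≃ J) {a : P.obj I},
    a ∈ carrier I → P.map e a ∈ carrier J
  comp_mem : ∀ {I J : Type} [Finite I] [Finite J] {a : P.obj (Option I)} {b : P.obj J},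
    a ∈ carrier (Option I) → b ∈ carrier J → P.comp a b ∈ carrier (I ⊕ J)

/-- The element `γ` is a primitive generator: it is primitive, and the only suboperad that contains
the product `m` and `γ` is `P`. -/
structure GrOperad.IsPrimitiveGenerator {𝕜 : Type u} [Field 𝕜] {P : GrOperad.{u, v} 𝕜}
    (Δ : GrOperad.Hom P (P.tensor P)) (m : P.obj (Fin 2)) {n : ℕ} (γ : P.obj (Fin (n + 1))) :
    Prop where
  primitive : GrOperad.IsPrimitive Δ m γ
  generates : ∀ S : P.Suboperad, m ∈ S.carrier (Fin 2) → γ ∈ S.carrier (Fin (n + 1)) →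
    ∀ (I : Type) [Finite I], S.carrier I = ⊤

end Hopf

end

noncomputable section

/-! ### Iterated products in operads with a commutative associative product -/

namespace GrOperad

section Products

variable {𝕜 : Type u} [Field 𝕜]

/-! `Pois^k_d` is given by generators and relations, so a morphism from it to an operad `P` amounts
to a pair of operations of `P` that satisfies the defining relations (`IsPois`, `Pois.desc`,
`Pois.hom_ext`). The theorem follows from this universal property and one closure statement,
`IsPois.tensor`: if `(m, n)` in `P` and `(m', n')` in `Q` satisfy the relations, then so do `m ⊗ m'`
and `M ⊗ n' + n ⊗ M'` in `P ⊗ Q`, where `M` and `M'` are the `k`-fold iterated products.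

Symmetry and the Leibniz identity for the new bracket reduce to one tensor factor at a time, because
`M` is invariant under permutations and products compose to products. The content is the Jacobi
identity. The new bracket composed with itself has four terms. Two of them, `M ∘ M ⊗ n' ∘ n'` and `n
∘ n ⊗ M' ∘ M'`, vanish by the Jacobi identities of `Q` and `P`. In each of the other two, one factor
is a bracket applied to a product. By Leibniz it becomes a sum over the inner inputs `x_j`: that
bracket sees the `k` outer inputs and `x_j`, the other factor's bracket sees the `k + 1` inner
inputs, and all remaining inputs are multiplied on. Summed over cosets, each cross sum runs over
ordered pairs of `(k+1)`-subsets of the `2k+1` inputs that meet in one point, and the two sums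
differ by exchanging the two subsets. The exchanging permutation has sign `(-1)^k`, which
contributes `(-1)^(kd)` through the symmetry of the brackets; the Koszul sign of one cross term is
`(-1)^((1-kd)^2)`. The product of these signs is `-1`, so the cross terms cancel (`sum_exchange`,
`IsPois.sum_cross`, `zsign_bracket`).

To make this computable without tracking numberings, the iterated product is replaced by the product
`totalMul` over an arbitrary finite set, and "a bracket times all other inputs" by `extendMul`,
indexed by the embedding of the bracket's inputs.

Coassociativity, cocommutativity and the counit identities are equalities of operad morphisms out of
`Pois^k_d`, hence need checking on `μ` and `ν` only; for this the symmetry, associativity and unit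
maps of the tensor product are shown to be morphisms of operads. The counit is the morphism to `Com`
that kills `ν`, and the augmentation is the morphism from `Com` defined by the product `μ`.
Generation by `μ` and `ν` is an induction over monomials, and applied to the locus where two
morphisms agree it gives uniqueness. -/

theorem map_map (P : GrOperad.{u, v} 𝕜) {I J K : Type} [Finite I] [Finite J] [Finite K]
    (e : I ≃ J) (f : J ≃ K) (a : P.obj I) : P.map f (P.map e a) = P.map (e.trans f) a :=
  (P.map_trans e f a).symm

theorem map_congr (P : GrOperad.{u, v} 𝕜) {I J : Type} [Finite I] [Finite J]
    {e f : I ≃ J} (h : ∀ x, e x = f x) (a : P.obj I) : P.map e a = P.map f a := by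
  rw [Equiv.ext h]

theorem map_symm_map (P : GrOperad.{u, v} 𝕜) {I J : Type} [Finite I] [Finite J]
    (e : I ≃ J) (a : P.obj I) : P.map e.symm (P.map e a) = a := by
  rw [map_map, Equiv.self_trans_symm, P.map_refl]

theorem map_map_symm (P : GrOperad.{u, v} 𝕜) {I J : Type} [Finite I] [Finite J]
    (e : I ≃ J) (a : P.obj J) : P.map e (P.map e.symm a) = a := by
  rw [map_map, Equiv.symm_trans_self, P.map_refl]

theorem map_comp_left (P : GrOperad.{u, v} 𝕜) {I J I' : Type} [Finite I] [Finite J] [Finite I']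
    (e : I ≃ I') (a : P.obj (Option I)) (b : P.obj J) :
    P.comp (P.map e.optionCongr a) b = P.map (e.sumCongr (Equiv.refl J)) (P.comp a b) := by
  rw [← P.comp_map, P.map_refl]

theorem map_comp_right (P : GrOperad.{u, v} 𝕜) {I J J' : Type} [Finite I] [Finite J] [Finite J']
    (f : J ≃ J') (a : P.obj (Option I)) (b : P.obj J) :
    P.comp a (P.map f b) = P.map ((Equiv.refl I).sumCongr f) (P.comp a b) := by
  rw [← P.comp_map, Equiv.optionCongr_refl, P.map_refl]

/-- Sequential associativity, solved for the composition on the left. -/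
theorem comp_map_seqEquiv (P : GrOperad.{u, v} 𝕜) {I J K : Type} [Finite I] [Finite J] [Finite K]
    (a : P.obj (Option I)) (b : P.obj (Option J)) (c : P.obj K) :
    P.comp (P.map (seqEquiv I J) (P.comp a b)) c =
      P.map (Equiv.sumAssoc I J K).symm (P.comp a (P.comp b c)) := by
  rw [← P.comp_seq, map_symm_map]

/-- The operation `a` is invariant under the exchange of the inputs `x` and `y`. -/
def SwapInv (P : GrOperad.{u, v} 𝕜) {I : Type} [Finite I] (a : P.obj I) (x y : I) : Prop :=
  P.map (@Equiv.swap I (Classical.decEq I) x y) a = a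

/-- `SwapInv` fixes the classical decidability instance so that it makes sense for every finite
type; this frees the statement from that choice. -/
theorem swapInv_iff (P : GrOperad.{u, v} 𝕜) {I : Type} [Finite I] [inst : DecidableEq I]
    (a : P.obj I) (x y : I) : P.SwapInv a x y ↔ P.map (Equiv.swap x y) a = a := by
  rw [SwapInv, Subsingleton.elim (Classical.decEq I) inst]

theorem SwapInv.refl (P : GrOperad.{u, v} 𝕜) {I : Type} [Finite I] (a : P.obj I) (x : I) :
    P.SwapInv a x x := by
  classical
  rw [swapInv_iff, Equiv.swap_self, P.map_refl]

theorem SwapInv.symm {P : GrOperad.{u, v} 𝕜} {I : Type} [Finite I] {a : P.obj I} {x y : I}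
    (h : P.SwapInv a x y) : P.SwapInv a y x := by
  classical
  rw [swapInv_iff] at h ⊢
  rwa [Equiv.swap_comm]

/-- The transposition `(x z)` is the conjugate of `(y z)` by `(x y)`. With reflexivity and symmetry
this makes `SwapInv` an equivalence relation on the inputs, so full symmetry can be proved by
linking neighbouring inputs. -/
theorem SwapInv.trans {P : GrOperad.{u, v} 𝕜} {I : Type} [Finite I] {a : P.obj I} {x y z : I}
    (h : P.SwapInv a x y) (h' : P.SwapInv a y z) : P.SwapInv a x z := by
  classical
  rw [swapInv_iff] at h h' ⊢
  by_cases hyz : y = z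
  · rwa [← hyz]
  by_cases hxz : x = z
  · rw [hxz, Equiv.swap_self, P.map_refl]
  have key : Equiv.swap x z = ((Equiv.swap x y).trans (Equiv.swap y z)).trans (Equiv.swap x y) := by
    rw [Equiv.swap_comm x y, Equiv.swap_comm y z,
      ← Equiv.swap_mul_swap_mul_swap (Ne.symm hyz) (Ne.symm hxz)]
    rfl
  rw [key, P.map_trans, P.map_trans, h, h', h]

theorem SwapInv.map {P : GrOperad.{u, v} 𝕜} {I J : Type} [Finite I] [Finite J] {a : P.obj I}
    {x y : I} (h : P.SwapInv a x y) (e : I ≃ J) : P.SwapInv (P.map e a) (e x) (e y) := by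
  classical
  rw [swapInv_iff] at h ⊢
  conv_rhs => rw [← h]
  rw [map_map, map_map]
  refine P.map_congr (fun z => ?_) a
  simp [Equiv.swap_apply_def, apply_ite e]

theorem SwapInv.of_map {P : GrOperad.{u, v} 𝕜} {I J : Type} [Finite I] [Finite J] {a : P.obj I}
    {x y : I} {e : I ≃ J} (h : P.SwapInv (P.map e a) (e x) (e y)) : P.SwapInv a x y := by
  have h' := h.map e.symm
  rwa [map_symm_map, e.symm_apply_apply, e.symm_apply_apply] at h'

theorem SwapInv.comp_left {P : GrOperad.{u, v} 𝕜} {I J : Type} [Finite I] [Finite J]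
    {a : P.obj (Option I)} {x y : I} (h : P.SwapInv a (some x) (some y)) (b : P.obj J) :
    P.SwapInv (P.comp a b) (.inl x) (.inl y) := by
  classical
  rw [swapInv_iff] at h ⊢
  conv_rhs => rw [← h]
  rw [← Equiv.optionCongr_swap, map_comp_left]
  refine P.map_congr (fun z => ?_) _
  rcases z with z | z <;> simp [Equiv.swap_apply_def]

theorem SwapInv.comp_right {P : GrOperad.{u, v} 𝕜} {I J : Type} [Finite I] [Finite J]
    {b : P.obj J} {x y : J} (h : P.SwapInv b x y) (a : P.obj (Option I)) :
    P.SwapInv (P.comp a b) (.inr x) (.inr y) := by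
  classical
  rw [swapInv_iff] at h ⊢
  conv_rhs => rw [← h]
  rw [map_comp_right]
  refine P.map_congr (fun z => ?_) _
  rcases z with z | z <;> simp [Equiv.swap_apply_def]

/-- Transpositions generate the symmetric group. -/
theorem map_eq_self_of_swapInv {P : GrOperad.{u, v} 𝕜} {I : Type} [Finite I] {a : P.obj I}
    (h : ∀ x y, P.SwapInv a x y) (σ : Equiv.Perm I) : P.map σ a = a := by
  classical
  induction σ using Equiv.Perm.swap_induction_on with
  | one => exact P.map_refl a
  | swap_mul σ x y _ ih =>
    have : Equiv.swap x y * σ = σ.trans (Equiv.swap x y) := rfl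
    rw [this, P.map_trans, ih, ← swapInv_iff]
    exact h x y

/-- The binary operation `m` of degree `0` is commutative and associative. -/
structure IsComm (P : GrOperad.{u, v} 𝕜) (m : P.obj (Fin 2)) : Prop where
  mem : m ∈ P.deg (Fin 2) 0
  symm : P.map (Equiv.swap 0 1) m = m
  assoc : P.map ((Equiv.sumComm (Fin 1) (Fin 2)).trans finSumFinEquiv)
      (P.comp (P.map (finSuccEquiv 1) m) m : P.obj (Fin 1 ⊕ Fin 2)) =
    P.map finSumFinEquiv (P.comp (P.map finSuccEquivLast m) m : P.obj (Fin 1 ⊕ Fin 2))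

/-! ### Symmetry of the iterated product -/

theorem iterMul_one (P : GrOperad.{u, v} 𝕜) (m : P.obj (Fin 2)) : P.iterMul m 1 = m := by
  have h := P.one_comp m
  -- The unit axiom is stated with `Empty` as the set of remaining inputs, while `iterMul` produces
  -- `Fin 0`; this renames one to the other.
  have h2 := congrArg (P.map (finSumFinEquiv (m := 0) (n := 2)))
    (P.map_comp_left (Equiv.equivOfIsEmpty Empty (Fin 0)) (P.map unitEquiv P.one) m)
  rw [iterMul, iterMul]
  conv_rhs => rw [← h]
  rw [map_map, map_map] at h2
  refine Eq.trans ?_ (h2.trans (P.map_congr (fun x => ?_) _))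
  · rw [map_map]
    congr 3
  · rcases x with x | x
    · exact x.elim
    · exact Fin.ext (Nat.zero_add _)

theorem IsComm.swapInv {P : GrOperad.{u, v} 𝕜} {m : P.obj (Fin 2)} (h : P.IsComm m)
    (x y : Fin 2) : P.SwapInv m x y := by
  have h01 : P.SwapInv m 0 1 := (P.swapInv_iff m 0 1).2 h.symm
  fin_cases x <;> fin_cases y
  · exact SwapInv.refl _ _ _
  · exact h01
  · exact h01.symm
  · exact SwapInv.refl _ _ _

/-- By associativity `m(x, m(y, z)) = m(m(x, y), z)`, and on the right `x` and `y` are exchanged by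
commutativity of the inner product. -/
theorem IsComm.swapInv_comp {P : GrOperad.{u, v} 𝕜} {m : P.obj (Fin 2)} (h : P.IsComm m) :
    P.SwapInv (P.comp (P.map finSuccEquivLast m) m : P.obj (Fin 1 ⊕ Fin 2)) (.inl 0) (.inr 0) := by
  have h1 := (((h.swapInv 0 1).comp_right (P.map (finSuccEquiv 1) m : P.obj (Option (Fin 1)))).map
    ((Equiv.sumComm (Fin 1) (Fin 2)).trans finSumFinEquiv))
  rw [h.assoc] at h1
  exact h1.of_map

theorem iterMul_succ (P : GrOperad.{u, v} 𝕜) (m : P.obj (Fin 2)) (n : ℕ) :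
    P.iterMul m (n + 1) = P.map (finSumFinEquiv (m := n) (n := 2))
      (P.comp (P.map finSuccEquivLast (P.iterMul m n)) m) := rfl

theorem map_finSuccEquivLast_iterMul (P : GrOperad.{u, v} 𝕜) (m : P.obj (Fin 2)) (n : ℕ) :
    P.map finSuccEquivLast (P.iterMul m (n + 1)) =
      P.map (finSumFinEquiv (m := n) (n := 1)).optionCongr (P.map (seqEquiv (Fin n) (Fin 1))
        (P.comp (P.map finSuccEquivLast (P.iterMul m n)) (P.map finSuccEquivLast m))) := by
  rw [iterMul_succ, map_comp_right, map_map, map_map, map_map]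
  refine P.map_congr (fun x => ?_) _
  rcases x with x | x
  · simp [seqEquiv]
    exact finSuccEquivLast_castSucc (Fin.castSucc x)
  · fin_cases x
    · simp [seqEquiv]
      exact finSuccEquivLast_castSucc (Fin.last n)
    · simp [seqEquiv]
      exact finSuccEquivLast_last

/-- Isolates the two innermost products of `iterMul` as a factor `m(x, m(y, z))`, to which the
symmetry `IsComm.swapInv_comp` applies. -/
theorem comp_map_iterMul (P : GrOperad.{u, v} 𝕜) (m : P.obj (Fin 2)) (n : ℕ) :
    P.comp (P.map finSuccEquivLast (P.iterMul m (n + 1))) m =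
      P.map ((Equiv.sumAssoc (Fin n) (Fin 1) (Fin 2)).symm.trans
        ((finSumFinEquiv (m := n) (n := 1)).sumCongr (Equiv.refl (Fin 2))))
        (P.comp (P.map finSuccEquivLast (P.iterMul m n))
          (P.comp (P.map finSuccEquivLast m) m)) := by
  rw [map_finSuccEquivLast_iterMul, map_comp_left, comp_map_seqEquiv, map_map]

/-- In the composite of `iterMul m n` with `m`, the first `n` inputs are exchangeable by induction
and the last two by commutativity; one link between these groups suffices. -/
theorem IsComm.swapInv_iterMul {P : GrOperad.{u, v} 𝕜} {m : P.obj (Fin 2)} (h : P.IsComm m)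
    (n : ℕ) (x y : Fin (n + 1)) : P.SwapInv (P.iterMul m n) x y := by
  induction n with
  | zero => 
    have hxy : x = y := Subsingleton.elim (α := Fin 1) x y
    rw [hxy]; exact SwapInv.refl _ _ _
  | succ n ih =>
    have hl : ∀ x y : Fin n, P.SwapInv (P.comp (P.map finSuccEquivLast (P.iterMul m n)) m)
        (.inl x) (.inl y) := fun x y => by
      refine SwapInv.comp_left ?_ m
      have := (ih x.castSucc y.castSucc).map finSuccEquivLast
      rwa [finSuccEquivLast_castSucc, finSuccEquivLast_castSucc] at this
    have hr : ∀ x y : Fin 2, P.SwapInv (P.comp (P.map finSuccEquivLast (P.iterMul m n)) m)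
        (.inr x) (.inr y) := fun x y => (h.swapInv x y).comp_right _
    -- The link comes from associativity, by exchanging the last outer input with the first inner
    -- one. If `n = 0` there are no outer inputs to link.
    have hlink : ∀ x : Fin n, P.SwapInv (P.comp (P.map finSuccEquivLast (P.iterMul m n)) m)
        (.inl x) (.inr 0) := by
      intro x
      cases n with
      | zero => exact x.elim0
      | succ n =>
        have h1 : P.SwapInv (P.comp (P.map finSuccEquivLast (P.iterMul m (n + 1))) m)
            (.inl (Fin.last n)) (.inr 0) := by
          rw [comp_map_iterMul]
          exact (h.swapInv_comp.comp_right (P.map finSuccEquivLast (P.iterMul m n))).map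
            ((Equiv.sumAssoc (Fin n) (Fin 1) (Fin 2)).symm.trans
              ((finSumFinEquiv (m := n) (n := 1)).sumCongr (Equiv.refl (Fin 2))))
        exact (hl _ _).trans h1
    have hall : ∀ x, P.SwapInv (P.comp (P.map finSuccEquivLast (P.iterMul m n)) m)
        x (.inr 0) := by
      rintro (x | x)
      exacts [hlink x, hr x 0]
    have := ((hall (finSumFinEquiv.symm x)).trans (hall (finSumFinEquiv.symm y)).symm).map
      finSumFinEquiv
    rwa [Equiv.apply_symm_apply, Equiv.apply_symm_apply] at this

/-- The product of a nonempty finite set of inputs, with respect to the binary operation `m`. -/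
def totalMul (P : GrOperad.{u, v} 𝕜) (m : P.obj (Fin 2)) (I : Type) [Finite I] [Nonempty I] :
    P.obj I :=
  P.map ((finCongr (Nat.sub_add_cancel Nat.card_pos)).trans (Finite.equivFin I).symm)
    (P.iterMul m (Nat.card I - 1))

/-- Two enumerations of the inputs differ by a permutation, which fixes the iterated product. Hence
the enumeration chosen in `totalMul` does not matter. -/
theorem IsComm.totalMul_eq {P : GrOperad.{u, v} 𝕜} {m : P.obj (Fin 2)} (h : P.IsComm m)
    {I : Type} [Finite I] [Nonempty I] {n : ℕ} (e : Fin (n + 1) ≃ I) :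
    P.totalMul m I = P.map e (P.iterMul m n) := by
  have hn : Nat.card I - 1 = n := by rw [← Nat.card_congr e]; simp
  subst hn
  rw [totalMul, ← P.map_map_symm e (P.map (_ : Fin (Nat.card I - 1 + 1) ≃ I) _), P.map_map _ e.symm,
    map_eq_self_of_swapInv (h.swapInv_iterMul _)]

theorem exists_fin_succ_equiv (I : Type) [Finite I] [Nonempty I] :
    ∃ n, Nonempty (Fin (n + 1) ≃ I) :=
  ⟨Nat.card I - 1,
    ⟨(finCongr (Nat.sub_add_cancel Nat.card_pos)).trans (Finite.equivFin I).symm⟩⟩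

theorem IsComm.map_totalMul {P : GrOperad.{u, v} 𝕜} {m : P.obj (Fin 2)} (h : P.IsComm m)
    {I J : Type} [Finite I] [Nonempty I] [Finite J] [Nonempty J] (e : I ≃ J) :
    P.map e (P.totalMul m I) = P.totalMul m J := by
  obtain ⟨n, ⟨f⟩⟩ := exists_fin_succ_equiv I
  rw [h.totalMul_eq f, h.totalMul_eq (f.trans e), P.map_trans]

theorem IsComm.totalMul_fin {P : GrOperad.{u, v} 𝕜} {m : P.obj (Fin 2)} (h : P.IsComm m) (n : ℕ) :
    P.totalMul m (Fin (n + 1)) = P.iterMul m n := by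
  rw [h.totalMul_eq (Equiv.refl _), P.map_refl]

theorem IsComm.totalMul_fin_two {P : GrOperad.{u, v} 𝕜} {m : P.obj (Fin 2)} (h : P.IsComm m) :
    P.totalMul m (Fin 2) = m := by
  rw [h.totalMul_fin 1, iterMul_one]

theorem IsComm.totalMul_unit {P : GrOperad.{u, v} 𝕜} {m : P.obj (Fin 2)} (h : P.IsComm m) :
    P.totalMul m Unit = P.one := by
  rw [h.totalMul_eq (Equiv.ofUnique Unit (Fin 1)).symm, iterMul, map_symm_map]

theorem IsComm.iterMul_mem {P : GrOperad.{u, v} 𝕜} {m : P.obj (Fin 2)} (h : P.IsComm m) (n : ℕ) :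
    P.iterMul m n ∈ P.deg (Fin (n + 1)) 0 := by
  induction n with
  | zero => exact P.map_mem _ P.one_mem
  | succ n ih =>
    have := P.map_mem (finSumFinEquiv (m := n) (n := 2))
      (P.comp_mem (P.map_mem finSuccEquivLast ih) h.mem)
    rwa [add_zero] at this

theorem IsComm.totalMul_mem {P : GrOperad.{u, v} 𝕜} {m : P.obj (Fin 2)} (h : P.IsComm m)
    (I : Type) [Finite I] [Nonempty I] : P.totalMul m I ∈ P.deg I 0 :=
  P.map_mem _ (h.iterMul_mem _)

/-- The step splits the added point of `K ⊔ {*}` into two, as in the recursion for `iterMul`. The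
predicate is on bare types, so in applications finiteness and nonemptiness are quantified inside
`C`. -/
theorem nonempty_finite_induction {C : Type → Prop} (equiv : ∀ {J J' : Type}, (J ≃ J') → C J → C J')
    (unit : C Unit) (step : ∀ (K : Type) [Finite K], C (Option K) → C (K ⊕ Fin 2))
    (J : Type) [Finite J] [Nonempty J] : C J := by
  obtain ⟨n, ⟨e⟩⟩ := exists_fin_succ_equiv J
  refine equiv e ?_
  clear e
  induction n with
  | zero => exact equiv (Equiv.ofUnique Unit (Fin 1)) unit
  | succ n ih => exact equiv (finSumFinEquiv (m := n) (n := 2)) (step (Fin n) (equiv finSuccEquivLast ih))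

theorem IsComm.totalMul_comp_mul {P : GrOperad.{u, v} 𝕜} {m : P.obj (Fin 2)} (h : P.IsComm m)
    (I : Type) [Finite I] :
    P.comp (P.totalMul m (Option I)) m = P.totalMul m (I ⊕ Fin 2) := by
  have e := (Finite.equivFin I).symm
  rw [h.totalMul_eq ((finSumFinEquiv (m := Nat.card I) (n := 2)).symm.trans
      (e.sumCongr (Equiv.refl (Fin 2)))), P.map_trans, iterMul_succ, map_symm_map,
    ← map_comp_left, ← h.totalMul_fin, h.map_totalMul, h.map_totalMul]

/-- Induction on `J`: a single input is the unit axiom, and when a product `m` is split off from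
`totalMul m J`, sequential associativity moves it to the outside. -/
theorem IsComm.totalMul_comp_totalMul {P : GrOperad.{u, v} 𝕜} {m : P.obj (Fin 2)} (h : P.IsComm m)
    (I J : Type) [Finite I] [hJ : Finite J] [hJ' : Nonempty J] :
    P.comp (P.totalMul m (Option I)) (P.totalMul m J) = P.totalMul m (I ⊕ J) := by
  revert hJ hJ'
  suffices hC : ∀ (I : Type) [Finite I] [Finite J] [Nonempty J],
      P.comp (P.totalMul m (Option I)) (P.totalMul m J) = P.totalMul m (I ⊕ J) from
    fun _ _ => hC I
  by_cases hJ : Finite J ∧ Nonempty J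
  swap
  · intro I _ h1 h2; exact absurd ⟨h1, h2⟩ hJ
  obtain ⟨hJ, hJ'⟩ := hJ
  refine nonempty_finite_induction (C := fun J => ∀ (I : Type) [Finite I] [Finite J] [Nonempty J],
      P.comp (P.totalMul m (Option I)) (P.totalMul m J) = P.totalMul m (I ⊕ J)) ?_ ?_ ?_ J
  · intro J J' e hJ I _ _ _
    have := Finite.of_equiv _ e.symm
    have := Nonempty.map e.symm inferInstance
    rw [← h.map_totalMul e, map_comp_right, hJ, h.map_totalMul]
  · intro I _ _ _
    rw [h.totalMul_unit, P.comp_one, h.map_totalMul]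
  · intro K _ ih I _ _ _
    rw [← h.totalMul_comp_mul K, ← P.comp_seq, ih, h.map_totalMul, h.totalMul_comp_mul,
      h.map_totalMul]

end Products

end GrOperad

/-! ### Products of one operation with the remaining inputs -/

namespace GrOperad

section Extend

variable {𝕜 : Type u} [Field 𝕜]

/-- The decomposition of `L` into the complement and the range of an embedding. -/
def complEquiv {J L : Type} (f : J ↪ L) : ((Set.range f)ᶜ : Set L) ⊕ J ≃ L := by
  classical
  exact ((Equiv.refl _).sumCongr (Equiv.ofInjective f f.injective)).trans
    ((Equiv.sumComm _ _).trans (Equiv.Set.sumCompl (Set.range f)))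

theorem complEquiv_inr {J L : Type} (f : J ↪ L) (x : J) : complEquiv f (.inr x) = f x := by
  simp [complEquiv]

theorem complEquiv_inl {J L : Type} (f : J ↪ L) (x : ((Set.range f)ᶜ : Set L)) :
    complEquiv f (.inl x) = x := by
  simp [complEquiv]

theorem exists_complEquiv {J L : Type} [Finite L] (f : J ↪ L) :
    ∃ (C : Type) (_ : Finite C) (e : C ⊕ J ≃ L), ∀ x, e (.inr x) = f x :=
  ⟨_, inferInstance, complEquiv f, complEquiv_inr f⟩

/-- The product of the operation `b`, applied to the inputs in the range of `f`, with all other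
inputs. -/
def extendMul (P : GrOperad.{u, v} 𝕜) (m : P.obj (Fin 2)) {J L : Type} [Finite J] [Finite L]
    (f : J ↪ L) : P.obj J →ₗ[𝕜] P.obj L :=
  P.map (complEquiv f) ∘ₗ P.comp (P.totalMul m (Option ((Set.range f)ᶜ : Set L)))

variable {P : GrOperad.{u, v} 𝕜} {m : P.obj (Fin 2)}

/-- The remaining inputs enter only through a total product, which is invariant under renaming; so
any set `C` that parametrizes the complement of the range may replace the chosen one. -/
theorem IsComm.extendMul_eq (h : P.IsComm m) {C J L : Type} [Finite C] [Finite J] [Finite L]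
    (e : C ⊕ J ≃ L) {f : J ↪ L} (he : ∀ x, e (.inr x) = f x) (b : P.obj J) :
    P.extendMul m f b = P.map e (P.comp (P.totalMul m (Option C)) b) := by
  have hmem : ∀ c, e (.inl c) ∈ ((Set.range f)ᶜ : Set L) := by
    rintro c ⟨x, hx⟩
    rw [← he, e.apply_eq_iff_eq] at hx
    cases hx
  let g : C ≃ ((Set.range f)ᶜ : Set L) := Equiv.ofBijective (fun c => ⟨e (.inl c), hmem c⟩) (by
    constructor
    · intro c c' hc
      simpa using hc
    · rintro ⟨y, hy⟩
      obtain ⟨x, rfl⟩ := e.surjective y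
      rcases x with c | x
      · exact ⟨c, rfl⟩
      · exact absurd ⟨x, (he x).symm⟩ hy)
  rw [extendMul, LinearMap.comp_apply, ← h.map_totalMul g.optionCongr, map_comp_left, map_map]
  refine P.map_congr (fun x => ?_) _
  rcases x with c | x
  · simp [complEquiv_inl, g]; rfl
  · simp [complEquiv_inr, he]

theorem IsComm.map_extendMul (h : P.IsComm m) {J L L' : Type} [Finite J] [Finite L] [Finite L']
    (σ : L ≃ L') (f : J ↪ L) (b : P.obj J) :
    P.map σ (P.extendMul m f b) = P.extendMul m (f.trans σ.toEmbedding) b := by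
  rw [h.extendMul_eq ((complEquiv f).trans σ) (f := f.trans σ.toEmbedding)
    (fun x => by simp [complEquiv_inr]), P.map_trans]
  rfl

theorem IsComm.extendMul_map (h : P.IsComm m) {J J' L : Type} [Finite J] [Finite J'] [Finite L]
    (τ : J ≃ J') (f : J' ↪ L) (b : P.obj J) :
    P.extendMul m f (P.map τ b) = P.extendMul m (τ.toEmbedding.trans f) b := by
  obtain ⟨C, _, e, he⟩ := exists_complEquiv f
  rw [h.extendMul_eq e he, map_comp_right, map_map,
    h.extendMul_eq (((Equiv.refl C).sumCongr τ).trans e) (fun x => by simp [he])]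

theorem IsComm.extendMul_inr (h : P.IsComm m) {I J : Type} [Finite I] [Finite J] (b : P.obj J) :
    P.extendMul m (Function.Embedding.inr : J ↪ I ⊕ J) b =
      P.comp (P.totalMul m (Option I)) b := by
  rw [h.extendMul_eq (Equiv.refl (I ⊕ J)) (fun x => rfl), P.map_refl]

/-- With no remaining inputs the total product has a single input and is the identity operation. -/
theorem IsComm.extendMul_equiv (h : P.IsComm m) {J L : Type} [Finite J] [Finite L]
    (e : J ≃ L) (b : P.obj J) : P.extendMul m e.toEmbedding b = P.map e b := by
  rw [h.extendMul_eq ((Equiv.emptySum Empty J).trans e) (fun x => rfl), P.map_trans,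
    ← h.map_totalMul unitEquiv, h.totalMul_unit, P.one_comp]

theorem IsComm.extendMul_extendMul (h : P.IsComm m) {J K L : Type} [Finite J] [Finite K] [Finite L]
    (f : J ↪ K) (g : K ↪ L) (b : P.obj J) :
    P.extendMul m g (P.extendMul m f b) = P.extendMul m (f.trans g) b := by
  obtain ⟨C, _, e, he⟩ := exists_complEquiv f
  obtain ⟨D, _, e', he'⟩ := exists_complEquiv g
  rw [h.extendMul_eq e' he', h.extendMul_eq e he, map_comp_right, ← P.comp_seq,
    h.totalMul_comp_totalMul, h.map_totalMul, map_map, map_map,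
    h.extendMul_eq ((Equiv.sumAssoc D C J).trans (((Equiv.refl D).sumCongr e).trans e'))
      (fun x => by simp [he, he'])]

/-- Inserting into an input of `b`. -/
theorem IsComm.extendMul_optionMap_comp (h : P.IsComm m) {A I J : Type} [Finite A] [Finite I]
    [Finite J] (f : A ↪ I) (b : P.obj (Option A)) (c : P.obj J) :
    P.comp (P.extendMul m f.optionMap b) c =
      P.extendMul m (f.sumMap (Function.Embedding.refl J)) (P.comp b c) := by
  obtain ⟨C, _, e, he⟩ := exists_complEquiv f
  rw [h.extendMul_eq ((seqEquiv C A).trans e.optionCongr)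
      (fun x => by rcases x with _ | x <;> simp [seqEquiv, he]), P.map_trans, map_comp_left,
    comp_map_seqEquiv, map_map,
    h.extendMul_eq ((Equiv.sumAssoc C A J).symm.trans (e.sumCongr (Equiv.refl J)))
      (fun x => by rcases x with x | x <;> simp [he])]

/-- Inserting a product into an input that is not an input of `b`. -/
theorem IsComm.extendMul_some_comp (h : P.IsComm m) {A I J : Type} [Finite A] [Finite I]
    [Finite J] [Nonempty J] (f : A ↪ I) {p : ℤ} {b : P.obj A} (hb : b ∈ P.deg A p) :
    P.comp (P.extendMul m (f.trans Function.Embedding.some) b) (P.totalMul m J) =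
      P.extendMul m (f.trans Function.Embedding.inl) b := by
  obtain ⟨C, _, e, he⟩ := exists_complEquiv f
  -- Parallel associativity moves the insertion of the product past `b`. A total product has degree
  -- `0`, so there is no Koszul sign, whatever the degree of `b`.
  have hpar := P.comp_par (P.totalMul m (Option (Option C))) hb (h.totalMul_mem J)
  rw [h.map_totalMul, h.totalMul_comp_totalMul, h.map_totalMul, mul_zero, zsign_zero, one_smul]
    at hpar
  rw [h.extendMul_eq ((parEquiv C A).trans e.optionCongr)
      (fun x => by simp [parEquiv, he]), P.map_trans, map_comp_left,
    h.extendMul_eq ((sumRightSwap C A J).symm.trans (e.sumCongr (Equiv.refl J)))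
      (fun x => by simp [sumRightSwap, he]), P.map_trans, ← hpar, map_symm_map]

/-- The embedding that sends the added point to `a`. -/
def replaceNone (A : Type) {J : Type} (a : J) : Option A ↪ A ⊕ J where
  toFun x := match x with
    | none => .inr a
    | some x => .inl x
  inj' x y h := by rcases x with _ | x <;> rcases y with _ | y <;> simp_all

theorem replaceNone_none (A : Type) {J : Type} (a : J) : replaceNone A a none = .inr a := rfl

theorem replaceNone_some {A J : Type} (a : J) (x : A) : replaceNone A a (some x) = .inl x := rfl

/-- The operation `b` is a derivation of `m` in the input `none`. -/
def IsDerivation (P : GrOperad.{u, v} 𝕜) (m : P.obj (Fin 2)) {A : Type} [Finite A]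
    (b : P.obj (Option A)) : Prop :=
  P.comp b m = ∑ a : Fin 2, P.extendMul m (replaceNone A a) b

/-- The Leibniz rule for products of any number of factors: a derivation acts on one factor `a` and
the others are multiplied on. The induction replaces one factor by a product of two. -/
theorem IsComm.comp_totalMul_of_isDerivation (h : P.IsComm m) {A : Type} [Finite A] {p : ℤ}
    {b : P.obj (Option A)} (hb : b ∈ P.deg (Option A) p) (hd : P.IsDerivation m b)
    (J : Type) [hJ : Fintype J] [hJ' : Nonempty J] :
    P.comp b (P.totalMul m J) = ∑ a : J, P.extendMul m (replaceNone A a) b := by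
  refine nonempty_finite_induction (C := fun J => ∀ [Fintype J] [Nonempty J],
    P.comp b (P.totalMul m J) = ∑ a : J, P.extendMul m (replaceNone A a) b) ?_ ?_ ?_ J
  · intro J J' e hJ _ _
    have := Fintype.ofEquiv _ e.symm
    have := Nonempty.map e.symm inferInstance
    rw [← h.map_totalMul e, map_comp_right, hJ, map_sum]
    refine Fintype.sum_equiv e _ _ fun a => ?_
    rw [h.map_extendMul]
    congr 2
    ext x
    rcases x with _ | x <;> rfl
  · intro inst _
    obtain rfl : inst = PUnit.fintype := Subsingleton.elim _ _
    rw [h.totalMul_unit, P.comp_one, ← h.extendMul_equiv, Fintype.sum_unique]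
    congr 2
    ext x
    rcases x with _ | x <;> rfl
  · intro K _ ih inst _
    have := Fintype.ofFinite K
    obtain rfl : inst = instFintypeSum K (Fin 2) := Subsingleton.elim _ _
    rw [← h.totalMul_comp_mul K, ← P.comp_seq, ih, Fintype.sum_option, Fintype.sum_sum_type,
      add_comm]
    simp only [map_add, LinearMap.add_apply, map_sum, LinearMap.sum_apply, h.map_extendMul]
    congr 1
    -- Terms in which `b` acts on a factor `a` of `K`: the factor being split lies outside `b`, so
    -- splitting it only lengthens the outer product.
    · refine Finset.sum_congr rfl fun a _ => ?_
      have h1 : (replaceNone A (some a)).trans (seqEquiv A K).toEmbedding =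
          (replaceNone A a).trans Function.Embedding.some := by
        ext1 x
        rcases x with _ | x <;> rfl
      have h2 := h.extendMul_some_comp (J := Fin 2) (replaceNone A a) hb
      rw [h.totalMul_fin_two] at h2
      rw [h1, h2, h.map_extendMul]
      congr 2
      ext x
      rcases x with _ | x <;> rfl
    -- The term in which `b` acts on the factor being split: the product is inserted into `b`
    -- itself, and the binary Leibniz rule gives two terms.
    · have h1 : (replaceNone A (none : Option K)).trans (seqEquiv A K).toEmbedding =
          (Function.Embedding.inl : A ↪ A ⊕ K).optionMap := by
        ext1 x
        rcases x with _ | x <;> rfl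
      rw [h1, h.extendMul_optionMap_comp, hd, map_sum, map_sum]
      refine Finset.sum_congr rfl fun a _ => ?_
      rw [h.extendMul_extendMul, h.map_extendMul]
      congr 2
      ext x
      rcases x with _ | x <;> rfl

end Extend

end GrOperad

/-! ### Exchange of representatives of shuffles -/

section Shuffles

/-- The sign of a permutation, raised to the power `d`, as a scalar. -/
def permSign (𝕜 : Type u) [Field 𝕜] (d : ℤ) {α : Type} [Fintype α] [DecidableEq α]
    (σ : Equiv.Perm α) : 𝕜 :=
  (((Equiv.Perm.sign σ ^ d : ℤˣ) : ℤ) : 𝕜)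

theorem permSign_mul (𝕜 : Type u) [Field 𝕜] (d : ℤ) {α : Type} [Fintype α] [DecidableEq α]
    (σ τ : Equiv.Perm α) : permSign 𝕜 d (σ * τ) = permSign 𝕜 d σ * permSign 𝕜 d τ := by
  simp [permSign, mul_zpow]

theorem permSign_sumCongr (𝕜 : Type u) [Field 𝕜] (d : ℤ) {α β : Type} [Fintype α] [DecidableEq α]
    [Fintype β] [DecidableEq β] (σ : Equiv.Perm α) (τ : Equiv.Perm β) :
    permSign 𝕜 d (Equiv.Perm.sumCongr σ τ) = permSign 𝕜 d σ * permSign 𝕜 d τ := by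
  simp [permSign, mul_zpow]

theorem permSign_mul_self (𝕜 : Type u) [Field 𝕜] (d : ℤ) {α : Type} [Fintype α] [DecidableEq α]
    (σ : Equiv.Perm α) : permSign 𝕜 d σ * permSign 𝕜 d σ = 1 := by
  rw [permSign, ← Int.cast_mul, ← Units.val_mul, Int.units_mul_self, Units.val_one, Int.cast_one]

theorem permSign_symm (𝕜 : Type u) [Field 𝕜] (d : ℤ) {α : Type} [Fintype α] [DecidableEq α]
    (σ : Equiv.Perm α) : permSign 𝕜 d σ.symm = permSign 𝕜 d σ := by
  simp [permSign]

/-- Under `α ⊕ α ≃ α × Bool` the exchange is negation in each fibre, a product of one transposition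
for each element of `α`. -/
theorem sign_sumComm (α : Type) [Fintype α] [DecidableEq α] :
    Equiv.Perm.sign (Equiv.sumComm α α : Equiv.Perm (α ⊕ α)) = (-1) ^ Fintype.card α := by
  have h : Equiv.Perm.sign (Equiv.sumComm α α : Equiv.Perm (α ⊕ α)) =
      Equiv.Perm.sign (Equiv.prodCongrRight fun _ : α => Equiv.boolNot) := by
    refine Equiv.Perm.sign_eq_sign_of_equiv _ _
      ((Equiv.boolProdEquivSum α).symm.trans (Equiv.prodComm Bool α)) ?_
    rintro (x | x) <;> rfl
  have h' : Equiv.Perm.sign Equiv.boolNot = -1 := by decide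
  rw [h, Equiv.Perm.sign_prodCongrRight]
  simp [h']

/-- The permutation that exchanges the first `k` points with the last `k + 1` points other
than `j`. -/
def exchange {k : ℕ} (j : Fin (k + 1)) : Equiv.Perm (Fin k ⊕ Fin (k + 1)) :=
  (((Equiv.refl (Fin k)).sumCongr (finSuccEquiv' j)).trans
    (seqEquiv (Fin k) (Fin k))).symm.permCongr (Equiv.optionCongr (Equiv.sumComm (Fin k) (Fin k)))

theorem exchange_inl {k : ℕ} (j : Fin (k + 1)) (i : Fin k) :
    exchange j (.inl i) = .inr (j.succAbove i) := by
  simp [exchange, seqEquiv]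

theorem exchange_inr_self {k : ℕ} (j : Fin (k + 1)) : exchange j (.inr j) = .inr j := by
  simp [exchange, seqEquiv]

theorem exchange_inr_succAbove {k : ℕ} (j : Fin (k + 1)) (i : Fin k) :
    exchange j (.inr (j.succAbove i)) = .inl i := by
  simp [exchange, seqEquiv]

theorem exchange_inr_of_ne {k : ℕ} {j x : Fin (k + 1)} (h : x ≠ j) :
    ∃ i, exchange j (.inr x) = .inl i := by
  obtain ⟨i, rfl⟩ := Fin.exists_succAbove_eq h
  exact ⟨i, exchange_inr_succAbove j i⟩

theorem exchange_exchange {k : ℕ} (j : Fin (k + 1)) (x : Fin k ⊕ Fin (k + 1)) :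
    exchange j (exchange j x) = x := by
  rcases x with i | x
  · rw [exchange_inl, exchange_inr_succAbove]
  · rcases Fin.eq_self_or_eq_succAbove j x with rfl | ⟨i, rfl⟩
    · rw [exchange_inr_self, exchange_inr_self]
    · rw [exchange_inr_succAbove, exchange_inl]

/-- Up to renaming, `exchange j` is the exchange of two copies of `Fin k` with `.inr j` added as a
fixed point. -/
theorem sign_exchange {k : ℕ} (j : Fin (k + 1)) :
    Equiv.Perm.sign (exchange j) = (-1) ^ k := by
  rw [exchange, Equiv.Perm.sign_permCongr, Equiv.optionCongr_sign, sign_sumComm, Fintype.card_fin]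

theorem permSign_exchange (𝕜 : Type u) [Field 𝕜] (d : ℤ) {k : ℕ} (j : Fin (k + 1)) :
    permSign 𝕜 d (exchange j) = zsign 𝕜 (k * d) := by
  rw [permSign, sign_exchange, zsign, Int.negOnePow, zpow_mul, zpow_natCast]

/-- A pair of a subset with `k + 1` elements and one of its elements corresponds to the pair of
the complement with that element added and the same element. -/
theorem sum_exchange {V : Type*} [AddCommMonoid V] {k : ℕ}
    (Φ : Equiv.Perm (Fin k ⊕ Fin (k + 1)) → Fin (k + 1) → V)
    (hΦ : ∀ σ (g : Equiv.Perm (Fin k)) (h : Equiv.Perm (Fin (k + 1))) j,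
      Φ (σ * Equiv.Perm.sumCongr g h) j = Φ σ (h j))
    (s : Equiv.Perm.ModSumCongr (Fin k) (Fin (k + 1)) → Equiv.Perm (Fin k ⊕ Fin (k + 1)))
    (hs : ∀ q, QuotientGroup.mk (s q) = q) :
    ∑ q, ∑ j, Φ (s q * exchange j) j = ∑ q, ∑ j, Φ (s q) j := by
  -- The chosen representative of the coset of `s q * exchange j` differs from it by some `g` and
  -- `h`; the marked inner input `j` is then renamed to `h j`. This defines the bijection `φ` on
  -- pairs of a coset and a marked input.
  have hex : ∀ p : Equiv.Perm.ModSumCongr (Fin k) (Fin (k + 1)) × Fin (k + 1),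
      ∃ p' : Equiv.Perm.ModSumCongr (Fin k) (Fin (k + 1)) × Fin (k + 1), ∃ g h,
        s p.1 * exchange p.2 = s p'.1 * Equiv.Perm.sumCongr g h ∧ p'.2 = h p.2 := by
    intro p
    have hq := hs (QuotientGroup.mk (s p.1 * exchange p.2))
    rw [QuotientGroup.eq] at hq
    obtain ⟨⟨g, h⟩, hgh⟩ := hq
    refine ⟨⟨QuotientGroup.mk (s p.1 * exchange p.2), h p.2⟩, g, h, ?_, rfl⟩
    rw [eq_inv_mul_iff_mul_eq] at hgh
    exact hgh.symm
  choose φ g h h1 h2 using hex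
  have happ : ∀ p x, s p.1 (exchange p.2 x) = s (φ p).1 (Sum.map (g p) (h p) x) :=
    fun p x => Equiv.congr_fun (h1 p) x
  have hinj : Function.Injective φ := by
    intro p p' hp
    have hj : h p p.2 = h p' p'.2 := by rw [← h2, ← h2, hp]
    have hq : p.1 = p'.1 := by
      rw [← hs p.1, ← hs p'.1, QuotientGroup.eq]
      -- Two representatives define the same coset once their quotient preserves the left summand.
      -- The left inputs of `s p.1` are the images under the new representative of the unmarked
      -- inner inputs, and the new pair determines these.
      refine Equiv.Perm.mem_sumCongrHom_range_of_perm_mapsTo_inl ?_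
      rintro _ ⟨i, rfl⟩
      have hne : (h p).symm (h p' (p'.2.succAbove i)) ≠ p.2 := by
        rw [Ne, Equiv.symm_apply_eq, hj]
        exact fun h0 => Fin.succAbove_ne p'.2 i ((h p').injective h0)
      obtain ⟨i', hi'⟩ := exchange_inr_of_ne hne
      refine ⟨i', ?_⟩
      rw [Equiv.Perm.mul_apply, Equiv.Perm.eq_inv_iff_eq, ← hi', happ, hp]
      have h3 := happ p' (.inr (p'.2.succAbove i))
      rw [exchange_inr_succAbove] at h3
      rw [h3]
      simp
    -- The marked input is fixed by the exchange, so it too is recovered from the new pair.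
    have h3 := happ p (.inr p.2)
    have h4 := happ p' (.inr p'.2)
    rw [exchange_inr_self] at h3 h4
    rw [hp, Sum.map_inr, hj, ← Sum.map_inr (g p') (h p'), ← h4, hq] at h3
    exact Prod.ext hq (Sum.inr_injective ((s p'.1).injective h3))
  rw [← Fintype.sum_prod_type' (f := fun q j => Φ (s q * exchange j) j),
    ← Fintype.sum_prod_type' (f := fun q j => Φ (s q) j)]
  refine Fintype.sum_bijective φ (Finite.injective_iff_bijective.1 hinj) _ _ fun p => ?_
  rw [h1, hΦ, h2]

end Shuffles

/-! ### Operads with a product and a bracket -/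

namespace GrOperad

section Bracket

variable {𝕜 : Type u} [Field 𝕜]

/-- The operations `m` and `n` satisfy the defining relations of `Pois^k_d`. -/
structure IsPois {k : ℕ} (P : GrOperad.{u, v} 𝕜) (d : ℤ) (m : P.obj (Fin 2))
    (n : P.obj (Fin (k + 1))) : Prop extends P.IsComm m where
  bracket_mem : n ∈ P.deg (Fin (k + 1)) (1 - k * d)
  bracket_symm (σ : Equiv.Perm (Fin (k + 1))) : P.map σ n = permSign 𝕜 d σ • n
  leibniz : (P.comp (P.map finSuccEquivLast n) m : P.obj (Fin k ⊕ Fin 2)) =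
    P.map (leibnizEquiv k) (P.comp (P.map (finSuccEquiv 1) m) n) +
      P.map ((leibnizEquiv k).trans (Equiv.sumCongr (Equiv.refl (Fin k)) (Equiv.swap 0 1)))
        (P.comp (P.map (finSuccEquiv 1) m) n)
  jacobi (s : Equiv.Perm.ModSumCongr (Fin k) (Fin (k + 1)) → Equiv.Perm (Fin k ⊕ Fin (k + 1)))
      (hs : ∀ q, QuotientGroup.mk (s q) = q) (hs' : ∀ q, Equiv.Perm.sign (s q) = 1) :
    ∑ q, P.map (s q) (P.comp (P.map (finSuccEquiv k) n) n) = 0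

variable {k : ℕ} {P : GrOperad.{u, v} 𝕜} {d : ℤ} {m : P.obj (Fin 2)} {n : P.obj (Fin (k + 1))}

/-- Restates the Leibniz relation without numberings: the two explicit renamings are the cases `a =
0` and `a = 1`, where `a` names the factor that the bracket acts on. -/
theorem IsPois.isDerivation_last (h : P.IsPois d m n) :
    P.IsDerivation m (P.map finSuccEquivLast n) := by
  have hm : P.map (finSuccEquiv 1) m = P.totalMul m (Option (Fin 1)) := by
    rw [← h.map_totalMul (finSuccEquiv 1), h.totalMul_fin_two]
  rw [IsDerivation, h.leibniz, hm, ← h.extendMul_inr, h.map_extendMul, h.map_extendMul,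
    Fin.sum_univ_two, h.extendMul_map, h.extendMul_map]
  congr 3
  · ext1 x
    refine Fin.lastCases ?_ (fun i => ?_) x
    · simp [leibnizEquiv, replaceNone_none]
      rfl
    · simp [leibnizEquiv, replaceNone_some]
  · ext1 x
    refine Fin.lastCases ?_ (fun i => ?_) x
    · simp [leibnizEquiv, replaceNone_none]
      rfl
    · simp [leibnizEquiv, replaceNone_some, Equiv.swap_apply_def]

/-- The Leibniz relation concerns the last input and the Jacobi relation inserts into the first. The
symmetry of the bracket passes between them at the cost of a sign, which is harmless because
`IsDerivation` is linear in the operation. -/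
theorem IsPois.isDerivation (h : P.IsPois d m n) :
    P.IsDerivation m (P.map (finSuccEquiv k) n) := by
  have h1 : P.map (finSuccEquiv k) n =
      permSign 𝕜 d ((finSuccEquiv k).trans finSuccEquivLast.symm) •
        P.map finSuccEquivLast n := by
    rw [← map_smul, ← h.bracket_symm, map_map]
    exact P.map_congr (fun x => by simp) n
  have h2 := h.isDerivation_last
  rw [IsDerivation] at h2
  rw [IsDerivation, h1, map_smul, LinearMap.smul_apply, h2, Finset.smul_sum]
  simp only [map_smul]

/-- The embedding of the inputs of the inner bracket in `ν(x_j, …)`. -/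
def crossEmb {k : ℕ} (j : Fin (k + 1)) : Fin (k + 1) ↪ Fin k ⊕ Fin (k + 1) :=
  (finSuccEquiv k).toEmbedding.trans (replaceNone (Fin k) j)

/-- This is the bracket-of-a-product factor in the cross terms of the Jacobi identity on a tensor
product. -/
theorem IsPois.comp_totalMul (h : P.IsPois d m n) :
    P.comp (P.map (finSuccEquiv k) n) (P.totalMul m (Fin (k + 1))) =
      ∑ j, P.extendMul m (crossEmb j) n := by
  rw [h.comp_totalMul_of_isDerivation (P.map_mem _ h.bracket_mem) h.isDerivation]
  simp only [h.extendMul_map, crossEmb]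

theorem IsPois.extendMul_trans (h : P.IsPois d m n) {L : Type} [Finite L]
    (τ : Equiv.Perm (Fin (k + 1))) (f : Fin (k + 1) ↪ L) :
    P.extendMul m (τ.toEmbedding.trans f) n = permSign 𝕜 d τ • P.extendMul m f n := by
  rw [← h.extendMul_map, h.bracket_symm, map_smul]

/-- The exchange turns the inner inputs other than `j` into the outer ones, so the inner bracket
becomes the cross bracket through `j`. The only difference is that `j` stands in position `j` rather
than first, which the permutation on the right corrects. -/
theorem inr_trans_exchange (j : Fin (k + 1)) :
    Function.Embedding.inr.trans (exchange j).toEmbedding =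
      ((finSuccEquiv' j).trans (finSuccEquiv k).symm).toEmbedding.trans (crossEmb j) := by
  ext1 x
  rcases Fin.eq_self_or_eq_succAbove j x with rfl | ⟨i, rfl⟩
  · simp [exchange_inr_self, crossEmb, replaceNone_none]
  · simp [exchange_inr_succAbove, crossEmb, replaceNone_some]

theorem crossEmb_trans_exchange (j : Fin (k + 1)) :
    (crossEmb j).trans (exchange j).toEmbedding =
      ((finSuccEquiv' j).trans (finSuccEquiv k).symm).symm.toEmbedding.trans
        Function.Embedding.inr := by
  ext1 x
  obtain ⟨y, rfl⟩ := ((finSuccEquiv' j).trans (finSuccEquiv k).symm).surjective x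
  have h := DFunLike.congr_fun (inr_trans_exchange j) y
  have h' := exchange_exchange j (.inr y)
  change exchange j (crossEmb j _) = Sum.inr _
  rw [Equiv.coe_toEmbedding, Equiv.symm_apply_apply, ← h']
  exact congrArg (exchange j) h.symm

/-- Permuting within the blocks moves the outer inputs by `g` and the marked input from `j` to `h
j`; position `0`, which holds the marked input, stays put. -/
theorem crossEmb_trans_sumCongr (g : Equiv.Perm (Fin k)) (h : Equiv.Perm (Fin (k + 1)))
    (j : Fin (k + 1)) : (crossEmb j).trans (Equiv.Perm.sumCongr g h).toEmbedding =
      ((finSuccEquiv k).symm.permCongr g.optionCongr).toEmbedding.trans (crossEmb (h j)) := by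
  ext1 x
  refine Fin.cases ?_ (fun i => ?_) x
  · simp [crossEmb, replaceNone_none]
  · simp [crossEmb, replaceNone_some]

theorem permSign_permCongr_optionCongr (g : Equiv.Perm (Fin k)) :
    permSign 𝕜 d ((finSuccEquiv k).symm.permCongr g.optionCongr) = permSign 𝕜 d g := by
  rw [permSign, Equiv.Perm.sign_permCongr, Equiv.optionCongr_sign, permSign]

end Bracket

end GrOperad

/-! ### The tensor product of operads with a product and a bracket -/

namespace GrOperad

section TensorBracket

variable {𝕜 : Type u} [Field 𝕜]

theorem tensor_map_tmul (P : GrOperad.{u, v} 𝕜) (Q : GrOperad.{u, w} 𝕜) {I J : Type} [Finite I]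
    [Finite J] (e : I ≃ J) (a : P.obj I) (b : Q.obj I) :
    (P.tensor Q).map e (a ⊗ₜ[𝕜] b : P.obj I ⊗[𝕜] Q.obj I) = P.map e a ⊗ₜ[𝕜] Q.map e b :=
  rfl

theorem tensor_comp_tmul (P : GrOperad.{u, v} 𝕜) (Q : GrOperad.{u, w} 𝕜)
    {I J : Type} [Finite I] [Finite J] {p q : ℤ} {a' : Q.obj (Option I)} {b : P.obj J}
    (ha : a' ∈ Q.deg (Option I) p) (hb : b ∈ P.deg J q) (a : P.obj (Option I)) (b' : Q.obj J) :
    (P.tensor Q).comp (a ⊗ₜ[𝕜] a' : P.obj (Option I) ⊗[𝕜] Q.obj (Option I))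
        (b ⊗ₜ[𝕜] b' : P.obj J ⊗[𝕜] Q.obj J) =
      zsign 𝕜 (p * q) • (P.comp a b ⊗ₜ[𝕜] Q.comp a' b') :=
  tensorComp_tmul P Q ha hb a b'

theorem tensor_comp_tmul_of_left (P : GrOperad.{u, v} 𝕜) (Q : GrOperad.{u, w} 𝕜)
    {I J : Type} [Finite I] [Finite J] {p : ℤ} {a' : Q.obj (Option I)} {b : P.obj J}
    (ha : a' ∈ Q.deg (Option I) 0) (hb : b ∈ P.deg J p) (a : P.obj (Option I)) (b' : Q.obj J) :
    (P.tensor Q).comp (a ⊗ₜ[𝕜] a' : P.obj (Option I) ⊗[𝕜] Q.obj (Option I))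
        (b ⊗ₜ[𝕜] b' : P.obj J ⊗[𝕜] Q.obj J) = P.comp a b ⊗ₜ[𝕜] Q.comp a' b' := by
  rw [tensor_comp_tmul P Q ha hb, zero_mul, zsign_zero, one_smul]

theorem tensor_comp_tmul_of_right (P : GrOperad.{u, v} 𝕜) (Q : GrOperad.{u, w} 𝕜)
    {I J : Type} [Finite I] [Finite J] {p : ℤ} {a' : Q.obj (Option I)} {b : P.obj J}
    (ha : a' ∈ Q.deg (Option I) p) (hb : b ∈ P.deg J 0) (a : P.obj (Option I)) (b' : Q.obj J) :
    (P.tensor Q).comp (a ⊗ₜ[𝕜] a' : P.obj (Option I) ⊗[𝕜] Q.obj (Option I))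
        (b ⊗ₜ[𝕜] b' : P.obj J ⊗[𝕜] Q.obj J) = P.comp a b ⊗ₜ[𝕜] Q.comp a' b' := by
  rw [tensor_comp_tmul P Q ha hb, mul_zero, zsign_zero, one_smul]

variable {P : GrOperad.{u, v} 𝕜} {Q : GrOperad.{u, w} 𝕜} {m : P.obj (Fin 2)} {m' : Q.obj (Fin 2)}

theorem IsComm.tensor (h : P.IsComm m) (h' : Q.IsComm m') :
    (P.tensor Q).IsComm (m ⊗ₜ[𝕜] m' : P.obj (Fin 2) ⊗[𝕜] Q.obj (Fin 2)) where
  mem := tmul_mem_tensorDeg h.mem h'.mem (add_zero 0)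
  symm := by rw [tensor_map_tmul, h.symm, h'.symm]
  assoc := by
    have h1 := tensor_comp_tmul_of_left P Q (Q.map_mem (finSuccEquiv 1) h'.mem) h.mem
      (P.map (finSuccEquiv 1) m) m'
    have h2 := tensor_comp_tmul_of_left P Q (Q.map_mem finSuccEquivLast h'.mem) h.mem
      (P.map finSuccEquivLast m) m'
    rw [tensor_map_tmul, tensor_map_tmul]
    refine (congrArg _ h1).trans (Eq.trans ?_ (congrArg _ h2).symm)
    rw [tensor_map_tmul, tensor_map_tmul, h.assoc, h'.assoc]

theorem IsComm.iterMul_tensor (h : P.IsComm m) (h' : Q.IsComm m') (r : ℕ) :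
    (P.tensor Q).iterMul (m ⊗ₜ[𝕜] m' : P.obj (Fin 2) ⊗[𝕜] Q.obj (Fin 2)) r =
      P.iterMul m r ⊗ₜ[𝕜] Q.iterMul m' r := by
  induction r with
  | zero => rfl
  | succ r ih =>
    refine (congrArg (fun z => (P.tensor Q).map (finSumFinEquiv (m := r) (n := 2))
      ((P.tensor Q).comp ((P.tensor Q).map finSuccEquivLast z)
        (m ⊗ₜ[𝕜] m' : P.obj (Fin 2) ⊗[𝕜] Q.obj (Fin 2)))) ih).trans ?_
    exact congrArg ((P.tensor Q).map (finSumFinEquiv (m := r) (n := 2)))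
      (tensor_comp_tmul_of_left P Q (Q.map_mem finSuccEquivLast (h'.iterMul_mem r)) h.mem
        (P.map finSuccEquivLast (P.iterMul m r)) m')

theorem IsComm.totalMul_tensor (h : P.IsComm m) (h' : Q.IsComm m') (I : Type) [Finite I]
    [Nonempty I] :
    (P.tensor Q).totalMul (m ⊗ₜ[𝕜] m' : P.obj (Fin 2) ⊗[𝕜] Q.obj (Fin 2)) I =
      P.totalMul m I ⊗ₜ[𝕜] Q.totalMul m' I :=
  congrArg ((P.tensor Q).map _) (h.iterMul_tensor h' _)

variable {k : ℕ} {d : ℤ} {n : P.obj (Fin (k + 1))} {n' : Q.obj (Fin (k + 1))}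

/-- Both sides run over ordered pairs of `(k+1)`-subsets that meet in one point, with `n` on one
subset and `n'` on the other. `sum_exchange` swaps the roles of the subsets, and the factor is the
sign of `exchange j` raised to the power `d`. -/
theorem IsPois.sum_cross (h : P.IsPois d m n) (h' : Q.IsPois d m' n')
    (s : Equiv.Perm.ModSumCongr (Fin k) (Fin (k + 1)) → Equiv.Perm (Fin k ⊕ Fin (k + 1)))
    (hs : ∀ q, QuotientGroup.mk (s q) = q) (hs' : ∀ q, Equiv.Perm.sign (s q) = 1) :
    ∑ q, ∑ j, P.extendMul m ((crossEmb j).trans (s q).toEmbedding) n ⊗ₜ[𝕜]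
        Q.extendMul m' (Function.Embedding.inr.trans (s q).toEmbedding) n' =
      zsign 𝕜 (k * d) • ∑ q, ∑ j,
        P.extendMul m (Function.Embedding.inr.trans (s q).toEmbedding) n ⊗ₜ[𝕜]
          Q.extendMul m' ((crossEmb j).trans (s q).toEmbedding) n' := by
  -- The weight `permSign 𝕜 d σ` makes the term depend only on the coset and the marked input, as
  -- `sum_exchange` requires; it is `1` on the given even representatives.
  let Φ : Equiv.Perm (Fin k ⊕ Fin (k + 1)) → Fin (k + 1) →
      P.obj (Fin k ⊕ Fin (k + 1)) ⊗[𝕜] Q.obj (Fin k ⊕ Fin (k + 1)) := fun σ j =>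
    permSign 𝕜 d σ • (P.extendMul m ((crossEmb j).trans σ.toEmbedding) n ⊗ₜ[𝕜]
      Q.extendMul m' (Function.Embedding.inr.trans σ.toEmbedding) n')
  -- The signs of `g` and `t` each occur twice: in the weight, and in the symmetry of `n` and of
  -- `n'` respectively.
  have hΦ : ∀ σ (g : Equiv.Perm (Fin k)) (t : Equiv.Perm (Fin (k + 1))) j,
      Φ (σ * Equiv.Perm.sumCongr g t) j = Φ σ (t j) := by
    intro σ g t j
    have e1 : (crossEmb j).trans (σ * Equiv.Perm.sumCongr g t).toEmbedding =
        ((finSuccEquiv k).symm.permCongr g.optionCongr).toEmbedding.trans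
          ((crossEmb (t j)).trans σ.toEmbedding) := by
      rw [← Function.Embedding.trans_assoc, ← crossEmb_trans_sumCongr]; rfl
    have e2 : Function.Embedding.inr.trans (σ * Equiv.Perm.sumCongr g t).toEmbedding =
        t.toEmbedding.trans (Function.Embedding.inr.trans σ.toEmbedding) := rfl
    simp only [Φ]
    rw [e1, e2, h.extendMul_trans, h'.extendMul_trans, permSign_mul, permSign_sumCongr,
      permSign_permCongr_optionCongr, TensorProduct.smul_tmul_smul, smul_smul]
    congr 1
    linear_combination permSign 𝕜 d σ * permSign 𝕜 d t * permSign 𝕜 d t *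
      permSign_mul_self 𝕜 d g + permSign 𝕜 d σ * permSign_mul_self 𝕜 d t
  have hone : ∀ q, permSign 𝕜 d (s q) = 1 := fun q => by simp [permSign, hs' q]
  -- The permutation that moves `j` to the first position acts on `n'` and its inverse on `n`, so
  -- their signs cancel and only the weight of `exchange j` survives.
  have hex : ∀ q j, Φ (s q * exchange j) j = zsign 𝕜 (k * d) •
      (P.extendMul m (Function.Embedding.inr.trans (s q).toEmbedding) n ⊗ₜ[𝕜]
          Q.extendMul m' ((crossEmb j).trans (s q).toEmbedding) n') := by
    intro q j
    have e1 : (crossEmb j).trans (s q * exchange j).toEmbedding =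
        ((finSuccEquiv' j).trans (finSuccEquiv k).symm).symm.toEmbedding.trans
          (Function.Embedding.inr.trans (s q).toEmbedding) := by
      rw [← Function.Embedding.trans_assoc, ← crossEmb_trans_exchange]; rfl
    have e2 : Function.Embedding.inr.trans (s q * exchange j).toEmbedding =
        ((finSuccEquiv' j).trans (finSuccEquiv k).symm).toEmbedding.trans
          ((crossEmb j).trans (s q).toEmbedding) := by
      rw [← Function.Embedding.trans_assoc, ← inr_trans_exchange]; rfl
    simp only [Φ]
    rw [e1, e2, h.extendMul_trans, h'.extendMul_trans, permSign_mul, hone, one_mul,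
      permSign_exchange, TensorProduct.smul_tmul_smul, permSign_symm, permSign_mul_self, one_smul]
  have key := sum_exchange Φ hΦ s hs
  simp only [hex] at key
  simp only [Finset.smul_sum]
  rw [key]
  simp only [Φ, hone, one_smul]

/-- With `r = kd`, the exponent satisfies `(1 - r)^2 + r - 1 = (r - 1) r`, a product of consecutive
integers. This is where the degree `1 - kd` of the bracket is used: Koszul sign and exchange sign
combine to `-1`. -/
theorem zsign_bracket (𝕜 : Type u) [Field 𝕜] (k : ℕ) (d : ℤ) :
    zsign 𝕜 ((1 - k * d) * (1 - k * d)) * zsign 𝕜 (k * d) = -1 := by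
  have h : zsign 𝕜 1 = -1 := by simp [zsign]
  rw [← zsign_add, ← h]
  apply zsign_eq
  have h2 := Int.even_mul_succ_self (k * d - 1)
  have e : (1 - k * d) * (1 - k * d) + k * d - 1 = (k * d - 1) * (k * d - 1 + 1) := by ring
  rwa [e]

/-- The bracket on the tensor product of two operads with product and bracket. -/
def tensorBracket (P : GrOperad.{u, v} 𝕜) (Q : GrOperad.{u, w} 𝕜) (m : P.obj (Fin 2))
    (m' : Q.obj (Fin 2)) (n : P.obj (Fin (k + 1))) (n' : Q.obj (Fin (k + 1))) :
    (P.tensor Q).obj (Fin (k + 1)) :=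
  (P.iterMul m k ⊗ₜ[𝕜] n' + n ⊗ₜ[𝕜] Q.iterMul m' k : P.obj (Fin (k + 1)) ⊗[𝕜] Q.obj (Fin (k + 1)))

theorem IsComm.map_tensorBracket (h : P.IsComm m) (h' : Q.IsComm m') {I : Type} [Finite I]
    [Nonempty I] (e : Fin (k + 1) ≃ I) :
    (P.tensor Q).map e (tensorBracket P Q m m' n n') =
      (P.totalMul m I ⊗ₜ[𝕜] Q.map e n' + P.map e n ⊗ₜ[𝕜] Q.totalMul m' I :
        P.obj I ⊗[𝕜] Q.obj I) := by
  rw [h.totalMul_eq e, h'.totalMul_eq e]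
  exact map_add ((P.tensor Q).map e) _ _

/-- Inserting an operation of degree `0` costs no sign, and in each summand one factor is again a
total product. -/
theorem IsPois.tensorBracket_comp_mul (h : P.IsPois d m n) (h' : Q.IsPois d m' n') :
    (P.tensor Q).comp ((P.tensor Q).map finSuccEquivLast (tensorBracket P Q m m' n n'))
        (m ⊗ₜ[𝕜] m' : P.obj (Fin 2) ⊗[𝕜] Q.obj (Fin 2)) =
      (P.totalMul m (Fin k ⊕ Fin 2) ⊗ₜ[𝕜] Q.comp (Q.map finSuccEquivLast n') m' +
        P.comp (P.map finSuccEquivLast n) m ⊗ₜ[𝕜] Q.totalMul m' (Fin k ⊕ Fin 2) :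
          P.obj (Fin k ⊕ Fin 2) ⊗[𝕜] Q.obj (Fin k ⊕ Fin 2)) := by
  rw [h.map_tensorBracket h'.toIsComm, ← h.totalMul_comp_mul, ← h'.totalMul_comp_mul,
    ← tensor_comp_tmul_of_right P Q (Q.map_mem _ h'.bracket_mem) h.mem,
    ← tensor_comp_tmul_of_right P Q (h'.totalMul_mem _) h.mem]
  exact LinearMap.map_add₂ (P.tensor Q).comp _ _ _

theorem IsPois.mul_comp_tensorBracket (h : P.IsPois d m n) (h' : Q.IsPois d m' n')
    {L : Type} [Finite L] [Nonempty L] (e : Fin 1 ⊕ Fin (k + 1) ≃ L) :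
    (P.tensor Q).map e ((P.tensor Q).comp ((P.tensor Q).map (finSuccEquiv 1)
        (m ⊗ₜ[𝕜] m' : P.obj (Fin 2) ⊗[𝕜] Q.obj (Fin 2))) (tensorBracket P Q m m' n n')) =
      (P.totalMul m L ⊗ₜ[𝕜] Q.map e (Q.comp (Q.map (finSuccEquiv 1) m') n') +
        P.map e (P.comp (P.map (finSuccEquiv 1) m) n) ⊗ₜ[𝕜] Q.totalMul m' L :
          P.obj L ⊗[𝕜] Q.obj L) := by
  have hm : P.map (finSuccEquiv 1) m = P.totalMul m (Option (Fin 1)) := by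
    rw [← h.map_totalMul (finSuccEquiv 1), h.totalMul_fin_two]
  have hm' : Q.map (finSuccEquiv 1) m' = Q.totalMul m' (Option (Fin 1)) := by
    rw [← h'.map_totalMul (finSuccEquiv 1), h'.totalMul_fin_two]
  rw [← h.map_totalMul e, ← h'.map_totalMul e, ← h.totalMul_comp_totalMul,
    ← h'.totalMul_comp_totalMul, tensor_map_tmul, hm, hm', h.totalMul_fin, h'.totalMul_fin,
    ← tensor_map_tmul, ← tensor_map_tmul,
    ← tensor_comp_tmul_of_left P Q (h'.totalMul_mem _) (h.iterMul_mem k),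
    ← tensor_comp_tmul_of_left P Q (h'.totalMul_mem _) h.bracket_mem]
  refine (congrArg _ (map_add _ _ _)).trans (map_add ((P.tensor Q).map e) _ _)

/-- Of the four products of summands, only `(M ⊗ n') ∘ (n ⊗ M')` moves two brackets past each other
and picks up a Koszul sign. The two cross terms are expanded by the Leibniz rule. -/
theorem IsPois.tensorBracket_comp_tensorBracket (h : P.IsPois d m n) (h' : Q.IsPois d m' n') :
    (P.tensor Q).comp ((P.tensor Q).map (finSuccEquiv k) (tensorBracket P Q m m' n n'))
        (tensorBracket P Q m m' n n') =
      ((P.totalMul m (Fin k ⊕ Fin (k + 1)) ⊗ₜ[𝕜] Q.comp (Q.map (finSuccEquiv k) n') n' +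
        P.comp (P.map (finSuccEquiv k) n) n ⊗ₜ[𝕜] Q.totalMul m' (Fin k ⊕ Fin (k + 1))) +
      (∑ j, P.extendMul m (crossEmb j) n ⊗ₜ[𝕜] Q.extendMul m' Function.Embedding.inr n' +
        zsign 𝕜 ((1 - k * d) * (1 - k * d)) • ∑ j,
          P.extendMul m Function.Embedding.inr n ⊗ₜ[𝕜] Q.extendMul m' (crossEmb j) n') :
          P.obj (Fin k ⊕ Fin (k + 1)) ⊗[𝕜] Q.obj (Fin k ⊕ Fin (k + 1))) := by
  have h1 := tensor_comp_tmul_of_right P Q (Q.map_mem (finSuccEquiv k) h'.bracket_mem)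
    (h.iterMul_mem k) (P.totalMul m (Option (Fin k))) n'
  have h2 := tensor_comp_tmul P Q (Q.map_mem (finSuccEquiv k) h'.bracket_mem)
    h.bracket_mem (P.totalMul m (Option (Fin k))) (Q.iterMul m' k)
  have h3 := tensor_comp_tmul_of_left P Q (h'.totalMul_mem (Option (Fin k)))
    (h.iterMul_mem k) (P.map (finSuccEquiv k) n) n'
  have h4 := tensor_comp_tmul_of_left P Q (h'.totalMul_mem (Option (Fin k)))
    h.bracket_mem (P.map (finSuccEquiv k) n) (Q.iterMul m' k)
  rw [← h.totalMul_fin, h.totalMul_comp_totalMul] at h1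
  rw [← h'.totalMul_fin, h'.comp_totalMul, ← h.extendMul_inr, TensorProduct.tmul_sum] at h2
  rw [← h.totalMul_fin, h.comp_totalMul, ← h'.extendMul_inr, TensorProduct.sum_tmul] at h3
  rw [← h'.totalMul_fin, h'.totalMul_comp_totalMul] at h4
  rw [h.map_tensorBracket h'.toIsComm, ← h1, ← h2, ← h3, ← h4, tensorBracket, ← h.totalMul_fin,
    ← h'.totalMul_fin]
  refine (LinearMap.map_add₂ (P.tensor Q).comp _ _ _).trans ?_
  refine (congrArg₂ (· + ·) (map_add _ _ _) (map_add _ _ _)).trans ?_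
  have habel : ∀ a b c e : (P.tensor Q).obj (Fin k ⊕ Fin (k + 1)),
      a + b + (c + e) = a + e + (c + b) := by
    intros; abel
  exact habel _ _ _ _

/-- Symmetry and Leibniz hold because in each summand one factor is a total product, unaffected by
renaming, so that the identity takes place in the other factor. The Jacobi identity needs in
addition the cancellation of the cross terms. -/
theorem IsPois.tensor (h : P.IsPois d m n) (h' : Q.IsPois d m' n') :
    (P.tensor Q).IsPois d (m ⊗ₜ[𝕜] m' : P.obj (Fin 2) ⊗[𝕜] Q.obj (Fin 2))
      (tensorBracket P Q m m' n n') where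
  toIsComm := h.toIsComm.tensor h'.toIsComm
  bracket_mem := add_mem (tmul_mem_tensorDeg (h.iterMul_mem k) h'.bracket_mem (zero_add _))
    (tmul_mem_tensorDeg h.bracket_mem (h'.iterMul_mem k) (add_zero _))
  bracket_symm σ := by
    rw [h.map_tensorBracket h'.toIsComm, h.bracket_symm, h'.bracket_symm, h.totalMul_fin,
      h'.totalMul_fin, TensorProduct.tmul_smul, ← TensorProduct.smul_tmul', ← smul_add]
    rfl
  leibniz := by
    rw [h.tensorBracket_comp_mul h', h.mul_comp_tensorBracket h', h.mul_comp_tensorBracket h',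
      h.leibniz, h'.leibniz, TensorProduct.add_tmul, TensorProduct.tmul_add]
    exact add_add_add_comm _ _ _ _
  jacobi s hs hs' := by
    have hmap : ∀ q, (P.tensor Q).map (s q) ((P.tensor Q).comp
        ((P.tensor Q).map (finSuccEquiv k) (tensorBracket P Q m m' n n'))
          (tensorBracket P Q m m' n n')) =
        ((P.totalMul m (Fin k ⊕ Fin (k + 1)) ⊗ₜ[𝕜]
            Q.map (s q) (Q.comp (Q.map (finSuccEquiv k) n') n') +
          P.map (s q) (P.comp (P.map (finSuccEquiv k) n) n) ⊗ₜ[𝕜]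
            Q.totalMul m' (Fin k ⊕ Fin (k + 1))) +
        (∑ j, P.extendMul m ((crossEmb j).trans (s q).toEmbedding) n ⊗ₜ[𝕜]
            Q.extendMul m' (Function.Embedding.inr.trans (s q).toEmbedding) n' +
          zsign 𝕜 ((1 - k * d) * (1 - k * d)) • ∑ j,
            P.extendMul m (Function.Embedding.inr.trans (s q).toEmbedding) n ⊗ₜ[𝕜]
              Q.extendMul m' ((crossEmb j).trans (s q).toEmbedding) n') :
            P.obj (Fin k ⊕ Fin (k + 1)) ⊗[𝕜] Q.obj (Fin k ⊕ Fin (k + 1))) := by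
      intro q
      rw [h.tensorBracket_comp_tensorBracket h']
      change TensorProduct.map (P.map (s q)) (Q.map (s q)) _ = _
      simp only [map_add, map_sum, map_smul, TensorProduct.map_tmul, h.map_extendMul,
        h'.map_extendMul, h.map_totalMul, h'.map_totalMul]
    refine (Finset.sum_congr rfl fun q _ => hmap q).trans ?_
    refine Eq.trans (b := (0 : P.obj (Fin k ⊕ Fin (k + 1)) ⊗[𝕜] Q.obj (Fin k ⊕ Fin (k + 1)))) ?_ rfl
    have hsum : ∀ A B C D : Equiv.Perm.ModSumCongr (Fin k) (Fin (k + 1)) →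
        P.obj (Fin k ⊕ Fin (k + 1)) ⊗[𝕜] Q.obj (Fin k ⊕ Fin (k + 1)),
        ∑ q, A q = 0 → ∑ q, B q = 0 → ∑ q, C q + ∑ q, D q = 0 →
          ∑ q, (A q + B q + (C q + D q)) = 0 := by
      intro A B C D hA hB hCD
      rw [Finset.sum_add_distrib, Finset.sum_add_distrib, Finset.sum_add_distrib, hA, hB, hCD,
        add_zero, add_zero]
    refine hsum _ _ _ _ ?_ ?_ ?_
    · rw [← TensorProduct.tmul_sum, h'.jacobi s hs hs', TensorProduct.tmul_zero]
    · rw [← TensorProduct.sum_tmul, h.jacobi s hs hs', TensorProduct.zero_tmul]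
    -- Both signs square to `1` and their product is `-1`, so they are opposite; the two cross sums,
    -- related by `IsPois.sum_cross`, cancel.
    · have hsign : zsign 𝕜 (k * d) = - zsign 𝕜 ((1 - k * d) * (1 - k * d)) := by
        have h1 := zsign_bracket 𝕜 k d
        have h2 : zsign 𝕜 (k * d) * zsign 𝕜 (k * d) = 1 := by
          rw [← zsign_add, zsign_eq 𝕜 (n := 0) (by simp), zsign_zero]
        linear_combination zsign 𝕜 (k * d) * h1 - zsign 𝕜 ((1 - k * d) * (1 - k * d)) * h2
      rw [h.sum_cross h' s hs hs', ← Finset.smul_sum, ← add_smul, hsign, neg_add_cancel, zero_smul]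

end TensorBracket

end GrOperad

/-! ### Morphisms of operads -/

namespace GrOperad

section Homs

universe v' w' x

variable {𝕜 : Type u} [Field 𝕜]

theorem Hom.ext_app {P : GrOperad.{u, v} 𝕜} {Q : GrOperad.{u, w} 𝕜} {f g : Hom P Q}
    (h : ∀ (I : Type) [Finite I] (a : P.obj I), f.app I a = g.app I a) : f = g := by
  cases f
  cases g
  congr 1
  funext I _
  exact LinearMap.ext (h I)

/-- The identity morphism. -/
def Hom.id (P : GrOperad.{u, v} 𝕜) : Hom P P where
  app _ _ := LinearMap.id
  app_mem h := h
  app_map _ _ := rfl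
  app_one := rfl
  app_comp _ _ := rfl

/-- Composition of morphisms of operads. -/
def Hom.trans {P : GrOperad.{u, v} 𝕜} {Q : GrOperad.{u, w} 𝕜} {R : GrOperad.{u, x} 𝕜}
    (f : Hom P Q) (g : Hom Q R) : Hom P R where
  app I _ := g.app I ∘ₗ f.app I
  app_mem h := g.app_mem (f.app_mem h)
  app_map e a := by
    rw [LinearMap.comp_apply, f.app_map, g.app_map]; rfl
  app_one := by rw [LinearMap.comp_apply, f.app_one, g.app_one]
  app_comp a b := by
    rw [LinearMap.comp_apply, f.app_comp, g.app_comp]; rfl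

theorem Hom.app_iterMul {P : GrOperad.{u, v} 𝕜} {Q : GrOperad.{u, w} 𝕜} (f : Hom P Q)
    (m : P.obj (Fin 2)) (r : ℕ) :
    f.app (Fin (r + 1)) (P.iterMul m r) = Q.iterMul (f.app (Fin 2) m) r := by
  induction r with
  | zero => exact (f.app_map _ _).trans (congrArg _ f.app_one)
  | succ r ih =>
    refine (f.app_map (finSumFinEquiv (m := r) (n := 2)) _).trans ?_
    rw [f.app_comp, f.app_map, ih, iterMul_succ]

theorem Hom.app_totalMul {P : GrOperad.{u, v} 𝕜} {Q : GrOperad.{u, w} 𝕜} (f : Hom P Q)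
    (m : P.obj (Fin 2)) (I : Type) [Finite I] [Nonempty I] :
    f.app I (P.totalMul m I) = Q.totalMul (f.app (Fin 2) m) I := by
  rw [totalMul, f.app_map, f.app_iterMul, totalMul]

/-- A morphism from a tensor product of operads, from its values on tensors of homogeneous
operations. -/
def Hom.ofTensor {P : GrOperad.{u, v} 𝕜} {Q : GrOperad.{u, w} 𝕜} {R : GrOperad.{u, x} 𝕜}
    (φ : ∀ (I : Type) [Finite I], P.obj I ⊗[𝕜] Q.obj I →ₗ[𝕜] R.obj I)
    (mem : ∀ {I : Type} [Finite I] {p q : ℤ} {a : P.obj I} {b : Q.obj I}, a ∈ P.deg I p →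
      b ∈ Q.deg I q → φ I (a ⊗ₜ b) ∈ R.deg I (p + q))
    (map : ∀ {I J : Type} [Finite I] [Finite J] (e : I ≃ J) {p q : ℤ} {a : P.obj I} {b : Q.obj I},
      a ∈ P.deg I p → b ∈ Q.deg I q →
        φ J (P.map e a ⊗ₜ Q.map e b) = R.map e (φ I (a ⊗ₜ b)))
    (one : φ Unit (P.one ⊗ₜ Q.one) = R.one)
    (comp : ∀ {I J : Type} [Finite I] [Finite J] {p p' q q' : ℤ} {a : P.obj (Option I)}
      {a' : Q.obj (Option I)} {b : P.obj J} {b' : Q.obj J}, a ∈ P.deg _ p → a' ∈ Q.deg _ p' →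
        b ∈ P.deg _ q → b' ∈ Q.deg _ q' →
          zsign 𝕜 (p' * q) • φ (I ⊕ J) (P.comp a b ⊗ₜ Q.comp a' b') =
            R.comp (φ (Option I) (a ⊗ₜ a')) (φ J (b ⊗ₜ b'))) :
    Hom (P.tensor Q) R where
  app I _ := φ I
  app_mem {I _ r x} hx := by
    refine Submodule.span_induction (p := fun x _ => φ I x ∈ R.deg I r) ?_ ?_ ?_ ?_ hx
    · rintro _ ⟨p, q, a, b, rfl, ha, hb, rfl⟩
      exact mem ha hb
    · rw [map_zero]; exact zero_mem _
    · intro x y _ _ hx hy; rw [map_add]; exact add_mem hx hy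
    · intro c x _ hx; rw [map_smul]; exact Submodule.smul_mem _ _ hx
  app_map {I J} _ _ e x := by
    refine P.tensor_induction Q I (C := fun x => φ J (TensorProduct.map (P.map e) (Q.map e) x) =
      R.map e (φ I x)) ?_ ?_ ?_ x
    · simp only [map_zero]
    · intro x y hx hy; simp only [map_add, hx, hy]
    · intro p q a ha b hb
      exact map e ha hb
  app_one := one
  app_comp {I J} _ _ x y := by
    change P.obj J ⊗[𝕜] Q.obj J at y
    refine P.tensor_induction Q (Option I) (C := fun x => φ (I ⊕ J) (tensorComp P Q x y) =
      R.comp (φ (Option I) x) (φ J y)) ?_ ?_ ?_ x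
    · simp only [map_zero, LinearMap.zero_apply]
    · intro x y hx hy; simp only [map_add, LinearMap.add_apply, hx, hy]
    · intro p q a ha a' ha'
      refine P.tensor_induction Q J (C := fun y => φ (I ⊕ J) (tensorComp P Q (a ⊗ₜ a') y) =
        R.comp (φ (Option I) (a ⊗ₜ a')) (φ J y)) ?_ ?_ ?_ y
      · simp only [map_zero]
      · intro x y hx hy; simp only [map_add, hx, hy]
      · intro p' q' b hb b' hb'
        rw [tensorComp_tmul P Q ha' hb, map_smul, comp ha ha' hb hb']

/-- A morphism between tensor products of operads, from its values on tensors of homogeneous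
operations. -/
def Hom.tensorOfTensor {P : GrOperad.{u, v} 𝕜} {Q : GrOperad.{u, w} 𝕜} {P' : GrOperad.{u, v'} 𝕜}
    {Q' : GrOperad.{u, w'} 𝕜}
    (φ : ∀ (I : Type) [Finite I], P.obj I ⊗[𝕜] Q.obj I →ₗ[𝕜] P'.obj I ⊗[𝕜] Q'.obj I)
    (mem : ∀ {I : Type} [Finite I] {p q : ℤ} {a : P.obj I} {b : Q.obj I}, a ∈ P.deg I p →
      b ∈ Q.deg I q → φ I (a ⊗ₜ b) ∈ tensorDeg (P'.deg I) (Q'.deg I) (p + q))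
    (map : ∀ {I J : Type} [Finite I] [Finite J] (e : I ≃ J) {p q : ℤ} {a : P.obj I} {b : Q.obj I},
      a ∈ P.deg I p → b ∈ Q.deg I q →
        φ J (P.map e a ⊗ₜ Q.map e b) = TensorProduct.map (P'.map e) (Q'.map e) (φ I (a ⊗ₜ b)))
    (one : φ Unit (P.one ⊗ₜ Q.one) = P'.one ⊗ₜ Q'.one)
    (comp : ∀ {I J : Type} [Finite I] [Finite J] {p p' q q' : ℤ} {a : P.obj (Option I)}
      {a' : Q.obj (Option I)} {b : P.obj J} {b' : Q.obj J}, a ∈ P.deg _ p → a' ∈ Q.deg _ p' →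
        b ∈ P.deg _ q → b' ∈ Q.deg _ q' →
          zsign 𝕜 (p' * q) • φ (I ⊕ J) (P.comp a b ⊗ₜ Q.comp a' b') =
            tensorComp P' Q' (φ (Option I) (a ⊗ₜ a')) (φ J (b ⊗ₜ b'))) :
    Hom (P.tensor Q) (P'.tensor Q') :=
  Hom.ofTensor (R := P'.tensor Q') φ mem map one comp

/-- The tensor product of two morphisms of operads. -/
def Hom.tensorMap {P : GrOperad.{u, v} 𝕜} {Q : GrOperad.{u, w} 𝕜} {P' : GrOperad.{u, v'} 𝕜}
    {Q' : GrOperad.{u, w'} 𝕜} (f : Hom P P') (g : Hom Q Q') :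
    Hom (P.tensor Q) (P'.tensor Q') :=
  Hom.tensorOfTensor (fun I _ => TensorProduct.map (f.app I) (g.app I))
    (fun ha hb => tmul_mem_tensorDeg (f.app_mem ha) (g.app_mem hb) rfl)
    (fun e _ _ a b _ _ => by
      simp only [TensorProduct.map_tmul, f.app_map, g.app_map])
    (by rw [TensorProduct.map_tmul, f.app_one, g.app_one])
    (fun {I J} _ _ {p p' q q' a a' b b'} _ ha' hb _ => by
      simp only [TensorProduct.map_tmul]
      rw [tensorComp_tmul P' Q' (g.app_mem ha') (f.app_mem hb), f.app_comp, g.app_comp])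

/-- The symmetry of the tensor product of operads. -/
def Hom.tensorSwap (P : GrOperad.{u, v} 𝕜) (Q : GrOperad.{u, w} 𝕜) :
    Hom (P.tensor Q) (Q.tensor P) :=
  Hom.tensorOfTensor (fun I _ => koszulSwap (P.isInternal I) (Q.isInternal I))
    (fun ha hb => by
      rw [koszulSwap_tmul _ _ ha hb]
      exact Submodule.smul_mem _ _ (tmul_mem_tensorDeg hb ha (add_comm _ _)))
    (fun e p q a b ha hb => by
      rw [koszulSwap_tmul _ _ (P.map_mem e ha) (Q.map_mem e hb), koszulSwap_tmul _ _ ha hb,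
        map_smul, TensorProduct.map_tmul])
    (by rw [koszulSwap_tmul _ _ P.one_mem Q.one_mem, mul_zero, zsign_zero, one_smul])
    (fun {I J} _ _ {p p' q q' a a' b b'} ha ha' hb hb' => by
      rw [koszulSwap_tmul _ _ (P.comp_mem ha hb) (Q.comp_mem ha' hb'), koszulSwap_tmul _ _ ha ha',
        koszulSwap_tmul _ _ hb hb', map_smul, map_smul, LinearMap.smul_apply,
        tensorComp_tmul Q P ha hb', smul_smul, smul_smul, smul_smul, ← zsign_add, ← zsign_add,
        ← zsign_add]
      congr 1
      -- Expanding `(p + q)(p' + q')` leaves `2 p' q` as the difference of the two exponents.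
      apply zsign_eq
      exact ⟨p' * q, by ring⟩)

/-! ### `Com` as the unit of the tensor product of operads -/

theorem mem_com_deg_zero {I : Type} (c : (Com 𝕜).obj I) : c ∈ (Com 𝕜).deg I 0 := by
  have h : (if (0 : ℤ) = 0 then (⊤ : Submodule 𝕜 (comSpace 𝕜 I)) else ⊥) = ⊤ := if_pos rfl
  exact h.ge Submodule.mem_top

theorem eq_zero_of_mem_com_deg {I : Type} {p : ℤ} (hp : p ≠ 0) {c : (Com 𝕜).obj I}
    (hc : c ∈ (Com 𝕜).deg I p) : c = 0 :=
  (Submodule.mem_bot 𝕜).1 ((if_neg hp :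
    (if p = 0 then (⊤ : Submodule 𝕜 (comSpace 𝕜 I)) else ⊥) = ⊥).le hc)

/-- The inclusion of `Com(I)` into the ground field. -/
def comVal (𝕜 : Type u) [Field 𝕜] (I : Type) : (Com 𝕜).obj I →ₗ[𝕜] 𝕜 :=
  (comSpace 𝕜 I).subtype

theorem comVal_eq_zero_of_mem {I : Type} {p : ℤ} (hp : p ≠ 0) {c : (Com 𝕜).obj I}
    (hc : c ∈ (Com 𝕜).deg I p) : comVal 𝕜 I c = 0 := by
  rw [eq_zero_of_mem_com_deg hp hc, map_zero]

theorem comVal_map {I J : Type} [Finite I] [Finite J] (e : I ≃ J) (c : (Com 𝕜).obj I) :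
    comVal 𝕜 J ((Com 𝕜).map e c) = comVal 𝕜 I c := rfl

theorem comVal_one : comVal 𝕜 Unit (Com 𝕜).one = 1 := rfl

theorem comVal_comp {I J : Type} [Finite I] [Finite J] (c : (Com 𝕜).obj (Option I))
    (c' : (Com 𝕜).obj J) :
    comVal 𝕜 (I ⊕ J) ((Com 𝕜).comp c c') = comVal 𝕜 (Option I) c * comVal 𝕜 J c' := rfl

/-- `Com` is concentrated in degree `0`, so Koszul signs against its operations have no effect:
either the sign is trivial or the operation is zero. -/
theorem zsign_smul_comVal {I : Type} {p q : ℤ} {c : (Com 𝕜).obj I} (hc : c ∈ (Com 𝕜).deg I q) :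
    zsign 𝕜 (p * q) * comVal 𝕜 I c = comVal 𝕜 I c := by
  by_cases hq : q = 0
  · rw [hq, mul_zero, zsign_zero, one_mul]
  · rw [comVal_eq_zero_of_mem hq hc, mul_zero]

/-- `Com` is a left unit for the tensor product of operads. -/
def Hom.comTensor (P : GrOperad.{u, v} 𝕜) : Hom ((Com 𝕜).tensor P) P :=
  Hom.ofTensor (fun I _ => (TensorProduct.lid 𝕜 (P.obj I)).toLinearMap ∘ₗ
      TensorProduct.map (comVal 𝕜 I) LinearMap.id)
    (fun {I _ p q a b} ha hb => by
      change comVal 𝕜 I a • b ∈ _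
      by_cases hp : p = 0
      · rw [hp, zero_add]; exact Submodule.smul_mem _ _ hb
      · rw [comVal_eq_zero_of_mem hp ha, zero_smul]; exact zero_mem _)
    (fun {I J} _ _ e p q a b _ _ => by
      change comVal 𝕜 J _ • P.map e b = P.map e (comVal 𝕜 I a • b)
      rw [map_smul, comVal_map])
    (by
      change comVal 𝕜 Unit _ • P.one = P.one
      rw [comVal_one, one_smul])
    (fun {I J} _ _ {p p' q q' a a' b b'} _ _ hb _ => by
      change zsign 𝕜 (p' * q) • comVal 𝕜 _ _ • P.comp a' b' =
        P.comp (comVal 𝕜 _ a • a') (comVal 𝕜 _ b • b')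
      rw [map_smul, map_smul, LinearMap.smul_apply, comVal_comp, smul_smul, smul_smul,
        mul_left_comm, zsign_smul_comVal hb, mul_comm])

/-- `Com` is a right unit for the tensor product of operads. -/
def Hom.tensorCom (P : GrOperad.{u, v} 𝕜) : Hom (P.tensor (Com 𝕜)) P :=
  Hom.ofTensor (fun I _ => (TensorProduct.rid 𝕜 (P.obj I)).toLinearMap ∘ₗ
      TensorProduct.map LinearMap.id (comVal 𝕜 I))
    (fun {I _ p q a b} ha hb => by
      change comVal 𝕜 I b • a ∈ _
      by_cases hq : q = 0
      · rw [hq, add_zero]; exact Submodule.smul_mem _ _ ha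
      · rw [comVal_eq_zero_of_mem hq hb, zero_smul]; exact zero_mem _)
    (fun {I J} _ _ e p q a b _ _ => by
      change comVal 𝕜 J _ • P.map e a = P.map e (comVal 𝕜 I b • a)
      rw [map_smul, comVal_map])
    (by
      change comVal 𝕜 Unit _ • P.one = P.one
      rw [comVal_one, one_smul])
    (fun {I J} _ _ {p p' q q' a a' b b'} _ ha' _ _ => by
      change zsign 𝕜 (p' * q) • comVal 𝕜 _ _ • P.comp a b =
        P.comp (comVal 𝕜 _ a' • a) (comVal 𝕜 _ b' • b)
      rw [map_smul, map_smul, LinearMap.smul_apply, comVal_comp, smul_smul, smul_smul,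
        mul_comm p' q, ← mul_assoc, zsign_smul_comVal ha', mul_comm])

/-- Composition in a tensor product has an explicit formula only on homogeneous tensors; this
reduces identities in triple products to them. -/
theorem triple_homogeneous_induction {M : Type v} {N : Type w} {L : Type x}
    [AddCommGroup M] [Module 𝕜 M] [AddCommGroup N] [Module 𝕜 N] [AddCommGroup L] [Module 𝕜 L]
    {A : ℤ → Submodule 𝕜 M} {B : ℤ → Submodule 𝕜 N} {D : ℤ → Submodule 𝕜 L}
    (hA : DirectSum.IsInternal A) (hB : DirectSum.IsInternal B) (hD : DirectSum.IsInternal D)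
    {C : (M ⊗[𝕜] N) ⊗[𝕜] L → Prop} (h0 : C 0) (hadd : ∀ x y, C x → C y → C (x + y))
    (hC : ∀ p q r, ∀ a ∈ A p, ∀ b ∈ B q, ∀ c ∈ D r, C ((a ⊗ₜ b) ⊗ₜ c))
    (x : (M ⊗[𝕜] N) ⊗[𝕜] L) : C x := by
  induction x using TensorProduct.induction_on with
  | zero => exact h0
  | add x y hx hy => exact hadd x y hx hy
  | tmul z c =>
    refine homogeneous_induction hD (C := fun c => C (z ⊗ₜ c)) (by simpa using h0)
      (fun x y hx hy => by rw [TensorProduct.tmul_add]; exact hadd _ _ hx hy) (fun r c hc => ?_) c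
    exact tensor_homogeneous_induction hA hB (C := fun z => C (z ⊗ₜ c)) (by simpa using h0)
      (fun x y hx hy => by rw [TensorProduct.add_tmul]; exact hadd _ _ hx hy)
      (fun p q a ha b hb => hC p q r a ha b hb c hc) z

/-- The associativity of the tensor product of operads. -/
def Hom.tensorAssoc (P : GrOperad.{u, v} 𝕜) (Q : GrOperad.{u, w} 𝕜) (R : GrOperad.{u, x} 𝕜) :
    Hom ((P.tensor Q).tensor R) (P.tensor (Q.tensor R)) where
  app I _ := (TensorProduct.assoc 𝕜 (P.obj I) (Q.obj I) (R.obj I)).toLinearMap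
  app_mem {I _ p x} hx := by
    refine Submodule.span_induction (p := fun x _ =>
      TensorProduct.assoc 𝕜 (P.obj I) (Q.obj I) (R.obj I) x ∈
        tensorDeg (P.deg I) (tensorDeg (Q.deg I) (R.deg I)) p) ?_ ?_ ?_ ?_ hx
    · rintro _ ⟨p, r, z, c, rfl, hz, hc, rfl⟩
      refine Submodule.span_induction (p := fun z _ =>
        TensorProduct.assoc 𝕜 (P.obj I) (Q.obj I) (R.obj I) (z ⊗ₜ c) ∈
          tensorDeg (P.deg I) (tensorDeg (Q.deg I) (R.deg I)) (p + r)) ?_ ?_ ?_ ?_ hz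
      · rintro _ ⟨p, q, a, b, rfl, ha, hb, rfl⟩
        exact tmul_mem_tensorDeg ha (tmul_mem_tensorDeg hb hc rfl) (add_assoc _ _ _).symm
      · rw [TensorProduct.zero_tmul, map_zero]; exact zero_mem _
      · intro x y _ _ hx hy; rw [TensorProduct.add_tmul, map_add]; exact add_mem hx hy
      · intro c x _ hx
        rw [← TensorProduct.smul_tmul', map_smul]; exact Submodule.smul_mem _ _ hx
    · rw [map_zero]; exact zero_mem _
    · intro x y _ _ hx hy; rw [map_add]; exact add_mem hx hy
    · intro c x _ hx; rw [map_smul]; exact Submodule.smul_mem _ _ hx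
  app_map {I J} _ _ e x := by
    refine triple_homogeneous_induction (P.isInternal I) (Q.isInternal I) (R.isInternal I)
      (C := fun x => TensorProduct.assoc 𝕜 (P.obj J) (Q.obj J) (R.obj J)
          (TensorProduct.map (TensorProduct.map (P.map e) (Q.map e)) (R.map e) x) =
        TensorProduct.map (P.map e) (TensorProduct.map (Q.map e) (R.map e))
          (TensorProduct.assoc 𝕜 (P.obj I) (Q.obj I) (R.obj I) x)) ?_ ?_ ?_ x
    · simp only [map_zero]
    · intro x y hx hy; simp only [map_add, hx, hy]
    · intros; rfl
  app_one := rfl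
  app_comp {I J} _ _ x y := by
    -- Both sides are packaged as bilinear maps on the underlying tensor products, so that it
    -- suffices to compare them on homogeneous tensors.
    let f : (P.obj (Option I) ⊗[𝕜] Q.obj (Option I)) ⊗[𝕜] R.obj (Option I) →ₗ[𝕜]
        (P.obj J ⊗[𝕜] Q.obj J) ⊗[𝕜] R.obj J →ₗ[𝕜]
          P.obj (I ⊕ J) ⊗[𝕜] (Q.obj (I ⊕ J) ⊗[𝕜] R.obj (I ⊕ J)) :=
      ((P.tensor Q).tensor R).comp.compr₂
        (TensorProduct.assoc 𝕜 (P.obj (I ⊕ J)) (Q.obj (I ⊕ J)) (R.obj (I ⊕ J))).toLinearMap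
    let g : (P.obj (Option I) ⊗[𝕜] Q.obj (Option I)) ⊗[𝕜] R.obj (Option I) →ₗ[𝕜]
        (P.obj J ⊗[𝕜] Q.obj J) ⊗[𝕜] R.obj J →ₗ[𝕜]
          P.obj (I ⊕ J) ⊗[𝕜] (Q.obj (I ⊕ J) ⊗[𝕜] R.obj (I ⊕ J)) :=
      (P.tensor (Q.tensor R)).comp.compl₁₂
        (TensorProduct.assoc 𝕜 (P.obj (Option I)) (Q.obj (Option I)) (R.obj (Option I))).toLinearMap
        (TensorProduct.assoc 𝕜 (P.obj J) (Q.obj J) (R.obj J)).toLinearMap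
    change (P.obj J ⊗[𝕜] Q.obj J) ⊗[𝕜] R.obj J at y
    change f x y = g x y
    refine triple_homogeneous_induction (P.isInternal (Option I)) (Q.isInternal _) (R.isInternal _)
      (C := fun x => f x y = g x y) ?_ ?_ ?_ x
    · simp only [map_zero, LinearMap.zero_apply]
    · intro x y hx hy; simp only [map_add, LinearMap.add_apply, hx, hy]
    · intro p p' p'' a ha a' ha' a'' ha''
      refine triple_homogeneous_induction (P.isInternal J) (Q.isInternal J) (R.isInternal J)
        (C := fun y => f ((a ⊗ₜ[𝕜] a') ⊗ₜ[𝕜] a'') y = g ((a ⊗ₜ[𝕜] a') ⊗ₜ[𝕜] a'') y) ?_ ?_ ?_ y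
      · simp only [map_zero]
      · intro x y hx hy; simp only [map_add, hx, hy]
      · intro q q' q'' b hb b' hb' b'' hb''
        have h1 := tensorComp_tmul (P.tensor Q) R ha''
          (show b ⊗ₜ[𝕜] b' ∈ (P.tensor Q).deg J (q + q') from tmul_mem_tensorDeg hb hb' rfl)
          (a ⊗ₜ[𝕜] a' : P.obj (Option I) ⊗[𝕜] Q.obj (Option I)) b''
        have h2 := tensorComp_tmul P (Q.tensor R)
          (show a' ⊗ₜ[𝕜] a'' ∈ (Q.tensor R).deg (Option I) (p' + p'') from
            tmul_mem_tensorDeg ha' ha'' rfl) hb a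
          (b' ⊗ₜ[𝕜] b'' : Q.obj J ⊗[𝕜] R.obj J)
        rw [tensor_comp_tmul P Q ha' hb] at h1
        rw [tensor_comp_tmul Q R ha'' hb'] at h2
        refine (congrArg (TensorProduct.assoc 𝕜 (P.obj (I ⊕ J)) (Q.obj (I ⊕ J)) (R.obj (I ⊕ J)))
          h1).trans (Eq.trans ?_ h2.symm)
        change TensorProduct.assoc 𝕜 (P.obj (I ⊕ J)) (Q.obj (I ⊕ J)) (R.obj (I ⊕ J))
            (zsign 𝕜 (p'' * (q + q')) • ((zsign 𝕜 (p' * q) • (P.comp a b ⊗ₜ[𝕜] Q.comp a' b')) ⊗ₜ[𝕜]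
              R.comp a'' b'')) =
          zsign 𝕜 ((p' + p'') * q) • (P.comp a b ⊗ₜ[𝕜]
            (zsign 𝕜 (p'' * q') • (Q.comp a' b' ⊗ₜ[𝕜] R.comp a'' b'')))
        rw [← TensorProduct.smul_tmul', TensorProduct.tmul_smul, smul_smul, smul_smul, map_smul,
          TensorProduct.assoc_tmul, ← zsign_add, ← zsign_add]
        -- On both sides the exponent is `p' q + p'' q + p'' q'`: one contribution for each
        -- operation of the first triple that passes an earlier factor of the second.
        congr 2
        ring

end Homs

end GrOperad

/-! ### Morphisms out of `Com`, and `Com` as a target with zero bracket -/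

namespace GrOperad

section ComHoms

variable {𝕜 : Type u} [Field 𝕜]

/-- The product of all inputs, zero if there are none. -/
def totalMulOrZero (P : GrOperad.{u, v} 𝕜) (m : P.obj (Fin 2)) (I : Type) [Finite I] : P.obj I :=
  open Classical in if _ : Nonempty I then P.totalMul m I else 0

theorem totalMulOrZero_of_nonempty (P : GrOperad.{u, v} 𝕜) (m : P.obj (Fin 2)) (I : Type)
    [Finite I] [h : Nonempty I] : P.totalMulOrZero m I = P.totalMul m I :=
  dif_pos h

theorem comVal_eq_zero_of_isEmpty {I : Type} [h : IsEmpty I] (c : (Com 𝕜).obj I) :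
    comVal 𝕜 I c = 0 :=
  c.2 h

/-- The morphism from `Com` given by a commutative associative operation. -/
def Hom.ofCom {P : GrOperad.{u, v} 𝕜} {m : P.obj (Fin 2)} (h : P.IsComm m) : Hom (Com 𝕜) P where
  app I _ := (comVal 𝕜 I).smulRight (P.totalMulOrZero m I)
  app_mem {I _ p c} hc := by
    rw [LinearMap.smulRight_apply]
    by_cases hp : p = 0
    · subst hp
      refine Submodule.smul_mem _ _ ?_
      by_cases hI : Nonempty I
      · rw [totalMulOrZero_of_nonempty]; exact h.totalMul_mem I
      · rw [totalMulOrZero, dif_neg hI]; exact zero_mem _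
    · rw [comVal_eq_zero_of_mem hp hc, zero_smul]; exact zero_mem _
  app_map {I J} _ _ e c := by
    rw [LinearMap.smulRight_apply, LinearMap.smulRight_apply, comVal_map, map_smul]
    rcases isEmpty_or_nonempty I with hI | hI
    · rw [comVal_eq_zero_of_isEmpty, zero_smul, zero_smul]
    · have : Nonempty J := hI.map e
      rw [totalMulOrZero_of_nonempty, totalMulOrZero_of_nonempty, h.map_totalMul]
  app_one := by
    rw [LinearMap.smulRight_apply, totalMulOrZero_of_nonempty, h.totalMul_unit, comVal_one,
      one_smul]
  app_comp {I J} _ _ a b := by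
    rw [LinearMap.smulRight_apply, LinearMap.smulRight_apply, LinearMap.smulRight_apply,
      comVal_comp, map_smul, map_smul, LinearMap.smul_apply, smul_smul, mul_comm]
    -- If `J` is empty then `b = 0`; otherwise all three index sets are nonempty, even when `I` is
    -- empty.
    rcases isEmpty_or_nonempty J with hJ | hJ
    · rw [comVal_eq_zero_of_isEmpty b, zero_mul, zero_smul, zero_smul]
    · rw [totalMulOrZero_of_nonempty, totalMulOrZero_of_nonempty, totalMulOrZero_of_nonempty,
        h.totalMul_comp_totalMul]

theorem Hom.ofCom_app_one {P : GrOperad.{u, v} 𝕜} {m : P.obj (Fin 2)} (h : P.IsComm m) (I : Type)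
    [Finite I] [Nonempty I] :
    (Hom.ofCom h).app I ⟨1, mem_comSpace 1⟩ = P.totalMul m I := by
  change (1 : 𝕜) • P.totalMulOrZero m I = _
  rw [one_smul, totalMulOrZero_of_nonempty]

/-- The commutative product of `Com`. -/
def comMul (𝕜 : Type u) [Field 𝕜] : (Com 𝕜).obj (Fin 2) := ⟨1, mem_comSpace 1⟩

theorem comVal_iterMul (r : ℕ) : comVal 𝕜 _ ((Com 𝕜).iterMul (comMul 𝕜) r) = 1 := by
  induction r with
  | zero => rfl
  | succ r ih =>
    have h : comVal 𝕜 _ ((Com 𝕜).iterMul (comMul 𝕜) (r + 1)) =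
      comVal 𝕜 _ ((Com 𝕜).iterMul (comMul 𝕜) r) * 1 := rfl
    rw [h, ih, mul_one]

theorem comVal_totalMul (I : Type) [Finite I] [Nonempty I] :
    comVal 𝕜 I ((Com 𝕜).totalMul (comMul 𝕜) I) = 1 :=
  comVal_iterMul _

/-- Every term of a relation that involves the bracket contains it as a factor, so the zero bracket
satisfies all of them. The resulting morphism `Pois^k_d → Com` is the counit. -/
theorem isPois_com (k : ℕ) (d : ℤ) :
    (Com 𝕜).IsPois d (comMul 𝕜) (0 : (Com 𝕜).obj (Fin (k + 1))) where
  mem := mem_com_deg_zero _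
  symm := rfl
  assoc := rfl
  bracket_mem := zero_mem _
  bracket_symm σ := by rw [map_zero, smul_zero]
  leibniz := by simp only [map_zero, LinearMap.zero_apply, add_zero]
  jacobi s _ _ := by simp only [map_zero, Finset.sum_const_zero]

end ComHoms

end GrOperad

/-! ### The universal property of `Pois^k_d` -/

section Universal

variable {𝕜 : Type u} [Field 𝕜] {k : ℕ}

/-- The value of a monomial on operations `m` and `n`. -/
def PoisMono.eval {P : GrOperad.{u, v} 𝕜} (m : P.obj (Fin 2)) (n : P.obj (Fin (k + 1))) :
    {I : Type} → PoisMono k I → P.obj I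
  | _, .one => P.one
  | _, .mu => m
  | _, .nu => n
  | _, @PoisMono.map _ _ _ _ _ e a => P.map e (a.eval m n)
  | _, @PoisMono.comp _ _ _ _ _ a b => P.comp (a.eval m n) (b.eval m n)

/-- The value of a linear combination of monomials on operations `m` and `n`. -/
def PoisFree.eval {P : GrOperad.{u, v} 𝕜} (m : P.obj (Fin 2)) (n : P.obj (Fin (k + 1)))
    (I : Type) : PoisFree 𝕜 k I →ₗ[𝕜] P.obj I :=
  Finsupp.linearCombination 𝕜 (PoisMono.eval m n)

variable {P : GrOperad.{u, v} 𝕜} {m : P.obj (Fin 2)} {n : P.obj (Fin (k + 1))}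

theorem PoisFree.eval_of {I : Type} (a : PoisMono k I) :
    PoisFree.eval m n I (PoisFree.of 𝕜 a) = a.eval m n := by
  simp [PoisFree.eval, PoisFree.of]

theorem PoisFree.of_induction {I : Type} {C : PoisFree 𝕜 k I → Prop} (h0 : C 0)
    (hadd : ∀ x y, C x → C y → C (x + y)) (hsmul : ∀ (c : 𝕜) x, C x → C (c • x))
    (hC : ∀ a, C (PoisFree.of 𝕜 a)) (x : PoisFree 𝕜 k I) : C x := by
  induction x using Finsupp.induction_linear with
  | zero => exact h0
  | add y z hy hz => exact hadd _ _ hy hz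
  | single b c =>
    have hc : Finsupp.single b c = c • PoisFree.of 𝕜 b := by simp [PoisFree.of]
    rw [hc]
    exact hsmul _ _ (hC b)

theorem PoisFree.eval_map {I J : Type} [Finite I] [Finite J] (e : I ≃ J) (x : PoisFree 𝕜 k I) :
    PoisFree.eval m n J (PoisFree.map e x) = P.map e (PoisFree.eval m n I x) := by
  induction x using PoisFree.of_induction with
  | h0 => simp only [map_zero]
  | hadd x y hx hy => simp only [map_add, hx, hy]
  | hsmul c x hx => simp only [map_smul, hx]
  | hC a => rw [PoisFree.map_of, PoisFree.eval_of, PoisFree.eval_of]; rfl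

theorem PoisFree.eval_comp {I J : Type} [Finite I] [Finite J] (x : PoisFree 𝕜 k (Option I))
    (y : PoisFree 𝕜 k J) : PoisFree.eval m n (I ⊕ J) (PoisFree.comp x y) =
      P.comp (PoisFree.eval m n (Option I) x) (PoisFree.eval m n J y) := by
  induction x using PoisFree.of_induction with
  | h0 => simp only [map_zero, LinearMap.zero_apply]
  | hadd x y hx hy => simp only [map_add, LinearMap.add_apply, hx, hy]
  | hsmul c x hx => simp only [map_smul, LinearMap.smul_apply, hx]
  | hC a =>
    induction y using PoisFree.of_induction with
    | h0 => simp only [map_zero]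
    | hadd x y hx hy => simp only [map_add, hx, hy]
    | hsmul c x hx => simp only [map_smul, hx]
    | hC b =>
      rw [PoisFree.comp_of, PoisFree.eval_of, PoisFree.eval_of, PoisFree.eval_of]; rfl

variable {d : ℤ}

theorem GrOperad.IsPois.eval_mem (h : P.IsPois d m n) {I : Type} (a : PoisMono k I) :
    a.eval m n ∈ P.deg I (a.degree d) := by
  induction a with
  | one => exact P.one_mem
  | mu => exact h.mem
  | nu => exact h.bracket_mem
  | map e a ih => exact P.map_mem e ih
  | comp a b iha ihb => exact P.comp_mem iha ihb

/-- The structural relations hold in any operad, those between generators hold by `IsPois`, and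
evaluation commutes with renaming and composition. Parallel associativity also needs that evaluation
preserves degrees, to match the Koszul signs. -/
theorem GrOperad.IsPois.eval_eq_zero (h : P.IsPois d m n) {I : Type} {x : PoisFree 𝕜 k I}
    (hx : PoisRel 𝕜 k d I x) : PoisFree.eval m n I x = 0 := by
  induction hx with
  | map_refl a =>
    rw [map_sub, PoisFree.eval_of, PoisFree.eval_of, sub_eq_zero]
    exact P.map_refl _
  | map_trans e f a =>
    rw [map_sub, PoisFree.eval_of, PoisFree.eval_of, sub_eq_zero]
    exact P.map_trans _ _ _
  | comp_map e f a b =>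
    rw [map_sub, PoisFree.eval_of, PoisFree.eval_of, sub_eq_zero]
    exact P.comp_map _ _ _ _
  | one_comp b =>
    rw [map_sub, PoisFree.eval_of, PoisFree.eval_of, sub_eq_zero]
    exact P.one_comp _
  | comp_one a =>
    rw [map_sub, PoisFree.eval_of, PoisFree.eval_of, sub_eq_zero]
    exact P.comp_one _
  | comp_seq a b c =>
    rw [map_sub, PoisFree.eval_of, PoisFree.eval_of, sub_eq_zero]
    exact P.comp_seq _ _ _
  | comp_par a b c =>
    rw [map_sub, map_smul, PoisFree.eval_of, PoisFree.eval_of, sub_eq_zero]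
    exact P.comp_par _ (h.eval_mem b) (h.eval_mem c)
  | mu_comm =>
    rw [map_sub, PoisFree.eval_of, PoisFree.eval_of, sub_eq_zero]
    exact h.symm
  | mu_assoc =>
    simp only [map_sub, PoisFree.eval_map, PoisFree.eval_comp, PoisFree.eval_of]
    exact sub_eq_zero.2 h.assoc
  | nu_symm σ =>
    simp only [map_sub, map_smul, PoisFree.eval_map, PoisFree.eval_of]
    exact sub_eq_zero.2 (h.bracket_symm σ)
  | leibniz =>
    simp only [map_sub, map_add, PoisFree.eval_map, PoisFree.eval_comp, PoisFree.eval_of]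
    exact sub_eq_zero.2 h.leibniz
  | jacobi s hs hs' =>
    simp only [map_sum, PoisFree.eval_map, PoisFree.eval_comp, PoisFree.eval_of]
    exact h.jacobi s hs hs'
  | map_rel e x _ ih => rw [PoisFree.eval_map, ih, map_zero]
  | rel_comp x b _ ih => rw [PoisFree.eval_comp, ih, map_zero, LinearMap.zero_apply]
  | comp_rel a y _ ih => rw [PoisFree.eval_comp, ih, map_zero]

/-- The morphism from `Pois^k_d` given by operations that satisfy the defining relations. -/
def Pois.desc (h : P.IsPois d m n) : GrOperad.Hom (Pois 𝕜 k d) P where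
  app I _ := PoisQuot.lift (PoisFree.eval m n I) (fun x hx => by
    rw [← LinearMap.mem_ker]
    revert x
    exact Submodule.span_le.2 fun x hx => LinearMap.mem_ker.2 (h.eval_eq_zero hx))
  app_mem {I _ p x} hx := by
    refine PoisQuot.deg_induction (C := fun x => PoisQuot.lift (PoisFree.eval m n I) _ x ∈ P.deg I p)
      ?_ ?_ ?_ ?_ x hx
    · rw [map_zero]; exact zero_mem _
    · intro x y hx hy; rw [map_add]; exact add_mem hx hy
    · intro c x hx; rw [map_smul]; exact Submodule.smul_mem _ _ hx
    · rintro a rfl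
      rw [PoisQuot.cls, PoisQuot.lift_mk, PoisFree.eval_of]
      exact h.eval_mem a
  app_map e x := by
    obtain ⟨x, rfl⟩ := PoisQuot.mk_surjective x
    exact PoisFree.eval_map e x
  app_one := PoisFree.eval_of _
  app_comp x y := by
    obtain ⟨x, rfl⟩ := PoisQuot.mk_surjective x
    obtain ⟨y, rfl⟩ := PoisQuot.mk_surjective y
    exact PoisFree.eval_comp x y

theorem Pois.desc_mu (h : P.IsPois d m n) :
    (Pois.desc h).app (Fin 2) (Pois.mu 𝕜 k d) = m :=
  PoisFree.eval_of _

theorem Pois.desc_nu (h : P.IsPois d m n) :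
    (Pois.desc h).app (Fin (k + 1)) (Pois.nu 𝕜 k d) = n :=
  PoisFree.eval_of _

/-- Monomials are built from the identity, `μ` and `ν` by exactly the operations under which a
suboperad is closed. -/
theorem Pois.cls_mem_suboperad (S : (Pois 𝕜 k d).Suboperad)
    (hmu : Pois.mu 𝕜 k d ∈ S.carrier (Fin 2)) (hnu : Pois.nu 𝕜 k d ∈ S.carrier (Fin (k + 1)))
    {I : Type} (a : PoisMono k I) :
    ∀ [Finite I], (PoisQuot.cls 𝕜 d a : (Pois 𝕜 k d).obj I) ∈ S.carrier I := by
  induction a with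
  | one => exact S.one_mem
  | mu => exact hmu
  | nu => exact hnu
  | @map I J _ _ e a ih =>
    exact (congrArg (fun x : (Pois 𝕜 k d).obj J => x ∈ S.carrier J)
      (PoisQuot.map_cls e a)).mp (S.map_mem e ih)
  | @comp I J _ _ a b iha ihb =>
    exact (congrArg (fun x : (Pois 𝕜 k d).obj (I ⊕ J) => x ∈ S.carrier (I ⊕ J))
      (PoisQuot.comp_cls a b)).mp (S.comp_mem iha ihb)

theorem Pois.suboperad_eq_top (S : (Pois 𝕜 k d).Suboperad)
    (hmu : Pois.mu 𝕜 k d ∈ S.carrier (Fin 2)) (hnu : Pois.nu 𝕜 k d ∈ S.carrier (Fin (k + 1)))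
    (I : Type) [Finite I] : S.carrier I = ⊤ := by
  rw [eq_top_iff]
  rintro x -
  refine PoisQuot.quot_induction (C := fun x => x ∈ S.carrier I) (zero_mem _)
    (fun x y hx hy => add_mem hx hy) (fun c x hx => Submodule.smul_mem _ c hx)
    (fun a => Pois.cls_mem_suboperad S hmu hnu a) x

/-- The suboperad on which two morphisms agree. -/
def GrOperad.Hom.eqLocus {Q : GrOperad.{u, w} 𝕜} (f g : GrOperad.Hom Q P) : Q.Suboperad where
  carrier I _ := LinearMap.eqLocus (f.app I) (g.app I)
  one_mem := f.app_one.trans g.app_one.symm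
  map_mem e a ha := by
    rw [LinearMap.mem_eqLocus] at ha ⊢
    rw [f.app_map, g.app_map, ha]
  comp_mem ha hb := by
    rw [LinearMap.mem_eqLocus] at ha hb ⊢
    rw [f.app_comp, g.app_comp, ha, hb]

/-- The operations on which `f` and `g` agree form a suboperad; if it contains `μ` and `ν` it is
everything. -/
theorem Pois.hom_ext {f g : GrOperad.Hom (Pois 𝕜 k d) P}
    (hmu : f.app (Fin 2) (Pois.mu 𝕜 k d) = g.app (Fin 2) (Pois.mu 𝕜 k d))
    (hnu : f.app (Fin (k + 1)) (Pois.nu 𝕜 k d) = g.app (Fin (k + 1)) (Pois.nu 𝕜 k d)) : f = g := by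
  refine GrOperad.Hom.ext_app fun I _ a => ?_
  have h : a ∈ (f.eqLocus g).carrier I := by
    rw [Pois.suboperad_eq_top (f.eqLocus g) hmu hnu I]
    trivial
  exact h

/-- Provides the universal pair, to be fed into `IsPois.tensor` to obtain the comultiplication and
into `Hom.ofCom` to obtain the augmentation. -/
theorem Pois.isPois (𝕜 : Type u) [Field 𝕜] (k : ℕ) (d : ℤ) :
    (Pois 𝕜 k d).IsPois d (Pois.mu 𝕜 k d) (Pois.nu 𝕜 k d) where
  mem := PoisQuot.mk_mem (PoisFree.of_mem_deg 𝕜 d _ rfl)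
  symm := (PoisQuot.map_cls _ _).trans (PoisQuot.mk_eq PoisRel.mu_comm)
  assoc := PoisQuot.mk_eq PoisRel.mu_assoc
  bracket_mem := PoisQuot.mk_mem (PoisFree.of_mem_deg 𝕜 d _ rfl)
  bracket_symm σ := (PoisQuot.mk_eq (PoisRel.nu_symm σ)).trans (map_smul (PoisQuot.mk 𝕜 k d _) _ _)
  leibniz := (PoisQuot.mk_eq PoisRel.leibniz).trans (map_add (PoisQuot.mk 𝕜 k d _) _ _)
  jacobi s hs hs' := (map_sum (PoisQuot.mk 𝕜 k d _) _ _).symm.trans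
    (PoisQuot.mk_eq_zero (Submodule.subset_span (PoisRel.jacobi s hs hs')))

end Universal

/-! ### The Hopf structure of `Pois^k_d` -/

section HopfStructure

open GrOperad

/-- The comultiplication of `Pois^k_d`. -/
def Pois.comulHom (𝕜 : Type u) [Field 𝕜] (k : ℕ) (d : ℤ) :
    Hom (Pois 𝕜 k d) ((Pois 𝕜 k d).tensor (Pois 𝕜 k d)) :=
  Pois.desc ((Pois.isPois 𝕜 k d).tensor (Pois.isPois 𝕜 k d))

/-- The counit of `Pois^k_d`. -/
def Pois.counitHom (𝕜 : Type u) [Field 𝕜] (k : ℕ) (d : ℤ) : Hom (Pois 𝕜 k d) (Com 𝕜) :=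
  Pois.desc (isPois_com k d)

variable {𝕜 : Type u} [Field 𝕜] {k : ℕ} {d : ℤ}

theorem Pois.comulHom_mu : (Pois.comulHom 𝕜 k d).comul (Fin 2) (Pois.mu 𝕜 k d) =
    Pois.mu 𝕜 k d ⊗ₜ[𝕜] Pois.mu 𝕜 k d :=
  Pois.desc_mu _

theorem Pois.comulHom_nu : (Pois.comulHom 𝕜 k d).comul (Fin (k + 1)) (Pois.nu 𝕜 k d) =
    (Pois 𝕜 k d).iterMul (Pois.mu 𝕜 k d) k ⊗ₜ[𝕜] Pois.nu 𝕜 k d +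
      Pois.nu 𝕜 k d ⊗ₜ[𝕜] (Pois 𝕜 k d).iterMul (Pois.mu 𝕜 k d) k :=
  Pois.desc_nu _

/-- `Δ` is a morphism of operads and `μ` is group-like, so all products built from `μ` are
group-like. -/
theorem Pois.comulHom_totalMul (I : Type) [Finite I] [Nonempty I] :
    (Pois.comulHom 𝕜 k d).comul I ((Pois 𝕜 k d).totalMul (Pois.mu 𝕜 k d) I) =
      (Pois 𝕜 k d).totalMul (Pois.mu 𝕜 k d) I ⊗ₜ[𝕜] (Pois 𝕜 k d).totalMul (Pois.mu 𝕜 k d) I := by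
  refine ((Pois.comulHom 𝕜 k d).app_totalMul (Pois.mu 𝕜 k d) I).trans ?_
  refine (congrArg (fun x => GrOperad.totalMul _ x I) Pois.comulHom_mu).trans ?_
  exact (Pois.isPois 𝕜 k d).totalMul_tensor (Pois.isPois 𝕜 k d).toIsComm I

theorem Pois.comulHom_iterMul (r : ℕ) :
    (Pois.comulHom 𝕜 k d).comul _ ((Pois 𝕜 k d).iterMul (Pois.mu 𝕜 k d) r) =
      (Pois 𝕜 k d).iterMul (Pois.mu 𝕜 k d) r ⊗ₜ[𝕜] (Pois 𝕜 k d).iterMul (Pois.mu 𝕜 k d) r := by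
  have h := Pois.comulHom_totalMul (𝕜 := 𝕜) (k := k) (d := d) (Fin (r + 1))
  rwa [(Pois.isPois 𝕜 k d).totalMul_fin] at h

theorem Pois.counitHom_mu : (Pois.counitHom 𝕜 k d).counit (Fin 2) (Pois.mu 𝕜 k d) = 1 :=
  congrArg (comVal 𝕜 (Fin 2)) (Pois.desc_mu (isPois_com k d))

theorem Pois.counitHom_nu : (Pois.counitHom 𝕜 k d).counit (Fin (k + 1)) (Pois.nu 𝕜 k d) = 0 :=
  (congrArg (comVal 𝕜 (Fin (k + 1))) (Pois.desc_nu (isPois_com k d))).trans (map_zero _)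

theorem Pois.counitHom_totalMul (I : Type) [Finite I] [Nonempty I] :
    (Pois.counitHom 𝕜 k d).counit I ((Pois 𝕜 k d).totalMul (Pois.mu 𝕜 k d) I) = 1 := by
  refine (congrArg (comVal 𝕜 I) ((Pois.counitHom 𝕜 k d).app_totalMul (Pois.mu 𝕜 k d) I)).trans ?_
  refine (congrArg (fun x => comVal 𝕜 I (GrOperad.totalMul _ x I))
    (Pois.desc_mu (isPois_com k d))).trans (comVal_totalMul I)

theorem Pois.counitHom_iterMul (r : ℕ) :
    (Pois.counitHom 𝕜 k d).counit _ ((Pois 𝕜 k d).iterMul (Pois.mu 𝕜 k d) r) = 1 := by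
  have h := Pois.counitHom_totalMul (𝕜 := 𝕜) (k := k) (d := d) (Fin (r + 1))
  rwa [(Pois.isPois 𝕜 k d).totalMul_fin] at h

/-- Each identity is an equality of components of two operad morphisms out of `Pois^k_d`, hence is
checked on `μ` and `ν`. -/
theorem Pois.isHopf (𝕜 : Type u) [Field 𝕜] (k : ℕ) (d : ℤ) : IsHopf (Pois.comulHom 𝕜 k d) where
  coassoc I _ x := by
    have h : ((Pois.comulHom 𝕜 k d).trans
          ((Pois.comulHom 𝕜 k d).tensorMap (Hom.id (Pois 𝕜 k d)))).trans
          (Hom.tensorAssoc _ _ _) =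
        (Pois.comulHom 𝕜 k d).trans ((Hom.id (Pois 𝕜 k d)).tensorMap (Pois.comulHom 𝕜 k d)) := by
      refine Pois.hom_ext ?_ ?_
      · change TensorProduct.assoc 𝕜 _ _ _ (((Pois.comulHom 𝕜 k d).comul _).rTensor _
          ((Pois.comulHom 𝕜 k d).comul _ _)) =
            ((Pois.comulHom 𝕜 k d).comul _).lTensor _ ((Pois.comulHom 𝕜 k d).comul _ _)
        simp only [Pois.comulHom_mu, LinearMap.rTensor_tmul, LinearMap.lTensor_tmul,
          TensorProduct.assoc_tmul]
      · change TensorProduct.assoc 𝕜 _ _ _ (((Pois.comulHom 𝕜 k d).comul _).rTensor _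
          ((Pois.comulHom 𝕜 k d).comul _ _)) =
            ((Pois.comulHom 𝕜 k d).comul _).lTensor _ ((Pois.comulHom 𝕜 k d).comul _ _)
        -- Since the iterated product is group-like, both sides are the sum of the three tensors
        -- with `ν` in one factor and the iterated product in the other two.
        simp only [Pois.comulHom_nu, Pois.comulHom_iterMul, map_add, LinearMap.rTensor_tmul,
          LinearMap.lTensor_tmul, TensorProduct.assoc_tmul, TensorProduct.add_tmul,
          TensorProduct.tmul_add, add_assoc]
    exact LinearMap.congr_fun (congrArg (fun f : Hom _ _ => f.app I) h) x
  cocomm I _ x := by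
    have h : (Pois.comulHom 𝕜 k d).trans (Hom.tensorSwap _ _) = Pois.comulHom 𝕜 k d := by
      refine Pois.hom_ext ?_ ?_
      · change koszulSwap _ _ ((Pois.comulHom 𝕜 k d).comul _ _) = (Pois.comulHom 𝕜 k d).comul _ _
        rw [Pois.comulHom_mu, koszulSwap_tmul _ _ (Pois.isPois 𝕜 k d).mem (Pois.isPois 𝕜 k d).mem,
          mul_zero, zsign_zero, one_smul]
      · change koszulSwap _ _ ((Pois.comulHom 𝕜 k d).comul _ _) = (Pois.comulHom 𝕜 k d).comul _ _
        -- The iterated product has degree `0`, so the symmetry just exchanges the two summands,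
        -- without a sign.
        rw [Pois.comulHom_nu, map_add, koszulSwap_tmul _ _ ((Pois.isPois 𝕜 k d).iterMul_mem k)
          (Pois.isPois 𝕜 k d).bracket_mem, koszulSwap_tmul _ _ (Pois.isPois 𝕜 k d).bracket_mem
          ((Pois.isPois 𝕜 k d).iterMul_mem k), mul_zero, zero_mul, zsign_zero, one_smul, one_smul]
        exact add_comm _ _
    exact LinearMap.congr_fun (congrArg (fun f : Hom _ _ => f.app I) h) x

/-- The counit takes the value `1` on every total product. This gives the section `η` of `ε`, and
thereby the surjectivity of `ε`. -/
theorem Pois.counitHom_ofCom (I : Type) [Finite I] (c : (Com 𝕜).obj I) :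
    (Pois.counitHom 𝕜 k d).app I ((Hom.ofCom (Pois.isPois 𝕜 k d).toIsComm).app I c) = c := by
  refine Subtype.ext ?_
  change (Pois.counitHom 𝕜 k d).counit I (comVal 𝕜 I c • totalMulOrZero _ _ I) = comVal 𝕜 I c
  rw [map_smul]
  rcases isEmpty_or_nonempty I with hI | hI
  · rw [comVal_eq_zero_of_isEmpty, zero_smul]
  · rw [totalMulOrZero_of_nonempty, Pois.counitHom_totalMul, smul_eq_mul, mul_one]

/-- Recognizes the left-hand side of the counit identity as a component of a composite of operad
morphisms, so that it can be tested on generators. -/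
theorem Pois.lid_counit_app (I : Type) [Finite I] (x : (Pois 𝕜 k d).obj I) :
    (((Pois.comulHom 𝕜 k d).trans ((Pois.counitHom 𝕜 k d).tensorMap (Hom.id (Pois 𝕜 k d)))).trans
        (Hom.comTensor _)).app I x =
      TensorProduct.lid 𝕜 ((Pois 𝕜 k d).obj I)
        (((Pois.counitHom 𝕜 k d).counit I).rTensor _ ((Pois.comulHom 𝕜 k d).comul I x)) :=
  congrArg (TensorProduct.lid 𝕜 ((Pois 𝕜 k d).obj I))
    (LinearMap.congr_fun (TensorProduct.map_comp (comVal 𝕜 I) LinearMap.id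
      ((Pois.counitHom 𝕜 k d).app I) LinearMap.id).symm ((Pois.comulHom 𝕜 k d).comul I x))

theorem Pois.rid_counit_app (I : Type) [Finite I] (x : (Pois 𝕜 k d).obj I) :
    (((Pois.comulHom 𝕜 k d).trans ((Hom.id (Pois 𝕜 k d)).tensorMap (Pois.counitHom 𝕜 k d))).trans
        (Hom.tensorCom _)).app I x =
      TensorProduct.rid 𝕜 ((Pois 𝕜 k d).obj I)
        (((Pois.counitHom 𝕜 k d).counit I).lTensor _ ((Pois.comulHom 𝕜 k d).comul I x)) :=
  congrArg (TensorProduct.rid 𝕜 ((Pois 𝕜 k d).obj I))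
    (LinearMap.congr_fun (TensorProduct.map_comp LinearMap.id (comVal 𝕜 I)
      LinearMap.id ((Pois.counitHom 𝕜 k d).app I)).symm ((Pois.comulHom 𝕜 k d).comul I x))

/-- On `ν` the counit kills the summand in which it meets `ν` and takes the value `1` on the
iterated product in the other, so `ν` remains. -/
theorem Pois.isUnital (𝕜 : Type u) [Field 𝕜] (k : ℕ) (d : ℤ) :
    IsUnital (Pois.comulHom 𝕜 k d) (Pois.counitHom 𝕜 k d) where
  counit_comul I _ x := by
    have h : ((Pois.comulHom 𝕜 k d).trans
        ((Pois.counitHom 𝕜 k d).tensorMap (Hom.id (Pois 𝕜 k d)))).trans (Hom.comTensor _) =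
          Hom.id _ := by
      refine Pois.hom_ext ?_ ?_
      · refine (Pois.lid_counit_app _ _).trans ?_
        rw [Pois.comulHom_mu, LinearMap.rTensor_tmul, Pois.counitHom_mu, TensorProduct.lid_tmul,
          one_smul]
        rfl
      · refine (Pois.lid_counit_app _ _).trans ?_
        rw [Pois.comulHom_nu, map_add, LinearMap.rTensor_tmul, LinearMap.rTensor_tmul,
          Pois.counitHom_nu, Pois.counitHom_iterMul, TensorProduct.zero_tmul, add_zero,
          TensorProduct.lid_tmul, one_smul]
        rfl
    rw [← Pois.lid_counit_app, h]
    rfl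
  comul_counit I _ x := by
    have h : ((Pois.comulHom 𝕜 k d).trans
        ((Hom.id (Pois 𝕜 k d)).tensorMap (Pois.counitHom 𝕜 k d))).trans (Hom.tensorCom _) =
          Hom.id _ := by
      refine Pois.hom_ext ?_ ?_
      · refine (Pois.rid_counit_app _ _).trans ?_
        rw [Pois.comulHom_mu, LinearMap.lTensor_tmul, Pois.counitHom_mu, TensorProduct.rid_tmul,
          one_smul]
        rfl
      · refine (Pois.rid_counit_app _ _).trans ?_
        rw [Pois.comulHom_nu, map_add, LinearMap.lTensor_tmul, LinearMap.lTensor_tmul,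
          Pois.counitHom_nu, Pois.counitHom_iterMul, TensorProduct.tmul_zero, zero_add,
          TensorProduct.rid_tmul, one_smul]
        rfl
    rw [← Pois.rid_counit_app, h]
    rfl
  surjective I _ c := ⟨_, Pois.counitHom_ofCom I c⟩

theorem Pois.isAugmented (𝕜 : Type u) [Field 𝕜] (k : ℕ) (d : ℤ) :
    IsAugmented (Pois.comulHom 𝕜 k d) (Pois.counitHom 𝕜 k d)
      (Hom.ofCom (Pois.isPois 𝕜 k d).toIsComm) (Pois.mu 𝕜 k d) where
  comul_app I _ _ := by rw [Hom.ofCom_app_one, Pois.comulHom_totalMul]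
  counit_app I _ c := Pois.counitHom_ofCom I c
  app_one := by rw [Hom.ofCom_app_one, (Pois.isPois 𝕜 k d).totalMul_fin_two]

end HopfStructure

end

theorem mainTheorem12 {𝕜 : Type u} [Field 𝕜] (k : ℕ) (hk : 1 ≤ k) (d : ℤ) :
    ∃ Δ : GrOperad.Hom (Pois 𝕜 k d) ((Pois 𝕜 k d).tensor (Pois 𝕜 k d)),
      (Δ.comul (Fin 2) (Pois.mu 𝕜 k d) = Pois.mu 𝕜 k d ⊗ₜ[𝕜] Pois.mu 𝕜 k d ∧
        Δ.comul (Fin (k + 1)) (Pois.nu 𝕜 k d) =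
          (Pois 𝕜 k d).iterMul (Pois.mu 𝕜 k d) k ⊗ₜ[𝕜] Pois.nu 𝕜 k d +
            Pois.nu 𝕜 k d ⊗ₜ[𝕜] (Pois 𝕜 k d).iterMul (Pois.mu 𝕜 k d) k) ∧
      (∀ Δ' : GrOperad.Hom (Pois 𝕜 k d) ((Pois 𝕜 k d).tensor (Pois 𝕜 k d)),
        Δ'.comul (Fin 2) (Pois.mu 𝕜 k d) = Pois.mu 𝕜 k d ⊗ₜ[𝕜] Pois.mu 𝕜 k d →
        Δ'.comul (Fin (k + 1)) (Pois.nu 𝕜 k d) =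
          (Pois 𝕜 k d).iterMul (Pois.mu 𝕜 k d) k ⊗ₜ[𝕜] Pois.nu 𝕜 k d +
            Pois.nu 𝕜 k d ⊗ₜ[𝕜] (Pois 𝕜 k d).iterMul (Pois.mu 𝕜 k d) k →
        Δ' = Δ) ∧
      GrOperad.IsHopf Δ ∧
      (∃ (ε : GrOperad.Hom (Pois 𝕜 k d) (Com 𝕜)) (η : GrOperad.Hom (Com 𝕜) (Pois 𝕜 k d)),
        GrOperad.IsUnital Δ ε ∧ GrOperad.IsAugmented Δ ε η (Pois.mu 𝕜 k d)) ∧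
      GrOperad.IsPrimitiveGenerator Δ (Pois.mu 𝕜 k d) (Pois.nu 𝕜 k d) :=
  ⟨Pois.comulHom 𝕜 k d, ⟨Pois.comulHom_mu, Pois.comulHom_nu⟩,
    fun _ hmu hnu => Pois.hom_ext (hmu.trans Pois.comulHom_mu.symm)
      (hnu.trans Pois.comulHom_nu.symm),
    Pois.isHopf 𝕜 k d,
    ⟨Pois.counitHom 𝕜 k d, GrOperad.Hom.ofCom (Pois.isPois 𝕜 k d).toIsComm, Pois.isUnital 𝕜 k d,
      Pois.isAugmented 𝕜 k d⟩,
    ⟨Pois.comulHom_nu, fun S hmu hnu I _ => Pois.suboperad_eq_top S hmu hnu I⟩⟩
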